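/- Let $\mathbb{D}$ be the open unit disk, $\mathbb{T}$ the unit circle, $dA=dx\,dy/\pi$ the normalized area measure on $\mathbb{D}$, and $D(z,r)=\{w\in\mathbb{D}:|z-w|<r|1-\bar z w|\}$ the pseudohyperbolic disk. For an interval $I\subseteq\mathbb{T}$ let $|I|$ be its normalized arc length and $S(I)=\{z\in\mathbb{D}: z/|z|\in I,\ 1-|I|\le|z|<1\}$. A positive Borel measure $\nu$ on $\mathbb{D}$ is a vanishing $s$-Carleson measure if $\lim_{|I|\to0}\nu(S(I))/|I|^{s}=0$, i.e. for every $\varepsilon>0$ there is $r_0\in(0,1)$ such that $\nu(S(I))\le\varepsilon|I|^s$ for all intervals $I\subseteq\mathbb{T}$ with $0<|I|\le r_0$. The class $\mathcal{D}$ consists of the integrable radial functions $\omega\ge0$ on $\mathbb{D}$, not almost everywhere zero, for which $\widehat\omega(z)=\int_{|z|}^1\omega(t)\,dt$ satisfies, with some constants $C_1,C_2\in(1,\infty)$ and $C_3\in[1,\infty)$, $$C_1\,\widehat\omega\Big(1-\frac{1-r}{C_2}\Big)\le\widehat\omega(r)\le C_3\,\widehat\omega\Big(\frac{1+r}{2}\Big),\qquad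 r\in[0,1).$$ For $0<p<\infty$, $L^p_a(\omega)$ is the space of analytic functions $f$ on $\mathbb{D}$ with $\|f\|_{L^p_a(\omega)}=\big(\int_{\mathbb{D}}|f|^p\omega\,dA\big)^{1/p}<\infty$. Let $\omega\in\mathcal{D}$, $\kappa(z)=\widehat\omega(z)/(1-|z|)$, $\kappa(E)=\int_E\kappa\,dA$, and let $\mu$ be a positive Borel measure on $\mathbb{D}$. Let $p\in(0,\infty)$, $s\in[1,\infty)$ and $\iota\in(0,1)$. Then the following statements are equivalent: (i) for some $\delta\in(0,1)$, $\Big(\frac{\mu(D(z,\delta))}{\kappa(D(z,\delta))}\Big)^{\frac1{1-\iota}}\kappa(z)\,dA(z)$ is a vanishing $s$-Carleson measure; (ii) the measures $|f|^{p\iota}d\mu$, $f\in L^p_a(\omega)$, are vanishing $s(1-\iota)$-Carleson measures uniformly in $f$: there is a constant $C>0$ such that for every $\varepsilon>0$ there exists $r_0\in(0,1)$ such that for every $f\in L^p_a(\omega)$ and every interval $I\subseteq\mathbb{T}$ with $0<|I|\le r_0$, $$\frac{\int_{S(I)}|f|^{p\iota}\,d\mu}{|I|^{s(1-\iota)}}\le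 C\,\varepsilon\,\|f\|_{L^p_a(\omega)}^{p\iota}.$$ -/

import Mathlib

open MeasureTheory
open scoped ENNReal

noncomputable section

namespace WeightedBergman

/-- The open unit disk `𝔻` of the complex plane. -/
def disk : Set ℂ := Metric.ball 0 1

/-- The normalized area measure `dA = dx dy / π` on the unit disk. -/
def area : Measure ℂ := ENNReal.ofReal Real.pi⁻¹ • volume.restrict disk

/-- The tail `ω̂(r) = ∫_r^1 ω(t) dt` of a radial weight. -/
def tail (ω : ℂ → ℝ) (r : ℝ) : ℝ≥0∞ := ∫⁻ t in Set.Ioo r 1, ENNReal.ofReal (ω (t : ℂ))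

/-- The class `𝒟` of integrable radial weights on the unit disk satisfying the reverse and the
forward doubling condition. A weight may vanish at some points, but not almost everywhere. -/
structure IsDWeight (ω : ℂ → ℝ) : Prop where
  nonneg : ∀ z ∈ disk, 0 ≤ ω z
  radial : ∀ z ∈ disk, ∀ w ∈ disk, ‖z‖ = ‖w‖ → ω z = ω w
  integrable : IntegrableOn ω disk area
  nontrivial : 0 < tail ω 0
  reverse_doubling : ∃ C₁ C₂ : ℝ, 1 < C₁ ∧ 1 < C₂ ∧ ∀ r ∈ Set.Ico (0 : ℝ) 1,
    ENNReal.ofReal C₁ * tail ω (1 - (1 - r) / C₂) ≤ tail ω r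
  forward_doubling : ∃ C₃ : ℝ, 1 ≤ C₃ ∧ ∀ r ∈ Set.Ico (0 : ℝ) 1,
    tail ω r ≤ ENNReal.ofReal C₃ * tail ω ((1 + r) / 2)

/-- The function `κ(z) = ω̂(z) / (1 - |z|)` attached to a radial weight `ω`. -/
def kappa (ω : ℂ → ℝ) (z : ℂ) : ℝ≥0∞ := tail ω ‖z‖ / ENNReal.ofReal (1 - ‖z‖)

/-- `κ(E) = ∫_E κ dA`. -/
def kappaMass (ω : ℂ → ℝ) (E : Set ℂ) : ℝ≥0∞ := ∫⁻ z in E, kappa ω z ∂area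

/-- The pseudohyperbolic disk `D(z, r)`. -/
def pseudoDisk (z : ℂ) (r : ℝ) : Set ℂ :=
  {w | w ∈ disk ∧ ‖(z - w) / (1 - starRingEnd ℂ z * w)‖ < r}

/-- The point `exp (2 π i t)` of the unit circle. -/
def circlePoint (t : ℝ) : ℂ := Complex.exp (2 * Real.pi * t * Complex.I)

/-- Intervals of the unit circle: images of (open, closed, half-open) intervals of the line. -/
def IsArc (I : Set ℂ) : Prop := ∃ J : Set ℝ, J.OrdConnected ∧ I = circlePoint '' J

/-- The normalized arc measure `|I|` of a subset of the unit circle. -/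
def arcLength (I : Set ℂ) : ℝ≥0∞ := volume {t : ℝ | t ∈ Set.Ico (0 : ℝ) 1 ∧ circlePoint t ∈ I}

/-- The Carleson square `S(I) = {z ∈ 𝔻 : z / |z| ∈ I, 1 - |I| ≤ |z| < 1}`. -/
def carlesonSquare (I : Set ℂ) : Set ℂ :=
  {z | z ∈ disk ∧ z / (‖z‖ : ℂ) ∈ I ∧ 1 - (arcLength I).toReal ≤ ‖z‖}

/-- `ν` is a vanishing `s`-Carleson measure: `ν(S(I)) / |I|^s → 0` as `|I| → 0`. -/
def IsVanishingCarleson (s : ℝ) (ν : Measure ℂ) : Prop :=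
  ∀ ε : ℝ, 0 < ε → ∃ r₀ ∈ Set.Ioo (0 : ℝ) 1, ∀ I : Set ℂ, IsArc I →
    0 < arcLength I → arcLength I ≤ ENNReal.ofReal r₀ →
      ν (carlesonSquare I) / arcLength I ^ s ≤ ENNReal.ofReal ε

/-- The (quasi-)norm `‖f‖ = (∫_𝔻 |f|^p ω dA)^{1/p}`, with value `∞` allowed. -/
def bergmanNorm (p : ℝ) (ω : ℂ → ℝ) (f : ℂ → ℂ) : ℝ≥0∞ :=
  (∫⁻ z, ‖f z‖ₑ ^ p * ENNReal.ofReal (ω z) ∂area) ^ (1 / p)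

/-- Membership in the weighted Bergman space `L^p_a(ω)`. -/
def MemBergman (p : ℝ) (ω : ℂ → ℝ) (f : ℂ → ℂ) : Prop :=
  DifferentiableOn ℂ f disk ∧ bergmanNorm p ω f < ∞

/-- The measure `(μ(D(z,δ)) / κ(D(z,δ)))^{1/(1-ι)} κ(z) dA(z)`. -/
def averagedMeasure (ω : ℂ → ℝ) (μ : Measure ℂ) (ι δ : ℝ) : Measure ℂ :=
  area.withDensity fun z =>
    (μ (pseudoDisk z δ) / kappaMass ω (pseudoDisk z δ)) ^ (1 / (1 - ι)) * kappa ω z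

/-- The measures `|f|^{pι} dμ`, `f ∈ L^p_a(ω)`, are vanishing `s(1-ι)`-Carleson measures,
uniformly with respect to the norm of `f`. -/
def UniformlyVanishing (p s ι : ℝ) (ω : ℂ → ℝ) (μ : Measure ℂ) : Prop :=
  ∃ C : ℝ, 0 < C ∧ ∀ ε : ℝ, 0 < ε → ∃ r₀ ∈ Set.Ioo (0 : ℝ) 1,
    ∀ f : ℂ → ℂ, MemBergman p ω f → ∀ I : Set ℂ, IsArc I →
      0 < arcLength I → arcLength I ≤ ENNReal.ofReal r₀ →
        (∫⁻ z in carlesonSquare I, ‖f z‖ₑ ^ (p * ι) ∂μ) / arcLength I ^ (s * (1 - ι)) ≤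
          ENNReal.ofReal (C * ε) * bergmanNorm p ω f ^ (p * ι)

end WeightedBergman

end

namespace WeightedBergman

open Real Set Metric

/-! Both conditions are equivalent to one discrete condition. Choose points `a` of the disk such
that the balls of radius `c(1-|a|)` are disjoint and their fivefold enlargements `R_a` cover. Put
`m_a = ω̂(a)(1-|a|)`, which is comparable to the κ-mass of a hyperbolic disk about `a`, and `T_a =
(μ(R_a)/m_a)^{1/(1-ι)} m_a`. The condition is that the sum of `T_a` over `|a-ζ| ≤ ℓ` is `o(ℓ^s)`
uniformly in `ζ ∈ 𝕋` (`CellVanishing`). Since κ is nearly constant on a cell, (i) is the integral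
form of this sum (`cellVanishing_of_ballVanishing`, `ballVanishing_of_cellVanishing`).

Discrete ⇒ (ii). Subharmonicity gives `|f|^p ≤ C P_a/m_a` on `R_a`, where `P_a` is the integral of
`|f|^p κ` near `a`. Since `μ(R_a) = T_a^{1-ι} m_a^ι`, the factor `m_a` cancels and `∫_{R_a} |f|^{pι}
dμ ≤ C P_a^ι T_a^{1-ι}`. Hölder with exponents `1/ι`, `1/(1-ι)` then separates the sums. Bounded
overlap of the cells and the equivalence of the ω- and κ-norms (`exists_kappaIntegral_equiv`) give
`∑ P_a ≤ C‖f‖^p`.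

(ii) ⇒ discrete. Test on `f = ∑ ± x_a b_a^M`, where `b_a` is a normalised Cauchy kernel and `|x_a|^p
m_a = T_a`. The synthesis estimate `exists_sum_bump_le` gives `‖f‖^p ≤ C ∑ T_a` for every choice of
signs. Averaging over signs isolates the single terms, and on `R_a` the term of `a` contributes
about `(T_a/m_a)^ι μ(R_a) = T_a`. Hence `∑ T_a ≤ C D (∑ T_a)^ι`, with `D` the constant in (ii) for
the given boundary ball, and one divides by `(∑ T_a)^ι`.

The class 𝒟 enters through two power bounds on `ω̂` (`IsPowerDoubling`). They yield the equivalence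
of norms and, with the Forelli–Rudin estimate, the integrals of kernels against κ. -/

/-! ### Subharmonicity of `|f|^p` and growth of its circular means -/

/-- Jensen's formula: the difference of the two sides is a sum over the zeros `u` of multiplicity
times `log (R/|c-u|)`, and every term is nonnegative. -/
lemma log_norm_le_circleAverage {f : ℂ → ℂ} {c : ℂ} {R : ℝ} (hR : 0 < R)
    (hf : AnalyticOnNhd ℂ f (closedBall c R)) (hc : f c ≠ 0) :
    Real.log ‖f c‖ ≤ circleAverage (fun z => Real.log ‖f z‖) c R := by
  have habs : |R| = R := abs_of_pos hR
  rw [AnalyticOnNhd.circleAverage_log_norm hR.ne' (by rwa [habs]) hc, habs]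
  have : 0 ≤ ∑ᶠ u, ((MeromorphicOn.divisor f (closedBall c R) u : ℤ) : ℝ) *
      Real.log (R * ‖c - u‖⁻¹) := by
    refine finsum_nonneg fun u => ?_
    by_cases hu : u ∈ closedBall c R
    · refine mul_nonneg (by exact_mod_cast MeromorphicOn.AnalyticOnNhd.divisor_nonneg hf u) ?_
      rcases eq_or_ne u c with rfl | hne
      · simp
      have hpos : 0 < ‖c - u‖ := norm_pos_iff.mpr (sub_ne_zero.mpr hne.symm)
      apply Real.log_nonneg
      rw [← div_eq_mul_inv, one_le_div hpos, ← dist_eq_norm, dist_comm]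
      exact mem_closedBall.mp hu
    · simp [hu]
  linarith

/-- The tangent line inequality `e·p·log t ≤ t^p` is an equality at `t = exp (1/p)`. After scaling
`f` so that `|f(c)|` is this value, averaging the inequality turns the submean property of `log |f|`
into that of `|f|^p`. -/
lemma norm_rpow_le_circleAverage {f : ℂ → ℂ} {c : ℂ} {R p : ℝ} (hp : 0 < p) (hR : 0 < R)
    (hf : AnalyticOnNhd ℂ f (closedBall c R)) :
    ‖f c‖ ^ p ≤ circleAverage (fun z => ‖f z‖ ^ p) c R := by
  have habs : |R| = R := abs_of_pos hR
  rcases eq_or_ne (f c) 0 with h0 | h0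
  · rw [h0, norm_zero, Real.zero_rpow hp.ne']
    exact circleAverage_nonneg_of_nonneg fun z _ => by positivity
  have hfc : 0 < ‖f c‖ := norm_pos_iff.mpr h0
  -- normalise so that the value at the centre has modulus `exp (1 / p)`
  set k : ℂ := (Real.exp (1 / p) : ℂ) / f c with hk
  have hknorm : ‖k‖ = Real.exp (1 / p) / ‖f c‖ := by
    rw [hk, norm_div, Complex.norm_real, Real.norm_of_nonneg (exp_pos _).le]
  have hkpos : 0 < ‖k‖ := by rw [hknorm]; positivity
  have hg : AnalyticOnNhd ℂ (fun z => k * f z) (closedBall c R) :=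
    fun z hz => analyticAt_const.mul (hf z hz)
  have hgc : ‖k * f c‖ = Real.exp (1 / p) := by
    rw [norm_mul, hknorm]; field_simp
  have hgc0 : k * f c ≠ 0 := by
    rw [← norm_pos_iff, hgc]; positivity
  have hlog := log_norm_le_circleAverage hR hg hgc0
  rw [hgc, Real.log_exp] at hlog
  have hcont : ContinuousOn (fun z => ‖f z‖ ^ p) (sphere c R) :=
    (hf.continuousOn.mono sphere_subset_closedBall).norm.rpow_const fun _ _ => Or.inr hp.le
  have hmono : circleAverage (fun z => (p * Real.exp 1) • Real.log ‖k * f z‖) c R ≤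
      circleAverage (fun z => (‖k‖ ^ p) • ‖f z‖ ^ p) c R := by
    refine circleAverage_mono ?_ ?_ ?_
    · refine CircleIntegrable.const_smul (f := fun z => Real.log ‖k * f z‖) ?_
      exact MeromorphicOn.circleIntegrable_log_norm
        ((hg.mono (by rw [habs]; exact sphere_subset_closedBall)).meromorphicOn)
    · exact ContinuousOn.circleIntegrable hR.le (by fun_prop)
    · intro z _
      simp only [smul_eq_mul]
      rw [← Real.mul_rpow (norm_nonneg _) (norm_nonneg _), ← norm_mul]
      rcases eq_or_ne (k * f z) 0 with hz | hz
      · simp [hz, Real.zero_rpow hp.ne']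
      have hzpos := norm_pos_iff.mpr hz
      rw [Real.rpow_def_of_pos hzpos]
      have h1 := Real.add_one_le_exp (Real.log ‖k * f z‖ * p - 1)
      rw [Real.exp_sub, le_div_iff₀ (exp_pos 1)] at h1
      linarith
  rw [circleAverage_fun_smul, circleAverage_fun_smul, smul_eq_mul, smul_eq_mul] at hmono
  have h2 : Real.exp 1 ≤ ‖k‖ ^ p * circleAverage (fun z => ‖f z‖ ^ p) c R := by
    refine le_trans ?_ hmono
    calc Real.exp 1 = p * Real.exp 1 * (1 / p) := by field_simp
      _ ≤ _ := by gcongr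
  have h3 : ‖k‖ ^ p * ‖f c‖ ^ p = Real.exp 1 := by
    rw [← Real.mul_rpow (norm_nonneg _) (norm_nonneg _), ← norm_mul, hgc, ← Real.exp_mul]
    congr 1; field_simp
  rw [← h3] at h2
  exact le_of_mul_le_mul_left h2 (by positivity)

lemma circleMap_add_angle (z : ℂ) (ρ φ θ : ℝ) :
    circleMap (z * Complex.exp (θ * Complex.I)) ρ (φ + θ) =
      circleMap z ρ φ * Complex.exp (θ * Complex.I) := by
  simp only [circleMap, Complex.ofReal_add, add_mul, Complex.exp_add]
  ring

lemma circleMap_zero_norm (g : ℂ → ℝ) (z : ℂ) :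
    circleAverage g 0 ‖z‖ =
      (2 * π)⁻¹ * ∫ θ in (0 : ℝ)..2 * π, g (z * Complex.exp (θ * Complex.I)) := by
  rw [circleAverage_eq_integral_add z.arg, smul_eq_mul]
  congr 2 with θ
  have : circleMap 0 ‖z‖ (θ + z.arg) = z * Complex.exp (θ * Complex.I) := by
    conv_rhs => rw [← Complex.norm_mul_exp_arg_mul_I z]
    simp only [circleMap, Complex.ofReal_add, add_mul, Complex.exp_add]
    ring
  rw [this]

/-- The circular means of a continuous function are submean if the function is. -/
lemma circleAverage_norm_le {g : ℂ → ℝ} (hg : Continuous g) {z : ℂ} {ρ : ℝ}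
    (hsub : ∀ θ : ℝ, g (z * Complex.exp (θ * Complex.I)) ≤
      circleAverage g (z * Complex.exp (θ * Complex.I)) ρ) :
    circleAverage g 0 ‖z‖ ≤ circleAverage (fun w => circleAverage g 0 ‖w‖) z ρ := by
  have hpi : (0 : ℝ) ≤ 2 * π := by positivity
  have h1 : ∀ θ : ℝ, circleAverage g (z * Complex.exp (θ * Complex.I)) ρ =
      (2 * π)⁻¹ * ∫ φ in (0 : ℝ)..2 * π, g (circleMap z ρ φ * Complex.exp (θ * Complex.I)) := by
    intro θ
    rw [circleAverage_eq_integral_add θ, smul_eq_mul]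
    simp_rw [circleMap_add_angle]
  have hc2 : Continuous fun q : ℝ × ℝ =>
      g (circleMap z ρ q.2 * Complex.exp (q.1 * Complex.I)) := by
    fun_prop
  calc circleAverage g 0 ‖z‖
      = (2 * π)⁻¹ * ∫ θ in (0 : ℝ)..2 * π, g (z * Complex.exp (θ * Complex.I)) :=
        circleMap_zero_norm g z
    _ ≤ (2 * π)⁻¹ * ∫ θ in (0 : ℝ)..2 * π,
          (2 * π)⁻¹ * ∫ φ in (0 : ℝ)..2 * π,
            g (circleMap z ρ φ * Complex.exp (θ * Complex.I)) := by
        refine mul_le_mul_of_nonneg_left ?_ (by positivity)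
        refine intervalIntegral.integral_mono_on hpi ?_ ?_ fun θ _ => ?_
        · exact Continuous.intervalIntegrable (by fun_prop) _ _
        · refine Continuous.intervalIntegrable (continuous_const.mul ?_) _ _
          exact intervalIntegral.continuous_parametric_intervalIntegral_of_continuous' hc2 _ _
        · rw [← h1]; exact hsub θ
    _ = (2 * π)⁻¹ * ∫ φ in (0 : ℝ)..2 * π,
          (2 * π)⁻¹ * ∫ θ in (0 : ℝ)..2 * π,
            g (circleMap z ρ φ * Complex.exp (θ * Complex.I)) := by
        simp_rw [intervalIntegral.integral_const_mul]
        congr 2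
        refine intervalIntegral_intervalIntegral_swap ?_
        refine (Continuous.integrableOn_Icc (a := ((0 : ℝ), (0 : ℝ))) (b := (2 * π, 2 * π))
          hc2).mono_set ?_
        rw [← Icc_prod_Icc]
        exact Set.prod_mono (by rw [uIoc_of_le hpi]; exact Ioc_subset_Icc_self)
          (by rw [uIoc_of_le hpi]; exact Ioc_subset_Icc_self)
    _ = _ := by
        rw [circleAverage_def, smul_eq_mul]
        simp_rw [circleMap_zero_norm g]

/-- A maximum principle for the radial function `w ↦ M(|w|)`, which inherits the submean property.
If its maximum `m` over `[0, R]` is attained at some `y < R` while `M(R) < m`, the circle about `y`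
of radius `R - y` touches `|w| = R`. The average over that circle is then strictly below `m = M(y)`,
a contradiction. -/
lemma circleAverage_mono_radius_of_continuous {g : ℂ → ℝ} (hg : Continuous g) {R : ℝ}
    (hsub : ∀ z ρ, 0 < ρ → ‖z‖ + ρ ≤ R → g z ≤ circleAverage g z ρ) {r : ℝ} (hr : 0 ≤ r)
    (hrR : r ≤ R) : circleAverage g 0 r ≤ circleAverage g 0 R := by
  by_contra! hlt
  have hcont : Continuous (circleAverage g 0) := hg.circleAverage
  obtain ⟨x, hx, hmax⟩ := isCompact_Icc.exists_isMaxOn (nonempty_Icc.mpr (hr.trans hrR))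
    hcont.continuousOn (s := Icc 0 R)
  set m := circleAverage g 0 x
  have hKc : IsCompact (Icc 0 R ∩ {t | m ≤ circleAverage g 0 t}) :=
    isCompact_Icc.inter_right (isClosed_le continuous_const hcont)
  obtain ⟨y, ⟨hy, hym⟩, hymax⟩ := hKc.exists_isMaxOn ⟨x, hx, le_refl m⟩ continuousOn_id
  have hmle : ∀ t ∈ Icc 0 R, circleAverage g 0 t ≤ m := fun t ht => hmax ht
  have hRm : circleAverage g 0 R < m := hlt.trans_le (hmle r ⟨hr, hrR⟩)
  have hyR : y < R := lt_of_le_of_ne hy.2 (by rintro rfl; exact absurd hym (not_le.mpr hRm))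
  have hyn : ‖(y : ℂ)‖ = y := by simp [abs_of_nonneg hy.1]
  have hρ : 0 < R - y := sub_pos.mpr hyR
  have h1 := circleAverage_norm_le hg (z := y) (ρ := R - y) (fun θ => hsub _ _ hρ (by
    rw [norm_mul, hyn, Complex.norm_exp_ofReal_mul_I]; linarith))
  rw [hyn] at h1
  have h2 : circleAverage (fun w => circleAverage g 0 ‖w‖) y (R - y) < m := by
    rw [circleAverage_def, smul_eq_mul, inv_mul_lt_iff₀ (by positivity)]
    have hint : ∫ θ in (0 : ℝ)..2 * π, m = 2 * π * m := by
      simp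
    rw [← hint]
    refine intervalIntegral.integral_lt_integral_of_continuousOn_of_le_of_exists_lt
      (by positivity) ?_ continuousOn_const ?_ ⟨0, ⟨le_rfl, by positivity⟩, ?_⟩
    · exact (hcont.comp (continuous_norm.comp (continuous_circleMap _ _))).continuousOn
    · intro θ _
      refine hmle _ ⟨norm_nonneg _, ?_⟩
      refine (norm_add_le _ _).trans ?_
      rw [hyn, norm_mul, Complex.norm_exp_ofReal_mul_I, Complex.norm_real, Real.norm_of_nonneg hρ.le]
      linarith
    · have : ‖circleMap (y : ℂ) (R - y) 0‖ = R := by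
        simp [circleMap, abs_of_nonneg (hr.trans hrR)]
      rw [this]; exact hRm
  exact absurd (hym.trans h1) (not_le.mpr h2)

lemma circleAverage_norm_rpow_mono {f : ℂ → ℂ} (hf : DifferentiableOn ℂ f disk) {p : ℝ}
    (hp : 0 < p) {r R : ℝ} (hr : 0 ≤ r) (hrR : r ≤ R) (hR : R < 1) :
    circleAverage (fun z => ‖f z‖ ^ p) 0 r ≤ circleAverage (fun z => ‖f z‖ ^ p) 0 R := by
  have hsubset : closedBall (0 : ℂ) R ⊆ disk := closedBall_subset_ball hR
  have han : AnalyticOnNhd ℂ f disk := hf.analyticOnNhd isOpen_ball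
  have hc : ContinuousOn (fun z => ‖f z‖ ^ p) (closedBall (0 : ℂ) R) :=
    (hf.continuousOn.mono hsubset).norm.rpow_const fun _ _ => Or.inr hp.le
  -- Tietze extension: the comparison of means is stated for functions continuous on all of `ℂ`, and
  -- only values on the closed ball of radius `R` matter.
  obtain ⟨G, hG⟩ := ContinuousMap.exists_restrict_eq (isClosed_closedBall (x := (0 : ℂ)) (ε := R))
    ⟨_, hc.domRestrict⟩
  have hGe : ∀ z ∈ closedBall (0 : ℂ) R, G z = ‖f z‖ ^ p := fun z hz => by
    have := congrArg (fun k => k ⟨z, hz⟩) hG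
    simpa using this
  have hGavg : ∀ (z : ℂ) (ρ : ℝ), 0 ≤ ρ → ‖z‖ + ρ ≤ R →
      circleAverage G z ρ = circleAverage (fun z => ‖f z‖ ^ p) z ρ := by
    intro z ρ hρ h
    refine circleAverage_congr_sphere fun w hw => hGe w ?_
    rw [abs_of_nonneg hρ] at hw
    have := norm_le_norm_add_norm_sub' w z
    rw [mem_sphere_iff_norm] at hw
    rw [mem_closedBall_zero_iff]; linarith
  rw [← hGavg 0 r hr (by simpa using hrR), ← hGavg 0 R (hr.trans hrR) (by simp)]
  refine circleAverage_mono_radius_of_continuous G.continuous (fun z ρ hρ h => ?_) hr hrR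
  rw [hGavg z ρ hρ.le h, hGe z (by rw [mem_closedBall_zero_iff]; linarith)]
  refine norm_rpow_le_circleAverage hp hρ (han.mono (subset_trans ?_ hsubset))
  exact closedBall_subset_closedBall' (by rw [dist_zero_right]; linarith)

/-! ### Polar coordinates and integrals against radial weights -/

lemma complex_polarCoord_symm_eq (r θ : ℝ) :
    Complex.polarCoord.symm (r, θ) = circleMap 0 r θ := by
  simp [circleMap, Complex.polarCoord_symm_apply, Complex.exp_mul_I]

lemma lintegral_volume_polar {F : ℂ → ℝ≥0∞} (hF : Measurable F) :
    ∫⁻ z, F z = ∫⁻ r in Ioi (0 : ℝ), ENNReal.ofReal r * ∫⁻ θ in Ioo (-π) π, F (circleMap 0 r θ) := by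
  have hm : Measurable fun q : ℝ × ℝ => ENNReal.ofReal q.1 * F (circleMap 0 q.1 q.2) := by
    have : Continuous fun q : ℝ × ℝ => circleMap 0 q.1 q.2 := by fun_prop
    exact (ENNReal.measurable_ofReal.comp measurable_fst).mul (hF.comp this.measurable)
  rw [← Complex.lintegral_comp_polarCoord_symm, show polarCoord.target = Ioi (0 : ℝ) ×ˢ Ioo (-π) π
    from rfl, Measure.volume_eq_prod, ← Measure.prod_restrict]
  have h1 : ∀ q : ℝ × ℝ, ENNReal.ofReal q.1 • F (Complex.polarCoord.symm q) =
      ENNReal.ofReal q.1 * F (circleMap 0 q.1 q.2) := fun q => by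
    rw [← complex_polarCoord_symm_eq, smul_eq_mul]
  simp_rw [h1]
  rw [lintegral_prod _ hm.aemeasurable]
  refine lintegral_congr fun r => ?_
  dsimp only
  exact lintegral_const_mul (f := fun θ => F (circleMap 0 r θ)) _
    (hF.comp (continuous_circleMap 0 r).measurable)

lemma lintegral_ball_polar {F : ℂ → ℝ≥0∞} (hF : Measurable F) (w : ℂ) (ρ : ℝ) :
    ∫⁻ z in ball w ρ, F z =
      ∫⁻ r in Ioo 0 ρ, ENNReal.ofReal r * ∫⁻ θ in Ioo (-π) π, F (circleMap w r θ) := by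
  have hG : Measurable fun z => (ball w ρ).indicator F (w + z) :=
    (hF.indicator measurableSet_ball).comp (measurable_const_add w)
  rw [← lintegral_indicator measurableSet_ball, ← lintegral_add_left_eq_self _ w,
    lintegral_volume_polar hG]
  have hset : Ioo (0 : ℝ) ρ = Iio ρ ∩ Ioi 0 := by rw [inter_comm, Ioi_inter_Iio]
  rw [hset, ← Measure.restrict_restrict measurableSet_Iio, ← lintegral_indicator measurableSet_Iio]
  refine setLIntegral_congr_fun measurableSet_Ioi fun r hr => ?_
  have hr0 : |r| = r := abs_of_pos hr
  have hw : ∀ θ, w + circleMap 0 r θ = circleMap w r θ := fun θ => by simp [circleMap]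
  simp only [hw]
  by_cases h1 : r < ρ
  · have : ∀ θ, circleMap w r θ ∈ ball w ρ := fun θ => by
      rw [mem_ball_iff_norm]; simpa [circleMap, hr0] using h1
    simp [this, h1]
  · have : ∀ θ, circleMap w r θ ∉ ball w ρ := fun θ => by
      rw [mem_ball_iff_norm]; simpa [circleMap, hr0] using h1
    simp [this, h1]

lemma measurableSet_disk : MeasurableSet disk := measurableSet_ball

lemma mem_disk {z : ℂ} : z ∈ disk ↔ ‖z‖ < 1 := by simp [disk]

lemma lintegral_area (F : ℂ → ℝ≥0∞) :
    ∫⁻ z, F z ∂area = ENNReal.ofReal π⁻¹ * ∫⁻ z in disk, F z := by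
  rw [area, lintegral_smul_measure, smul_eq_mul]

lemma setLIntegral_area {A : Set ℂ} (hA : MeasurableSet A) (F : ℂ → ℝ≥0∞) :
    ∫⁻ z in A, F z ∂area = ENNReal.ofReal π⁻¹ * ∫⁻ z in A ∩ disk, F z := by
  rw [area, Measure.restrict_smul, lintegral_smul_measure, smul_eq_mul, Measure.restrict_restrict hA]

lemma lintegral_area_polar {F : ℂ → ℝ≥0∞} (hF : Measurable F) :
    ∫⁻ z, F z ∂area = ENNReal.ofReal π⁻¹ * ∫⁻ r in Ioo (0 : ℝ) 1,
      ENNReal.ofReal r * ∫⁻ θ in Ioo (-π) π, F (circleMap 0 r θ) := by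
  rw [lintegral_area, disk, lintegral_ball_polar hF]

lemma lintegral_circle_eq {g : ℂ → ℝ} {c : ℂ} {r : ℝ} (hr : 0 ≤ r)
    (hg : ContinuousOn g (sphere c r)) (hg0 : ∀ z, 0 ≤ g z) :
    ∫⁻ θ in Ioo (-π) π, ENNReal.ofReal (g (circleMap c r θ)) =
      ENNReal.ofReal (2 * π * circleAverage g c r) := by
  have hcont : Continuous fun θ => g (circleMap c r θ) :=
    hg.comp_continuous (continuous_circleMap c r) fun θ => circleMap_mem_sphere c hr θ
  have h1 : 2 * π * circleAverage g c r = ∫ θ in (-π)..π, g (circleMap c r θ) := by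
    rw [circleAverage_eq_integral_add (-π), smul_eq_mul,
      intervalIntegral.integral_comp_add_right (fun θ => g (circleMap c r θ)),
      ← mul_assoc, mul_inv_cancel₀ (by positivity), one_mul]
    congr 1 <;> ring
  have hpi : -π ≤ π := by linarith [pi_pos]
  rw [h1, intervalIntegral.integral_of_le hpi, integral_Ioc_eq_integral_Ioo,
    ofReal_integral_eq_lintegral_ofReal]
  · exact (hcont.integrableOn_Icc).mono_set Ioo_subset_Icc_self
  · exact Filter.Eventually.of_forall fun θ => hg0 _

lemma lintegral_circle_enorm_rpow {f : ℂ → ℂ} {c : ℂ} {r p : ℝ} (hp : 0 < p) (hr : 0 ≤ r)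
    (hf : ContinuousOn f (sphere c r)) :
    ∫⁻ θ in Ioo (-π) π, ‖f (circleMap c r θ)‖ₑ ^ p =
      ENNReal.ofReal (2 * π * circleAverage (fun z => ‖f z‖ ^ p) c r) := by
  rw [← lintegral_circle_eq (g := fun z => ‖f z‖ ^ p) hr
    (hf.norm.rpow_const fun _ _ => Or.inr hp.le) fun z => by positivity]
  refine lintegral_congr fun θ => ?_
  rw [← ENNReal.ofReal_rpow_of_nonneg (norm_nonneg _) hp.le, ofReal_norm]

lemma measurable_indicator_disk {f : ℂ → ℂ} (hf : DifferentiableOn ℂ f disk) :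
    Measurable (disk.indicator f) := by
  classical
  have := ContinuousOn.measurable_piecewise (g := fun _ => (0 : ℂ)) hf.continuousOn
    continuousOn_const measurableSet_disk
  convert this using 1
  ext z
  simp [indicator, piecewise]

lemma measurable_indicator_disk_enorm_rpow {f : ℂ → ℂ} (hf : DifferentiableOn ℂ f disk) (p : ℝ) :
    Measurable fun z => ‖disk.indicator f z‖ₑ ^ p :=
  (measurable_indicator_disk hf).enorm.pow_const p

/-- The area form of the submean value property. -/
lemma enorm_rpow_le_lintegral_ball {f : ℂ → ℂ} (hf : DifferentiableOn ℂ f disk) {p : ℝ}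
    (hp : 0 < p) {w : ℂ} {ρ : ℝ} (hρ : 0 ≤ ρ) (hw : ball w ρ ⊆ disk) :
    ENNReal.ofReal (ρ ^ 2) * ‖f w‖ₑ ^ p ≤ ∫⁻ z in ball w ρ, ‖f z‖ₑ ^ p ∂area := by
  have hcirc : ∀ r ∈ Ioo 0 ρ, ENNReal.ofReal r * (ENNReal.ofReal (2 * π) * ‖f w‖ₑ ^ p) ≤
      ENNReal.ofReal r * ∫⁻ θ in Ioo (-π) π, ‖disk.indicator f (circleMap w r θ)‖ₑ ^ p := by
    intro r hr
    have hsub : closedBall w r ⊆ disk := (closedBall_subset_ball hr.2).trans hw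
    have h1 : ∀ θ, disk.indicator f (circleMap w r θ) = f (circleMap w r θ) := fun θ =>
      indicator_of_mem (hsub (circleMap_mem_closedBall w hr.1.le θ)) f
    simp_rw [h1]
    rw [lintegral_circle_enorm_rpow hp hr.1.le
      (hf.continuousOn.mono (sphere_subset_closedBall.trans hsub)),
      ← ofReal_norm, ENNReal.ofReal_rpow_of_nonneg (norm_nonneg _) hp.le,
      ← ENNReal.ofReal_mul (p := 2 * π) (by positivity)]
    gcongr
    exact norm_rpow_le_circleAverage hp hr.1 ((hf.analyticOnNhd isOpen_ball).mono hsub)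
  have hint : ∫⁻ r in Ioo 0 ρ, ENNReal.ofReal r = ENNReal.ofReal (ρ ^ 2 / 2) := by
    rw [← ofReal_integral_eq_lintegral_ofReal, ← integral_Ioc_eq_integral_Ioo,
      ← intervalIntegral.integral_of_le hρ, integral_id]
    · congr 1; ring
    · exact (continuous_id.integrableOn_Icc).mono_set Ioo_subset_Icc_self
    · exact (ae_restrict_iff' measurableSet_Ioo).mpr (Filter.Eventually.of_forall fun r hr => hr.1.le)
  have hvol : ∫⁻ z in ball w ρ, ‖f z‖ₑ ^ p = ∫⁻ z in ball w ρ, ‖disk.indicator f z‖ₑ ^ p :=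
    setLIntegral_congr_fun measurableSet_ball fun z hz => by
      simp only [indicator_of_mem (hw hz) f]
  rw [setLIntegral_area measurableSet_ball, inter_eq_left.mpr hw, hvol,
    lintegral_ball_polar (measurable_indicator_disk_enorm_rpow hf p)]
  calc ENNReal.ofReal (ρ ^ 2) * ‖f w‖ₑ ^ p
      = ENNReal.ofReal π⁻¹ * ∫⁻ r in Ioo 0 ρ,
          ENNReal.ofReal r * (ENNReal.ofReal (2 * π) * ‖f w‖ₑ ^ p) := by
        rw [lintegral_mul_const _ ENNReal.measurable_ofReal, hint, ← mul_assoc, ← mul_assoc,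
          ← ENNReal.ofReal_mul (by positivity), ← ENNReal.ofReal_mul (by positivity)]
        congr 2
        field_simp
    _ ≤ _ := by
        gcongr 1
        exact setLIntegral_mono' measurableSet_Ioo hcirc

lemma lintegral_bergman_polar {f : ℂ → ℂ} (hf : DifferentiableOn ℂ f disk) {p : ℝ}
    (hp : 0 < p) {W : ℝ → ℝ≥0∞} (hW : Measurable W) :
    ∫⁻ z, ‖f z‖ₑ ^ p * W ‖z‖ ∂area =
      ∫⁻ r in Ioo (0 : ℝ) 1, ENNReal.ofReal (2 * circleAverage (fun z => ‖f z‖ ^ p) 0 r) *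
        (ENNReal.ofReal r * W r) := by
  have h1 : ∫⁻ z, ‖f z‖ₑ ^ p * W ‖z‖ ∂area =
      ∫⁻ z, ‖disk.indicator f z‖ₑ ^ p * W ‖z‖ ∂area := by
    rw [lintegral_area, lintegral_area]
    congr 1
    refine setLIntegral_congr_fun measurableSet_disk fun z hz => ?_
    simp only [indicator_of_mem hz f]
  have hm := measurable_indicator_disk_enorm_rpow hf p
  have hmW : Measurable fun z : ℂ => ‖disk.indicator f z‖ₑ ^ p * W ‖z‖ :=
    hm.mul (hW.comp measurable_norm)
  rw [h1, lintegral_area_polar hmW, ← lintegral_const_mul']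
  · refine setLIntegral_congr_fun measurableSet_Ioo fun r hr => ?_
    have hsub : closedBall (0 : ℂ) r ⊆ disk := closedBall_subset_ball hr.2
    have h2 : ∀ θ, disk.indicator f (circleMap 0 r θ) = f (circleMap 0 r θ) := fun θ =>
      indicator_of_mem (hsub (circleMap_mem_closedBall 0 hr.1.le θ)) f
    have h3 : ∀ θ, ‖circleMap 0 r θ‖ = r := fun θ => by simp [abs_of_pos hr.1]
    simp only [h2, h3]
    have hmeas : Measurable fun θ => ‖f (circleMap 0 r θ)‖ₑ ^ p := by
      have := hm.comp (continuous_circleMap 0 r).measurable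
      simpa only [Function.comp_def, h2] using this
    rw [lintegral_mul_const _ hmeas, lintegral_circle_enorm_rpow hp hr.1.le
      (hf.continuousOn.mono (sphere_subset_closedBall.trans hsub))]
    have h4 : ENNReal.ofReal (2 * circleAverage (fun z => ‖f z‖ ^ p) 0 r) =
        ENNReal.ofReal π⁻¹ * ENNReal.ofReal (2 * π * circleAverage (fun z => ‖f z‖ ^ p) 0 r) := by
      rw [← ENNReal.ofReal_mul (by positivity)]
      congr 1
      field_simp
    rw [h4]
    ring
  · exact ENNReal.ofReal_ne_top

/-- Layer cake: each superlevel set of an increasing `Φ` is, up to an endpoint, an interval `(a,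
1)`, so comparing the tails of the weights is enough. -/
lemma lintegral_monotone_weight_le {W₁ W₂ : ℝ → ℝ≥0∞} (h₁ : Measurable W₁) (h₂ : Measurable W₂)
    {C : ℝ≥0∞} (hC : C ≠ ∞)
    (h : ∀ r ∈ Ico (0 : ℝ) 1, ∫⁻ t in Ioo r 1, W₁ t ≤ C * ∫⁻ t in Ioo r 1, W₂ t)
    {Φ : ℝ → ℝ} (hΦ : MonotoneOn Φ (Ioo 0 1)) (hΦ0 : ∀ r, 0 ≤ Φ r) :
    ∫⁻ r in Ioo (0 : ℝ) 1, ENNReal.ofReal (Φ r) * W₁ r ≤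
      C * ∫⁻ r in Ioo (0 : ℝ) 1, ENNReal.ofReal (Φ r) * W₂ r := by
  have hΦm : AEMeasurable Φ (volume.restrict (Ioo (0 : ℝ) 1)) :=
    aemeasurable_restrict_of_monotoneOn measurableSet_Ioo hΦ
  have key : ∀ {W : ℝ → ℝ≥0∞}, Measurable W →
      ∫⁻ r in Ioo (0 : ℝ) 1, ENNReal.ofReal (Φ r) * W r =
        ∫⁻ t in Ioi (0 : ℝ), ∫⁻ r in {r | t < Φ r} ∩ Ioo 0 1, W r := by
    intro W hW
    have hac : AEMeasurable Φ ((volume.restrict (Ioo (0 : ℝ) 1)).withDensity W) :=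
      hΦm.mono_ac (withDensity_absolutelyContinuous _ _)
    have e1 : ∫⁻ r in Ioo (0 : ℝ) 1, ENNReal.ofReal (Φ r) * W r =
        ∫⁻ r, ENNReal.ofReal (Φ r) ∂((volume.restrict (Ioo (0 : ℝ) 1)).withDensity W) := by
      rw [lintegral_withDensity_eq_lintegral_mul₀ hW.aemeasurable hΦm.ennreal_ofReal]
      simp [mul_comm]
    rw [e1, lintegral_eq_lintegral_meas_lt _ (Filter.Eventually.of_forall hΦ0) hac]
    refine lintegral_congr fun t => ?_
    rw [withDensity_apply' _, Measure.restrict_restrict₀']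
    exact measurableSet_Ioo.nullMeasurableSet
  rw [key h₁, key h₂, ← lintegral_const_mul' _ _ hC]
  refine lintegral_mono fun t => ?_
  set A := {r | t < Φ r} ∩ Ioo 0 1 with hA
  rcases A.eq_empty_or_nonempty with he | hne
  · simp [he]
  have hbdd : BddBelow A := ⟨0, fun x hx => hx.2.1.le⟩
  set a := sInf A
  have ha0 : 0 ≤ a := le_csInf hne fun x hx => hx.2.1.le
  obtain ⟨x, hx⟩ := hne
  have ha1 : a < 1 := (csInf_le hbdd hx).trans_lt hx.2.2
  have hsub1 : A ⊆ Ico a 1 := fun y hy => ⟨csInf_le hbdd hy, hy.2.2⟩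
  have hsub2 : Ioo a 1 ⊆ A := by
    intro y hy
    obtain ⟨b, hb, hby⟩ := exists_lt_of_csInf_lt ⟨x, hx⟩ hy.1
    have hy01 : y ∈ Ioo (0 : ℝ) 1 := ⟨ha0.trans_lt hy.1, hy.2⟩
    exact ⟨lt_of_lt_of_le hb.1 (hΦ hb.2 hy01 hby.le), hy01⟩
  calc ∫⁻ r in A, W₁ r ≤ ∫⁻ r in Ico a 1, W₁ r := lintegral_mono_set hsub1
    _ = ∫⁻ r in Ioo a 1, W₁ r := setLIntegral_congr Ioo_ae_eq_Ico.symm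
    _ ≤ C * ∫⁻ r in Ioo a 1, W₂ r := h a ⟨ha0, ha1⟩
    _ ≤ C * ∫⁻ r in A, W₂ r := by gcongr

/-- Weighted Bergman integrals of radial weights are controlled by the tails of the weights. -/
lemma lintegral_bergman_le_of_tail_le {f : ℂ → ℂ} (hf : DifferentiableOn ℂ f disk) {p : ℝ}
    (hp : 0 < p) {W₁ W₂ : ℝ → ℝ≥0∞} (h₁ : Measurable W₁) (h₂ : Measurable W₂) {C : ℝ≥0∞}
    (hC : C ≠ ∞) (h : ∀ r ∈ Ico (0 : ℝ) 1, ∫⁻ t in Ioo r 1, ENNReal.ofReal t * W₁ t ≤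
      C * ∫⁻ t in Ioo r 1, ENNReal.ofReal t * W₂ t) :
    ∫⁻ z, ‖f z‖ₑ ^ p * W₁ ‖z‖ ∂area ≤ C * ∫⁻ z, ‖f z‖ₑ ^ p * W₂ ‖z‖ ∂area := by
  rw [lintegral_bergman_polar hf hp h₁, lintegral_bergman_polar hf hp h₂]
  refine lintegral_monotone_weight_le (ENNReal.measurable_ofReal.mul h₁)
    (ENNReal.measurable_ofReal.mul h₂) hC h ?_ ?_
  · intro r hr R hR hrR
    have := circleAverage_norm_rpow_mono hf hp hr.1.le hrR hR.2
    linarith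
  · intro r
    have := circleAverage_nonneg_of_nonneg (f := fun z => ‖f z‖ ^ p) (c := 0) (R := r)
      fun z _ => by positivity
    linarith

lemma lintegral_Ioo_one_sub (F : ℝ → ℝ≥0∞) (r : ℝ) :
    ∫⁻ t in Ioo r 1, F (1 - t) = ∫⁻ x in Ioo 0 (1 - r), F x := by
  rw [← lintegral_indicator measurableSet_Ioo, ← lintegral_indicator measurableSet_Ioo,
    ← lintegral_sub_left_eq_self ((Ioo 0 (1 - r)).indicator F) 1]
  refine lintegral_congr fun t => ?_
  by_cases ht : t ∈ Ioo r 1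
  · rw [indicator_of_mem ht, indicator_of_mem]
    exact ⟨by linarith [ht.2], by linarith [ht.1]⟩
  · rw [indicator_of_notMem ht, indicator_of_notMem]
    exact fun h => ht ⟨by linarith [h.2], by linarith [h.1]⟩

lemma lintegral_Ioo_rpow {σ d : ℝ} (hσ : 0 < σ) (hd : 0 ≤ d) :
    ∫⁻ x in Ioo 0 d, ENNReal.ofReal (x ^ (σ - 1)) = ENNReal.ofReal (d ^ σ / σ) := by
  have hii : IntervalIntegrable (fun x : ℝ => x ^ (σ - 1)) volume 0 d :=
    intervalIntegral.intervalIntegrable_rpow' (by linarith)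
  rw [← ofReal_integral_eq_lintegral_ofReal, ← integral_Ioc_eq_integral_Ioo,
    ← intervalIntegral.integral_of_le hd, integral_rpow (Or.inl (by linarith))]
  · simp [Real.zero_rpow hσ.ne']
  · rw [intervalIntegrable_iff_integrableOn_Ioo_of_le hd] at hii
    exact hii
  · exact (ae_restrict_iff' measurableSet_Ioo).mpr
      (Filter.Eventually.of_forall fun x hx => Real.rpow_nonneg hx.1.le _)

/-! ### Radial weights as functions of the modulus -/

lemma area_restrict_disk : area.restrict disk = area := by
  rw [area, Measure.restrict_smul, Measure.restrict_restrict measurableSet_disk, inter_self]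

lemma ae_area_mem_disk : ∀ᵐ z ∂area, z ∈ disk := by
  rw [← area_restrict_disk]
  exact ae_restrict_mem measurableSet_disk

/-- Fubini in polar coordinates. This links statements almost everywhere in area with the values of
a weight along a radius, itself a null set. -/
lemma ae_ae_circleMap {N : Set ℂ} (hN : area N = 0) :
    ∀ᵐ r ∂(volume.restrict (Ioo (0 : ℝ) 1)), ∀ᵐ θ ∂(volume.restrict (Ioo (-π) π)),
      circleMap 0 r θ ∉ N := by
  set N' := toMeasurable area N
  have hN'm : MeasurableSet N' := measurableSet_toMeasurable _ _
  have hN' : area N' = 0 := by rw [measure_toMeasurable, hN]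
  have hF : Measurable (N'.indicator (fun _ => (1 : ℝ≥0∞))) := measurable_one.indicator hN'm
  have h0 := lintegral_area_polar hF
  rw [lintegral_indicator hN'm, setLIntegral_one, hN'] at h0
  have h1 := (mul_eq_zero.mp h0.symm).resolve_left (by simp [pi_pos])
  have hcm : Continuous fun q : ℝ × ℝ => circleMap 0 q.1 q.2 := by fun_prop
  have hm2 : Measurable fun r : ℝ =>
      ∫⁻ θ in Ioo (-π) π, N'.indicator (fun _ => (1 : ℝ≥0∞)) (circleMap 0 r θ) :=
    Measurable.lintegral_prod_right' (f := fun q : ℝ × ℝ =>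
      N'.indicator (fun _ => (1 : ℝ≥0∞)) (circleMap 0 q.1 q.2)) (hF.comp hcm.measurable)
  have hm3 : Measurable fun r : ℝ => ENNReal.ofReal r *
      ∫⁻ θ in Ioo (-π) π, N'.indicator (fun _ => (1 : ℝ≥0∞)) (circleMap 0 r θ) :=
    ENNReal.measurable_ofReal.mul hm2
  rw [lintegral_eq_zero_iff hm3] at h1
  filter_upwards [h1, ae_restrict_mem measurableSet_Ioo] with r hr hr01
  have hr' := (mul_eq_zero.mp hr).resolve_left (by simpa using hr01.1)
  have hm4 : Measurable fun θ : ℝ => N'.indicator (fun _ => (1 : ℝ≥0∞)) (circleMap 0 r θ) :=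
    hF.comp (continuous_circleMap 0 r).measurable
  rw [lintegral_eq_zero_iff hm4] at hr'
  filter_upwards [hr'] with θ hθ hmem
  have : circleMap 0 r θ ∈ N' := subset_toMeasurable _ _ hmem
  simp [indicator_of_mem this] at hθ

lemma ae_area_norm {B : ℝ → Prop} (hB : ∀ᵐ r ∂(volume.restrict (Ioo (0 : ℝ) 1)), B r) :
    ∀ᵐ z ∂area, B ‖z‖ := by
  have hN : volume.restrict (Ioo (0 : ℝ) 1) {r | ¬ B r} = 0 := hB
  set N' := toMeasurable (volume.restrict (Ioo (0 : ℝ) 1)) {r | ¬ B r}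
  have hN'm : MeasurableSet N' := measurableSet_toMeasurable _ _
  have hN' : volume.restrict (Ioo (0 : ℝ) 1) N' = 0 := by rw [measure_toMeasurable, hN]
  have hpre : MeasurableSet {z : ℂ | ‖z‖ ∈ N'} := measurable_norm hN'm
  have hF : Measurable ({z : ℂ | ‖z‖ ∈ N'}.indicator (fun _ => (1 : ℝ≥0∞))) :=
    measurable_one.indicator hpre
  have h0 := lintegral_area_polar hF
  rw [lintegral_indicator hpre, setLIntegral_one] at h0
  have hz : area {z : ℂ | ‖z‖ ∈ N'} = 0 := by
    rw [h0, lintegral_congr_ae (g := fun _ => (0 : ℝ≥0∞))]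
    · simp
    have hae : ∀ᵐ r ∂(volume.restrict (Ioo (0 : ℝ) 1)), r ∉ N' :=
      measure_eq_zero_iff_ae_notMem.mp hN'
    filter_upwards [hae, ae_restrict_mem measurableSet_Ioo] with r hr hr01
    have : ∀ θ, ‖circleMap 0 r θ‖ = r := fun θ => by simp [abs_of_pos hr01.1]
    simp [indicator, hr, abs_of_pos hr01.1]
  have hz' := measure_eq_zero_iff_ae_notMem.mp hz
  filter_upwards [hz'] with z hz
  by_contra hB'
  exact hz (subset_toMeasurable _ _ hB')

/-- A radial weight coincides almost everywhere with a measurable function of the modulus. -/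
lemma IsDWeight.exists_measurable_radial {ω : ℂ → ℝ} (hω : IsDWeight ω) :
    ∃ W : ℝ → ℝ≥0∞, Measurable W ∧ (∀ᵐ z ∂area, ENNReal.ofReal (ω z) = W ‖z‖) ∧
      ∀ᵐ r : ℝ ∂(volume.restrict (Ioo (0 : ℝ) 1)), ENNReal.ofReal (ω (r : ℂ)) = W r := by
  have hae : AEMeasurable ω area := by
    have := hω.integrable.aemeasurable
    rwa [area_restrict_disk] at this
  set g : ℂ → ℝ≥0∞ := fun z => ENNReal.ofReal (hae.mk ω z)
  have hg : Measurable g := hae.measurable_mk.ennreal_ofReal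
  have hN : area {z | ω z ≠ hae.mk ω z} = 0 := hae.ae_eq_mk
  have hcm : Continuous fun q : ℝ × ℝ => circleMap 0 q.1 q.2 := by fun_prop
  -- The circular mean of a measurable representative. On almost every circle the representative
  -- agrees almost everywhere with `ω`, which is constant there, so the mean recovers the value
  -- `ω(r)` used by `tail`.
  set W : ℝ → ℝ≥0∞ := fun r =>
    ENNReal.ofReal (2 * π)⁻¹ * ∫⁻ θ in Ioo (-π) π, g (circleMap 0 r θ)
  have hW : Measurable W := (Measurable.lintegral_prod_right' (f := fun q : ℝ × ℝ =>
      g (circleMap 0 q.1 q.2)) (hg.comp hcm.measurable)).const_mul _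
  have hrad : ∀ᵐ r : ℝ ∂(volume.restrict (Ioo (0 : ℝ) 1)), ENNReal.ofReal (ω (r : ℂ)) = W r := by
    filter_upwards [ae_ae_circleMap hN, ae_restrict_mem measurableSet_Ioo] with r hr hr01
    have hconst : ∫⁻ θ in Ioo (-π) π, g (circleMap 0 r θ) =
        ∫⁻ θ in Ioo (-π) π, ENNReal.ofReal (ω (r : ℂ)) := by
      refine lintegral_congr_ae ?_
      filter_upwards [hr] with θ hθ
      simp only [not_not] at hθ
      have h1 : ω (circleMap 0 r θ) = ω (r : ℂ) :=
        hω.radial _ (by rw [mem_disk]; simpa [abs_of_pos hr01.1] using hr01.2) _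
          (by rw [mem_disk]; simpa [abs_of_pos hr01.1] using hr01.2) (by simp)
      simp only [g, ← hθ, h1]
    simp only [W, hconst, setLIntegral_const, Real.volume_Ioo]
    rw [mul_left_comm, ← ENNReal.ofReal_mul (by positivity)]
    have : (2 * π)⁻¹ * (π - -π) = 1 := by field_simp; ring
    rw [this]; simp
  refine ⟨W, hW, ?_, hrad⟩
  filter_upwards [ae_area_norm hrad, ae_area_mem_disk] with z hz hzd
  rw [← hz, hω.radial z hzd (‖z‖ : ℂ) (by rw [mem_disk] at *; simpa using hzd) (by simp)]

/-! ### Power bounds for the tail of a weight -/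

/-- Two-sided power control of the tail of a weight, in terms of the distance to the boundary. -/
structure IsPowerDoubling (h : ℝ → ℝ) (C lam γ : ℝ) : Prop where
  one_le : 1 ≤ C
  lam_pos : 0 < lam
  γ_pos : 0 < γ
  pos : ∀ x ∈ Ioc (0 : ℝ) 1, 0 < h x
  mono : ∀ x ∈ Ioc (0 : ℝ) 1, ∀ y ∈ Ioc (0 : ℝ) 1, x ≤ y → h x ≤ h y
  upper : ∀ x ∈ Ioc (0 : ℝ) 1, ∀ y ∈ Ioc (0 : ℝ) 1, x ≤ y → h y ≤ C * (y / x) ^ lam * h x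
  lower : ∀ x ∈ Ioc (0 : ℝ) 1, ∀ y ∈ Ioc (0 : ℝ) 1, x ≤ y → h x ≤ C * (x / y) ^ γ * h y

/-- Each doubling inequality is iterated until the scale `x` is reached from `y`: about `log₂ (y/x)`
forward steps, rounded up, and about `log (y/x) / log C₂` reverse steps, rounded down. Rounding
costs one extra factor, absorbed in the constant. -/
lemma isPowerDoubling_of_doubling {h : ℝ → ℝ} (hpos : ∀ x ∈ Ioc (0 : ℝ) 1, 0 < h x)
    (hmono : ∀ x ∈ Ioc (0 : ℝ) 1, ∀ y ∈ Ioc (0 : ℝ) 1, x ≤ y → h x ≤ h y)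
    {C₁ C₂ C₃ : ℝ} (h1 : 1 < C₁) (h2 : 1 < C₂) (h3 : 1 ≤ C₃)
    (hrev : ∀ x ∈ Ioc (0 : ℝ) 1, C₁ * h (x / C₂) ≤ h x)
    (hfor : ∀ x ∈ Ioc (0 : ℝ) 1, h x ≤ C₃ * h (x / 2)) :
    ∃ C lam γ, IsPowerDoubling h C lam γ := by
  have hlog2 : 0 < Real.log 2 := Real.log_pos one_lt_two
  have hL1 : 0 < Real.log C₁ := Real.log_pos h1
  have hL2 : 0 < Real.log C₂ := Real.log_pos h2
  have hL3 : 0 < Real.log (C₃ + 1) := Real.log_pos (by linarith)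
  have hdiv : ∀ {c : ℝ}, 1 < c → ∀ n : ℕ, ∀ x ∈ Ioc (0 : ℝ) 1, x / c ^ n ∈ Ioc (0 : ℝ) 1 := by
    intro c hc n x hx
    have : 0 < c ^ n := by positivity
    exact ⟨div_pos hx.1 this, (div_le_self hx.1.le (one_le_pow₀ hc.le)).trans hx.2⟩
  have hrevn : ∀ n : ℕ, ∀ x ∈ Ioc (0 : ℝ) 1, C₁ ^ n * h (x / C₂ ^ n) ≤ h x := by
    intro n x hx
    induction n with
    | zero => simp
    | succ n ih =>
      refine le_trans ?_ ih
      rw [pow_succ, mul_assoc, pow_succ, ← div_div]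
      gcongr
      exact hrev _ (hdiv h2 n x hx)
  have hforn : ∀ n : ℕ, ∀ x ∈ Ioc (0 : ℝ) 1, h x ≤ (C₃ + 1) ^ n * h (x / 2 ^ n) := by
    intro n x hx
    induction n with
    | zero => simp
    | succ n ih =>
      refine ih.trans ?_
      rw [pow_succ (C₃ + 1), mul_assoc, pow_succ, ← div_div]
      gcongr
      have hmem := hdiv one_lt_two n x hx
      have := hpos _ (hdiv one_lt_two 1 _ hmem)
      rw [pow_one] at this
      nlinarith [hfor _ hmem]
  -- Using `C₃ + 1` instead of `C₃` keeps the upper exponent positive when `C₃ = 1`.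
  refine ⟨max (C₃ + 1) C₁, Real.log (C₃ + 1) / Real.log 2, Real.log C₁ / Real.log C₂,
    ⟨le_max_of_le_right h1.le, by positivity, by positivity, hpos, hmono, ?_, ?_⟩⟩
  · intro x hx y hy hxy
    have hyx : 1 ≤ y / x := (one_le_div hx.1).mpr hxy
    set L := Real.log (y / x) / Real.log 2
    have hL0 : 0 ≤ L := div_nonneg (Real.log_nonneg hyx) hlog2.le
    have hyL : y / x = 2 ^ L := by
      rw [Real.rpow_def_of_pos two_pos, mul_div_cancel₀ _ hlog2.ne',
        Real.exp_log (by linarith)]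
    set n := ⌈L⌉₊
    have hn1 : L ≤ n := Nat.le_ceil L
    have hn2 : (n : ℝ) ≤ L + 1 := (Nat.ceil_lt_add_one hL0).le
    have hle : y / 2 ^ n ≤ x := by
      rw [div_le_iff₀ (by positivity), mul_comm, ← div_le_iff₀ hx.1, hyL, ← Real.rpow_natCast]
      exact Real.rpow_le_rpow_of_exponent_le one_le_two hn1
    calc h y ≤ (C₃ + 1) ^ n * h (y / 2 ^ n) := hforn n y hy
      _ ≤ (C₃ + 1) ^ n * h x := by
        gcongr
        exact hmono _ (hdiv one_lt_two n y hy) _ hx hle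
      _ ≤ (C₃ + 1) ^ (L + 1) * h x := by
        have := hpos x hx
        gcongr
        rw [← Real.rpow_natCast]
        exact Real.rpow_le_rpow_of_exponent_le (by linarith) hn2
      _ ≤ _ := by
        have := hpos x hx
        gcongr
        rw [Real.rpow_add (by linarith), Real.rpow_one, mul_comm]
        gcongr
        · exact le_max_left _ _
        · rw [Real.rpow_def_of_pos (by linarith), Real.rpow_def_of_pos (by positivity)]
          apply le_of_eq
          congr 1
          simp only [L]
          field_simp
  · intro x hx y hy hxy
    have hyx : 1 ≤ y / x := (one_le_div hx.1).mpr hxy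
    set L := Real.log (y / x) / Real.log C₂
    have hL0 : 0 ≤ L := div_nonneg (Real.log_nonneg hyx) hL2.le
    have hyL : y / x = C₂ ^ L := by
      rw [Real.rpow_def_of_pos (by linarith), mul_div_cancel₀ _ hL2.ne',
        Real.exp_log (by linarith)]
    set n := ⌊L⌋₊
    have hn1 : (n : ℝ) ≤ L := Nat.floor_le hL0
    have hn2 : L < n + 1 := Nat.lt_floor_add_one L
    have hle : x ≤ y / C₂ ^ n := by
      rw [le_div_iff₀ (by positivity), mul_comm, ← le_div_iff₀ hx.1, hyL, ← Real.rpow_natCast]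
      exact Real.rpow_le_rpow_of_exponent_le h2.le hn1
    have hpow : (C₁ ^ n)⁻¹ ≤ C₁ * (x / y) ^ (Real.log C₁ / Real.log C₂) := by
      have e1 : (x / y) ^ (Real.log C₁ / Real.log C₂) = (C₁ ^ L)⁻¹ := by
        rw [← inv_div, Real.inv_rpow (by positivity), Real.rpow_def_of_pos (by positivity),
          Real.rpow_def_of_pos (by positivity)]
        congr 2
        simp only [L]
        field_simp
      have e2 : C₁ ^ L ≤ C₁ ^ n * C₁ := by
        rw [← pow_succ, ← Real.rpow_natCast]
        exact Real.rpow_le_rpow_of_exponent_le h1.le (by push_cast; exact hn2.le)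
      have hp1 : 0 < C₁ ^ L := by positivity
      rw [e1, inv_eq_one_div, div_le_iff₀ (by positivity), mul_assoc, mul_comm, mul_assoc,
        inv_mul_eq_div, one_le_div hp1]
      exact e2
    calc h x ≤ h (y / C₂ ^ n) := hmono _ hx _ (hdiv h2 n y hy) hle
      _ ≤ (C₁ ^ n)⁻¹ * h y := by
        rw [inv_mul_eq_div, le_div_iff₀ (by positivity), mul_comm]
        exact hrevn n y hy
      _ ≤ _ := by
        have := hpos y hy
        gcongr
        refine hpow.trans ?_
        gcongr
        · have := hx.1; have := hy.1; positivity
        · exact le_max_right _ _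

lemma tail_antitone (ω : ℂ → ℝ) : Antitone (tail ω) := fun _ _ h =>
  lintegral_mono_set (Ioo_subset_Ioo_left h)

/-- The tail of a weight as a real function of the distance to the boundary. -/
noncomputable def tailReal (ω : ℂ → ℝ) (x : ℝ) : ℝ := (tail ω (1 - x)).toReal

/-- Integrability over the disk controls `∫ ω(r) r dr`, hence the tail only away from the origin.
Forward doubling at `0` bounds the full tail by the tail at `1/2`. -/
lemma IsDWeight.tail_lt_top {ω : ℂ → ℝ} (hω : IsDWeight ω) {r : ℝ} (hr : 0 ≤ r) :
    tail ω r < ∞ := by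
  obtain ⟨W, hW, hWω, hWr⟩ := hω.exists_measurable_radial
  have hint : ∫⁻ z, W ‖z‖ ∂area < ∞ := by
    have h1 := hω.integrable.lintegral_lt_top
    rwa [area_restrict_disk, lintegral_congr_ae hWω] at h1
  have hWn : Measurable fun z : ℂ => W ‖z‖ := hW.comp measurable_norm
  rw [lintegral_area_polar hWn] at hint
  have h2 : ∫⁻ r in Ioo (0 : ℝ) 1, ENNReal.ofReal r * (W r * ENNReal.ofReal (2 * π)) < ∞ := by
    refine lt_of_le_of_lt (le_of_eq ?_) (ENNReal.lt_top_of_mul_ne_top_right hint.ne (by simp [pi_pos]))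
    refine setLIntegral_congr_fun measurableSet_Ioo fun r hr => ?_
    have : ∀ θ, ‖circleMap 0 r θ‖ = r := fun θ => by simp [abs_of_pos hr.1]
    simp only [this, setLIntegral_const, Real.volume_Ioo]
    rw [show π - -π = 2 * π by ring]
  have h3 : tail ω 2⁻¹ < ∞ := by
    refine lt_of_le_of_lt ?_ (ENNReal.mul_lt_top (a := 2) (by simp) h2)
    rw [← lintegral_const_mul' _ _ (by simp)]
    have hsub : Ioo (2⁻¹ : ℝ) 1 ⊆ Ioo 0 1 := Ioo_subset_Ioo_left (by norm_num)
    have e : tail ω 2⁻¹ = ∫⁻ t in Ioo (2⁻¹ : ℝ) 1, W t :=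
      lintegral_congr_ae (ae_mono (Measure.restrict_mono_set _ hsub) hWr)
    rw [e]
    refine le_trans (setLIntegral_mono' measurableSet_Ioo fun t ht => ?_) (lintegral_mono_set hsub)
    calc W t = 1 * (W t * 1) := by simp
      _ ≤ (2 * ENNReal.ofReal t) * (W t * ENNReal.ofReal (2 * π)) := by
        gcongr
        · rw [← ENNReal.ofReal_ofNat, ← ENNReal.ofReal_mul (by norm_num), ENNReal.one_le_ofReal]
          linarith [ht.1, show (2 : ℝ) * 2⁻¹ = 1 by norm_num]
        · rw [ENNReal.one_le_ofReal]; linarith [pi_gt_three]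
      _ = _ := by ring
  obtain ⟨C₃, -, h⟩ := hω.forward_doubling
  refine (tail_antitone ω hr).trans_lt ((h 0 (by simp)).trans_lt ?_)
  rw [show (1 + (0 : ℝ)) / 2 = 2⁻¹ by norm_num]
  exact ENNReal.mul_lt_top (by simp) h3

lemma IsDWeight.ofReal_tailReal {ω : ℂ → ℝ} (hω : IsDWeight ω) {x : ℝ} (hx : x ≤ 1) :
    ENNReal.ofReal (tailReal ω x) = tail ω (1 - x) :=
  ENNReal.ofReal_toReal (hω.tail_lt_top (by linarith)).ne

lemma IsDWeight.isPowerDoubling {ω : ℂ → ℝ} (hω : IsDWeight ω) :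
    ∃ C lam γ, IsPowerDoubling (tailReal ω) C lam γ := by
  obtain ⟨C₁, C₂, h1, h2, hr⟩ := hω.reverse_doubling
  obtain ⟨C₃, h3, hf⟩ := hω.forward_doubling
  have hmono : ∀ x ∈ Ioc (0 : ℝ) 1, ∀ y ∈ Ioc (0 : ℝ) 1, x ≤ y →
      tailReal ω x ≤ tailReal ω y := fun x hx y hy hxy =>
    ENNReal.toReal_mono (hω.tail_lt_top (by linarith [hy.2])).ne
      (tail_antitone ω (by linarith))
  have hfor : ∀ x ∈ Ioc (0 : ℝ) 1, tailReal ω x ≤ C₃ * tailReal ω (x / 2) := by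
    intro x hx
    have := hf (1 - x) ⟨by linarith [hx.2], by linarith [hx.1]⟩
    rw [show (1 + (1 - x)) / 2 = 1 - x / 2 by ring] at this
    have h4 := ENNReal.toReal_mono (ENNReal.mul_lt_top (by simp)
      (hω.tail_lt_top (by linarith [hx.1, hx.2]))).ne this
    rwa [ENNReal.toReal_mul, ENNReal.toReal_ofReal (by linarith)] at h4
  have hrev : ∀ x ∈ Ioc (0 : ℝ) 1, C₁ * tailReal ω (x / C₂) ≤ tailReal ω x := by
    intro x hx
    have := hr (1 - x) ⟨by linarith [hx.2], by linarith [hx.1]⟩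
    rw [show 1 - (1 - (1 - x)) / C₂ = 1 - x / C₂ by ring] at this
    have h4 := ENNReal.toReal_mono (hω.tail_lt_top (by linarith [hx.1, hx.2])).ne this
    rwa [ENNReal.toReal_mul, ENNReal.toReal_ofReal (by linarith)] at h4
  have hnonneg : ∀ x, 0 ≤ tailReal ω x := fun x => ENNReal.toReal_nonneg
  have h0 : 0 < tailReal ω 1 := by
    refine ENNReal.toReal_pos ?_ ?_
    · simpa using hω.nontrivial.ne'
    · simpa using (hω.tail_lt_top le_rfl).ne
  -- Forward doubling prevents the tail from vanishing at a dyadic scale, since it is positive at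
  -- scale `1`. Monotonicity then covers all scales.
  have hpow : ∀ n : ℕ, 0 < tailReal ω (1 / 2 ^ n) := by
    intro n
    induction n with
    | zero => simpa using h0
    | succ n ih =>
      have hle : (1 : ℝ) / 2 ^ n ≤ 1 := div_le_one_of_le₀ (one_le_pow₀ one_le_two) (by positivity)
      have := hfor (1 / 2 ^ n) ⟨by positivity, hle⟩
      rw [div_div, ← pow_succ] at this
      by_contra hcon
      have : tailReal ω (1 / 2 ^ (n + 1)) = 0 := le_antisymm (not_lt.mp hcon) (hnonneg _)
      simp_all
      linarith
  have hpos : ∀ x ∈ Ioc (0 : ℝ) 1, 0 < tailReal ω x := by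
    intro x hx
    obtain ⟨n, hn⟩ := exists_pow_lt_of_lt_one hx.1 (show (1 / 2 : ℝ) < 1 by norm_num)
    rw [one_div_pow] at hn
    exact (hpow n).trans_le (hmono _ ⟨by positivity, hn.le.trans hx.2⟩ _ hx hn.le)
  exact isPowerDoubling_of_doubling hpos hmono h1 h2 h3 hrev hfor

/-! ### The weight κ and the equivalence of norms -/

lemma IsDWeight.kappa_eq {ω : ℂ → ℝ} (hω : IsDWeight ω) {z : ℂ} (hz : z ∈ disk) :
    kappa ω z = ENNReal.ofReal (tailReal ω (1 - ‖z‖) / (1 - ‖z‖)) := by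
  have hz' := mem_disk.mp hz
  rw [kappa, ENNReal.ofReal_div_of_pos (by linarith),
    hω.ofReal_tailReal (by linarith [norm_nonneg z]), sub_sub_cancel]

lemma measurable_kappa (ω : ℂ → ℝ) : Measurable (kappa ω) :=
  ((tail_antitone ω).measurable.comp measurable_norm).div (by fun_prop)

/-- The weighted integral `∫ ‖f‖ ^ p κ dA`. -/
noncomputable def kappaIntegral (p : ℝ) (ω : ℂ → ℝ) (f : ℂ → ℂ) : ℝ≥0∞ :=
  ∫⁻ z, ‖f z‖ₑ ^ p * kappa ω z ∂area

lemma setLIntegral_mul_id_le (W : ℝ → ℝ≥0∞) (r : ℝ) :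
    ∫⁻ t in Ioo r 1, ENNReal.ofReal t * W t ≤ ∫⁻ t in Ioo r 1, W t :=
  setLIntegral_mono' measurableSet_Ioo fun _ ht =>
    mul_le_of_le_one_left' (ENNReal.ofReal_le_one.mpr ht.2.le)

/-- The area element carries a factor `t` that degenerates at the origin. Passing from `r` to
`(1+r)/2` forces `t ≥ 1/2`, at the cost of a factor `2`. -/
lemma le_setLIntegral_mul_id (W : ℝ → ℝ≥0∞) {r : ℝ} (hr : r ∈ Ico (0 : ℝ) 1) :
    ∫⁻ t in Ioo ((1 + r) / 2) 1, W t ≤ 2 * ∫⁻ t in Ioo r 1, ENNReal.ofReal t * W t := by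
  rw [← lintegral_const_mul' _ _ (by simp)]
  have hsub : Ioo ((1 + r) / 2) 1 ⊆ Ioo r 1 := Ioo_subset_Ioo_left (by linarith [hr.2])
  refine le_trans (setLIntegral_mono' measurableSet_Ioo fun t ht => ?_) (lintegral_mono_set hsub)
  rw [← mul_assoc]
  refine le_mul_of_one_le_left' ?_
  rw [← ENNReal.ofReal_ofNat, ← ENNReal.ofReal_mul (by norm_num), ENNReal.one_le_ofReal]
  linarith [ht.1, hr.1]

/-- This is where reverse doubling is needed: `ω̂(1-x) ≲ (x/(1-r))^γ ω̂(r)` makes `ω̂(1-x)/x`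
integrable at `x = 0`, with integral of `x^{γ-1}` giving the factor `1/γ`. -/
lemma lintegral_kappa_tail_le {ω : ℂ → ℝ} (hω : IsDWeight ω) {C lam γ : ℝ}
    (hd : IsPowerDoubling (tailReal ω) C lam γ) {r : ℝ} (hr : r ∈ Ico (0 : ℝ) 1) :
    ∫⁻ t in Ioo r 1, tail ω t / ENNReal.ofReal (1 - t) ≤ ENNReal.ofReal (C / γ) * tail ω r := by
  have hγ := hd.γ_pos
  have hC := hd.one_le
  have hr1 : 0 < 1 - r := by linarith [hr.2]
  have hrm : 1 - r ∈ Ioc (0 : ℝ) 1 := ⟨hr1, by linarith [hr.1]⟩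
  have hp := hd.pos _ hrm
  have e := lintegral_Ioo_one_sub (fun x => tail ω (1 - x) / ENNReal.ofReal x) r
  simp only [sub_sub_cancel] at e
  rw [e]
  calc ∫⁻ x in Ioo 0 (1 - r), tail ω (1 - x) / ENNReal.ofReal x
      ≤ ∫⁻ x in Ioo 0 (1 - r), ENNReal.ofReal (C * tailReal ω (1 - r) / (1 - r) ^ γ) *
          ENNReal.ofReal (x ^ (γ - 1)) := by
        refine setLIntegral_mono' measurableSet_Ioo fun x hx => ?_
        have hxm : x ∈ Ioc (0 : ℝ) 1 := ⟨hx.1, hx.2.le.trans hrm.2⟩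
        rw [← hω.ofReal_tailReal hxm.2, ← ENNReal.ofReal_div_of_pos hx.1,
          ← ENNReal.ofReal_mul (by positivity)]
        refine ENNReal.ofReal_le_ofReal ?_
        rw [div_le_iff₀ hx.1]
        refine (hd.lower x hxm _ hrm hx.2.le).trans (le_of_eq ?_)
        have e2 : x ^ (γ - 1) * x = x ^ γ := by
          rw [← Real.rpow_add_one hx.1.ne', sub_add_cancel]
        rw [Real.div_rpow hx.1.le hr1.le, mul_assoc _ (x ^ (γ - 1)), e2]
        ring
    _ = ENNReal.ofReal (C / γ) * tail ω r := by
        rw [lintegral_const_mul' _ _ (by simp), lintegral_Ioo_rpow hγ hr1.le,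
          ← ENNReal.ofReal_mul (by positivity)]
        have h1 := hω.ofReal_tailReal hrm.2
        rw [sub_sub_cancel] at h1
        rw [← h1, ← ENNReal.ofReal_mul (by positivity)]
        congr 1
        field_simp

/-- On the first half of `(r, 1)` the integrand is at least `ω̂((1+r)/2)/(1-r)`, and that half has
length `(1-r)/2`. Forward doubling compares `ω̂((1+r)/2)` with `ω̂(r)`. -/
lemma tail_le_lintegral_kappa_tail {ω : ℂ → ℝ} {C₃ : ℝ}
    (h : ∀ r ∈ Ico (0 : ℝ) 1, tail ω r ≤ ENNReal.ofReal C₃ * tail ω ((1 + r) / 2)) {r : ℝ}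
    (hr : r ∈ Ico (0 : ℝ) 1) :
    tail ω r ≤ ENNReal.ofReal C₃ *
      (2 * ∫⁻ t in Ioo r 1, tail ω t / ENNReal.ofReal (1 - t)) := by
  refine (h r hr).trans ?_
  gcongr
  have hr1 : 0 < 1 - r := by linarith [hr.2]
  have hr2 : (1 + r) / 2 < 1 := by linarith [hr.2]
  have h2 : ENNReal.ofReal (1 - r) ≠ 0 := by simpa using hr1
  calc tail ω ((1 + r) / 2)
      = 2 * ∫⁻ t in Ioo r ((1 + r) / 2), tail ω ((1 + r) / 2) / ENNReal.ofReal (1 - r) := by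
        rw [setLIntegral_const, Real.volume_Ioo, show (1 + r) / 2 - r = (1 - r) / 2 by ring,
          ENNReal.ofReal_div_of_pos two_pos, ENNReal.ofReal_ofNat, mul_comm,
          mul_assoc, ENNReal.div_mul_cancel (by simp) (by simp),
          ENNReal.div_mul_cancel h2 (by simp)]
    _ ≤ 2 * ∫⁻ t in Ioo r ((1 + r) / 2), tail ω t / ENNReal.ofReal (1 - t) := by
        gcongr 2 * ?_
        refine setLIntegral_mono' measurableSet_Ioo fun _ ht => ?_
        exact ENNReal.div_le_div (tail_antitone ω ht.2.le)
          (ENNReal.ofReal_le_ofReal (by linarith [ht.1]))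
    _ ≤ _ := by
        gcongr 2 * ?_
        exact lintegral_mono_set (Ioo_subset_Ioo_right hr2.le)

/-- The norms of the weighted Bergman spaces with weights `ω` and `κ` are equivalent. -/
lemma IsDWeight.exists_kappaIntegral_equiv {ω : ℂ → ℝ} (hω : IsDWeight ω) {p : ℝ} (hp : 0 < p) :
    ∃ C : ℝ, 0 < C ∧ ∀ f : ℂ → ℂ, DifferentiableOn ℂ f disk →
      kappaIntegral p ω f ≤ ENNReal.ofReal C * bergmanNorm p ω f ^ p ∧
      bergmanNorm p ω f ^ p ≤ ENNReal.ofReal C * kappaIntegral p ω f := by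
  obtain ⟨C, lam, γ, hd⟩ := hω.isPowerDoubling
  obtain ⟨C₃, h3, hf3⟩ := hω.forward_doubling
  obtain ⟨W, hW, hWω, hWr⟩ := hω.exists_measurable_radial
  have hC := hd.one_le
  have hγ := hd.γ_pos
  have htailW : ∀ r, 0 ≤ r → ∫⁻ t in Ioo r 1, W t = tail ω r := fun r hr =>
    (lintegral_congr_ae (ae_mono (Measure.restrict_mono_set _ (Ioo_subset_Ioo_left hr)) hWr)).symm
  have hKm : Measurable fun r => tail ω r / ENNReal.ofReal (1 - r) :=
    (tail_antitone ω).measurable.div (by fun_prop)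
  have hmid : ∀ r ∈ Ico (0 : ℝ) 1, (1 + r) / 2 ∈ Ico (0 : ℝ) 1 := fun r hr =>
    ⟨by linarith [hr.1], by linarith [hr.2]⟩
  have e : ∀ f, bergmanNorm p ω f ^ p = ∫⁻ z, ‖f z‖ₑ ^ p * W ‖z‖ ∂area := by
    intro f
    rw [bergmanNorm, ← ENNReal.rpow_mul, one_div_mul_cancel hp.ne', ENNReal.rpow_one]
    refine lintegral_congr_ae ?_
    filter_upwards [hWω] with z hz
    rw [hz]
  have hA : ∀ r ∈ Ico (0 : ℝ) 1,
      ∫⁻ t in Ioo r 1, ENNReal.ofReal t * (tail ω t / ENNReal.ofReal (1 - t)) ≤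
        ENNReal.ofReal (C / γ * C₃ * 2) * ∫⁻ t in Ioo r 1, ENNReal.ofReal t * W t := by
    intro r hr
    calc _ ≤ ENNReal.ofReal (C / γ) * tail ω r :=
          (setLIntegral_mul_id_le _ r).trans (lintegral_kappa_tail_le hω hd hr)
      _ ≤ ENNReal.ofReal (C / γ) * (ENNReal.ofReal C₃ * tail ω ((1 + r) / 2)) := by
          gcongr; exact hf3 r hr
      _ ≤ ENNReal.ofReal (C / γ) * (ENNReal.ofReal C₃ *
            (2 * ∫⁻ t in Ioo r 1, ENNReal.ofReal t * W t)) := by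
          gcongr
          rw [← htailW _ (hmid r hr).1]
          exact le_setLIntegral_mul_id W hr
      _ = _ := by
          rw [ENNReal.ofReal_mul (by positivity), ENNReal.ofReal_mul (by positivity),
            ENNReal.ofReal_ofNat]
          ring
  -- Two passages to a midpoint give `C₃ * C₃`; the factor `4` is a `2` from the κ-tail estimate and
  -- a `2` from `t ≥ 1/2`.
  have hB : ∀ r ∈ Ico (0 : ℝ) 1,
      ∫⁻ t in Ioo r 1, ENNReal.ofReal t * W t ≤ ENNReal.ofReal (C₃ * C₃ * 4) *
        ∫⁻ t in Ioo r 1, ENNReal.ofReal t * (tail ω t / ENNReal.ofReal (1 - t)) := by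
    intro r hr
    calc _ ≤ tail ω r := (setLIntegral_mul_id_le _ r).trans (htailW r hr.1).le
      _ ≤ ENNReal.ofReal C₃ * tail ω ((1 + r) / 2) := hf3 r hr
      _ ≤ ENNReal.ofReal C₃ * (ENNReal.ofReal C₃ * (2 * (2 *
            ∫⁻ t in Ioo r 1, ENNReal.ofReal t * (tail ω t / ENNReal.ofReal (1 - t))))) := by
          gcongr
          refine (tail_le_lintegral_kappa_tail hf3 (hmid r hr)).trans ?_
          gcongr
          exact le_setLIntegral_mul_id _ hr
      _ = _ := by
          rw [ENNReal.ofReal_mul (by positivity), ENNReal.ofReal_mul (by positivity),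
            ENNReal.ofReal_ofNat, show (4 : ℝ≥0∞) = 2 * 2 by norm_num]
          ring
  refine ⟨max (C / γ * C₃ * 2) (C₃ * C₃ * 4), by positivity, fun f hf => ⟨?_, ?_⟩⟩
  · rw [e]
    refine (lintegral_bergman_le_of_tail_le hf hp hKm hW (by simp) hA).trans ?_
    gcongr
    exact le_max_left _ _
  · rw [e]
    refine (lintegral_bergman_le_of_tail_le hf hp hW hKm (by simp) hB).trans ?_
    rw [kappaIntegral]
    gcongr
    · exact le_max_right _ _
    · exact le_rfl

/-! ### Poisson kernel and Forelli–Rudin estimates -/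

/-- The Poisson kernel reproduces the harmonic function `1`. -/
lemma circleAverage_poisson {b : ℂ} (hb : ‖b‖ < 1) :
    circleAverage (fun ζ => (‖ζ - b‖ ^ 2)⁻¹) 0 1 = (1 - ‖b‖ ^ 2)⁻¹ := by
  have hb2 : 0 < 1 - ‖b‖ ^ 2 := by nlinarith [norm_nonneg b]
  have hh : InnerProductSpace.HarmonicOnNhd (fun _ : ℂ => (1 : ℝ)) (closedBall (0 : ℂ) 1) :=
    InnerProductSpace.harmonicOnNhd_const (1 : ℝ)
  have h := hh.circleAverage_poissonKernel_smul (w := b) (by simpa using hb)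
  have h2 : circleAverage (fun ζ => (1 - ‖b‖ ^ 2) • (‖ζ - b‖ ^ 2)⁻¹) 0 1 = 1 := by
    refine Eq.trans ?_ h
    refine circleAverage_congr_sphere fun ζ hζ => ?_
    have : ‖ζ‖ = 1 := by simpa using hζ
    simp [poissonKernel, this, div_eq_mul_inv]
  rw [circleAverage_fun_smul, smul_eq_mul] at h2
  field_simp at h2 ⊢
  linarith

lemma one_sub_norm_mul_norm_le (a z : ℂ) :
    1 - ‖a‖ * ‖z‖ ≤ ‖1 - starRingEnd ℂ a * z‖ := by
  have := norm_sub_norm_le (1 : ℂ) (starRingEnd ℂ a * z)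
  simpa using this

lemma norm_one_sub_conj_circleMap (a : ℂ) (r θ : ℝ) :
    ‖1 - starRingEnd ℂ a * circleMap 0 r θ‖ = ‖circleMap 0 1 θ - a * r‖ := by
  have h1 : circleMap 0 1 θ * starRingEnd ℂ (circleMap 0 1 θ) = 1 := by
    rw [Complex.mul_conj, Complex.normSq_eq_norm_sq]; simp
  have h2 : circleMap 0 r θ = r * circleMap 0 1 θ := by simp [circleMap]
  have h3 : 1 - starRingEnd ℂ a * circleMap 0 r θ =
      circleMap 0 1 θ * starRingEnd ℂ (circleMap 0 1 θ - a * r) := by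
    rw [map_sub, map_mul, Complex.conj_ofReal, mul_sub, h1, h2]; ring
  rw [h3, norm_mul, Complex.norm_conj]
  simp

/-- On the circle the kernel is `|ζ - ar|^{-N}` with `|ζ| = 1`. Two of the `N` powers form a Poisson
kernel; the others are bounded by their supremum, which is why `N ≥ 2`. -/
lemma lintegral_circle_kernel_le {a : ℂ} (ha : ‖a‖ < 1) {r N : ℝ} (hr : r ∈ Ioo (0 : ℝ) 1)
    (hN : 2 ≤ N) :
    ∫⁻ θ in Ioo (-π) π, ENNReal.ofReal (‖1 - starRingEnd ℂ a * circleMap 0 r θ‖ ^ (-N)) ≤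
      ENNReal.ofReal (2 * π * (1 - ‖a‖ * r) ^ (1 - N)) := by
  set b : ℂ := a * r
  have hbn : ‖b‖ = ‖a‖ * r := by simp [b, abs_of_pos hr.1]
  have hb : ‖b‖ < 1 := by rw [hbn]; nlinarith [hr.1, hr.2, norm_nonneg a]
  have hb1 : 0 < 1 - ‖b‖ := by linarith
  have hdist : ∀ ζ ∈ sphere (0 : ℂ) 1, 1 - ‖b‖ ≤ ‖ζ - b‖ := fun ζ hζ => by
    have := norm_sub_norm_le ζ b
    rwa [mem_sphere_zero_iff_norm.mp hζ] at this
  have hcont : ContinuousOn (fun ζ => (‖ζ - b‖ ^ 2)⁻¹) (sphere 0 1) := by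
    refine ContinuousOn.inv₀ (by fun_prop) fun ζ hζ => ?_
    have := hb1.trans_le (hdist ζ hζ)
    positivity
  calc _ ≤ ∫⁻ θ in Ioo (-π) π, ENNReal.ofReal ((1 - ‖b‖) ^ (2 - N)) *
        ENNReal.ofReal ((‖circleMap 0 1 θ - b‖ ^ 2)⁻¹) := by
        refine lintegral_mono fun θ => ?_
        rw [norm_one_sub_conj_circleMap, ← ENNReal.ofReal_mul (by positivity)]
        refine ENNReal.ofReal_le_ofReal ?_
        have hd := hdist _ (circleMap_mem_sphere 0 zero_le_one θ)
        have hpos : 0 < ‖circleMap 0 1 θ - b‖ := hb1.trans_le hd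
        rw [show -N = (2 - N) + (-2) by ring, Real.rpow_add hpos, Real.rpow_neg hpos.le,
          Real.rpow_two]
        exact mul_le_mul_of_nonneg_right
          (Real.rpow_le_rpow_of_nonpos hb1 hd (by linarith)) (by positivity)
    _ = ENNReal.ofReal ((1 - ‖b‖) ^ (2 - N) * (2 * π * (1 - ‖b‖ ^ 2)⁻¹)) := by
        rw [lintegral_const_mul' _ _ ENNReal.ofReal_ne_top, lintegral_circle_eq (g := fun ζ => (‖ζ - b‖ ^ 2)⁻¹)
          zero_le_one hcont (fun z => by positivity), circleAverage_poisson hb,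
          ← ENNReal.ofReal_mul (by positivity)]
    _ ≤ _ := by
        refine ENNReal.ofReal_le_ofReal ?_
        rw [← hbn, show 1 - N = (2 - N) + (-1) by ring, Real.rpow_add hb1, Real.rpow_neg_one,
          mul_left_comm]
        gcongr
        nlinarith [norm_nonneg b]

/-- Split at `x = d`: `σ > 0` gives convergence at `0` and `σ < N - 1` at infinity. -/
lemma lintegral_rpow_max_le {σ N d : ℝ} (hσ : 0 < σ) (hσN : σ < N - 1) (hd : 0 < d) :
    ∫⁻ x in Ioi (0 : ℝ), ENNReal.ofReal (x ^ (σ - 1) * max d x ^ (1 - N)) ≤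
      ENNReal.ofReal ((1 / σ + 1 / (N - 1 - σ)) * d ^ (σ + 1 - N)) := by
  have hden : 0 < N - 1 - σ := by linarith
  have hcover : Ioi (0 : ℝ) ⊆ Ioo 0 d ∪ Ici d := fun x hx => by
    rcases lt_or_ge x d with h | h
    · exact Or.inl ⟨hx, h⟩
    · exact Or.inr h
  have h1 : ∫⁻ x in Ioo 0 d, ENNReal.ofReal (x ^ (σ - 1) * max d x ^ (1 - N)) =
      ENNReal.ofReal (1 / σ * d ^ (σ + 1 - N)) := by
    calc _ = ∫⁻ x in Ioo 0 d, ENNReal.ofReal (d ^ (1 - N)) * ENNReal.ofReal (x ^ (σ - 1)) := by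
          refine setLIntegral_congr_fun measurableSet_Ioo fun x hx => ?_
          simp only [max_eq_left hx.2.le]
          rw [mul_comm, ENNReal.ofReal_mul (by positivity)]
      _ = _ := by
          rw [lintegral_const_mul' _ _ ENNReal.ofReal_ne_top, lintegral_Ioo_rpow hσ hd.le,
            ← ENNReal.ofReal_mul (by positivity)]
          congr 1
          rw [show σ + 1 - N = (1 - N) + σ by ring, Real.rpow_add hd]
          ring
  have h2 : ∫⁻ x in Ici d, ENNReal.ofReal (x ^ (σ - 1) * max d x ^ (1 - N)) =
      ENNReal.ofReal (1 / (N - 1 - σ) * d ^ (σ + 1 - N)) := by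
    have hlt : σ - N < -1 := by linarith
    calc _ = ∫⁻ x in Ioi d, ENNReal.ofReal (x ^ (σ - N)) := by
          rw [setLIntegral_congr Ioi_ae_eq_Ici.symm]
          refine setLIntegral_congr_fun measurableSet_Ioi fun x hx => ?_
          simp only [max_eq_right (le_of_lt (show d < x from hx))]
          rw [← Real.rpow_add (hd.trans hx)]
          congr 2; ring
      _ = _ := by
          rw [← ofReal_integral_eq_lintegral_ofReal (integrableOn_Ioi_rpow_of_lt hlt hd),
            integral_Ioi_rpow_of_lt hlt hd]
          · congr 1
            rw [show σ - N + 1 = -(N - 1 - σ) by ring, neg_div_neg_eq,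
              show σ + 1 - N = -(N - 1 - σ) by ring]
            ring
          · exact (ae_restrict_iff' measurableSet_Ioi).mpr (Filter.Eventually.of_forall
              fun x hx => Real.rpow_nonneg (hd.trans hx).le _)
  refine (lintegral_mono_set hcover).trans ((lintegral_union_le _ _ _).trans ?_)
  rw [h1, h2, ← ENNReal.ofReal_add (by positivity) (by positivity), add_mul]

/-- The Forelli–Rudin estimate. -/
lemma lintegral_kernel_le {σ N : ℝ} (hσ : 0 < σ) (hσN : σ < N - 1) (hN : 2 ≤ N) {a : ℂ}
    (ha : ‖a‖ < 1) :
    ∫⁻ z, ENNReal.ofReal ((1 - ‖z‖) ^ (σ - 1) * ‖1 - starRingEnd ℂ a * z‖ ^ (-N)) ∂area ≤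
      ENNReal.ofReal (2 * (1 / σ + 1 / (N - 1 - σ)) * (1 - ‖a‖) ^ (σ + 1 - N)) := by
  have hd : 0 < 1 - ‖a‖ := by linarith
  have hm : Measurable fun z : ℂ =>
      ENNReal.ofReal ((1 - ‖z‖) ^ (σ - 1) * ‖1 - starRingEnd ℂ a * z‖ ^ (-N)) := by
    refine Measurable.ennreal_ofReal (Measurable.mul ?_ ?_)
    · exact (measurable_const.sub measurable_norm).pow_const _
    · exact (Continuous.measurable (by fun_prop)).pow_const _
  rw [lintegral_area_polar hm]
  calc _ ≤ ENNReal.ofReal π⁻¹ * ∫⁻ r in Ioo (0 : ℝ) 1, ENNReal.ofReal (2 * π) *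
        ENNReal.ofReal ((1 - r) ^ (σ - 1) * max (1 - ‖a‖) (1 - r) ^ (1 - N)) := by
        gcongr 1
        refine setLIntegral_mono' measurableSet_Ioo fun r hr => ?_
        have hr1 : 0 < 1 - r := by linarith [hr.2]
        have hn : ∀ θ, ‖circleMap 0 r θ‖ = r := fun θ => by simp [abs_of_pos hr.1]
        simp only [hn]
        simp_rw [ENNReal.ofReal_mul (Real.rpow_nonneg hr1.le (σ - 1))]
        rw [lintegral_const_mul' _ _ ENNReal.ofReal_ne_top]
        calc _ ≤ 1 * (ENNReal.ofReal ((1 - r) ^ (σ - 1)) *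
              ENNReal.ofReal (2 * π * (1 - ‖a‖ * r) ^ (1 - N))) := by
              gcongr
              · exact ENNReal.ofReal_le_one.mpr hr.2.le
              · exact lintegral_circle_kernel_le ha hr hN
          _ ≤ _ := by
              rw [one_mul, ENNReal.ofReal_mul (by positivity), mul_left_comm]
              gcongr _ * (_ * ENNReal.ofReal ?_)
              -- `1 - |a|r` dominates both `1 - |a|` and `1 - r`, and the exponent `1 - N` is
              -- negative.
              refine Real.rpow_le_rpow_of_nonpos (lt_max_of_lt_left hd) (max_le ?_ ?_)
                (by linarith)
              · nlinarith [norm_nonneg a, hr.2]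
              · nlinarith [norm_nonneg a, hr.1]
    _ = ENNReal.ofReal 2 * ∫⁻ x in Ioo 0 (1 - 0),
          ENNReal.ofReal (x ^ (σ - 1) * max (1 - ‖a‖) x ^ (1 - N)) := by
        rw [lintegral_const_mul' _ _ ENNReal.ofReal_ne_top, ← mul_assoc, ← ENNReal.ofReal_mul (by positivity),
          ← lintegral_Ioo_one_sub]
        congr 2
        field_simp
    _ ≤ ENNReal.ofReal 2 * ENNReal.ofReal
          ((1 / σ + 1 / (N - 1 - σ)) * (1 - ‖a‖) ^ (σ + 1 - N)) := by
        gcongr 1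
        exact (lintegral_mono_set Ioo_subset_Ioi_self).trans (lintegral_rpow_max_le hσ hσN hd)
    _ = _ := by
        rw [← ENNReal.ofReal_mul two_pos.le, mul_assoc]

/-- With `u = (1-|z|)/(1-|a|)`, the power bounds give `ω̂(z) ≤ C (u^lam + u^γ) ω̂(a)`: the first
power serves for `u ≥ 1`, the second for `u ≤ 1`. Each power leaves a Forelli–Rudin integral with `σ
= lam - β` or `σ = γ - β`. -/
lemma IsDWeight.lintegral_kernel_kappa_le {ω : ℂ → ℝ} (hω : IsDWeight ω) {C lam γ : ℝ}
    (hd : IsPowerDoubling (tailReal ω) C lam γ) {β N : ℝ} (hβlam : β < lam)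
    (hβγ : β < γ) (hN : 2 ≤ N) (hNlam : lam - β < N - 1) (hNγ : γ - β < N - 1) :
    ∃ K : ℝ, 0 < K ∧ ∀ a : ℂ, ‖a‖ < 1 →
      ∫⁻ z, ENNReal.ofReal ((1 - ‖z‖) ^ (-β) * ‖1 - starRingEnd ℂ a * z‖ ^ (-N)) *
        kappa ω z ∂area ≤
      ENNReal.ofReal (K * tailReal ω (1 - ‖a‖) * (1 - ‖a‖) ^ (1 - N - β)) := by
  have hC := hd.one_le
  set k : ℝ → ℝ := fun τ => 2 * (1 / (τ - β) + 1 / (N - 1 - (τ - β)))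
  have hkpos : ∀ τ, β < τ → τ - β < N - 1 → 0 < k τ := fun τ h1 h2 => by
    have h3 : 0 < τ - β := by linarith
    have h4 : 0 < N - 1 - (τ - β) := by linarith
    positivity
  have hk1 := hkpos lam hβlam hNlam
  have hk2 := hkpos γ hβγ hNγ
  refine ⟨C * (k lam + k γ), by positivity, fun a ha => ?_⟩
  have hda : 0 < 1 - ‖a‖ := by linarith
  have hdam : 1 - ‖a‖ ∈ Ioc (0 : ℝ) 1 := ⟨hda, by linarith [norm_nonneg a]⟩
  have hha := hd.pos _ hdam
  set A : ℝ → ℝ := fun τ => C * tailReal ω (1 - ‖a‖) * (1 - ‖a‖) ^ (-τ)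
  have hA : ∀ τ, 0 ≤ A τ := fun τ => by positivity
  set G : ℝ → ℂ → ℝ := fun τ z =>
    (1 - ‖z‖) ^ (τ - β - 1) * ‖1 - starRingEnd ℂ a * z‖ ^ (-N)
  have hmG : ∀ τ, Measurable fun z => ENNReal.ofReal (G τ z) := fun τ => by
    refine Measurable.ennreal_ofReal (Measurable.mul ?_ ?_)
    · exact (measurable_const.sub measurable_norm).pow_const _
    · exact (Continuous.measurable (by fun_prop)).pow_const _
  have hpt : ∀ z ∈ disk, ENNReal.ofReal ((1 - ‖z‖) ^ (-β) * ‖1 - starRingEnd ℂ a * z‖ ^ (-N)) *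
      kappa ω z ≤ ENNReal.ofReal (A lam) * ENNReal.ofReal (G lam z) +
        ENNReal.ofReal (A γ) * ENNReal.ofReal (G γ z) := by
    intro z hz
    have hz1 := mem_disk.mp hz
    have hdz : 0 < 1 - ‖z‖ := by linarith
    have hdzm : 1 - ‖z‖ ∈ Ioc (0 : ℝ) 1 := ⟨hdz, by linarith [norm_nonneg z]⟩
    have hhz := hd.pos _ hdzm
    have hGn : ∀ τ, 0 ≤ G τ z := fun τ => by positivity
    have hform : ∀ τ, A τ * G τ z = (C * ((1 - ‖z‖) / (1 - ‖a‖)) ^ τ * tailReal ω (1 - ‖a‖)) *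
        ((1 - ‖z‖) ^ (-β) * ‖1 - starRingEnd ℂ a * z‖ ^ (-N) / (1 - ‖z‖)) := by
      intro τ
      simp only [A, G]
      rw [Real.div_rpow hdz.le hda.le, Real.rpow_neg hda.le,
        show τ - β - 1 = τ + -β + -1 by ring, Real.rpow_add hdz, Real.rpow_add hdz,
        Real.rpow_neg_one]
      ring
    rw [hω.kappa_eq hz, ← ENNReal.ofReal_mul (by positivity), ← ENNReal.ofReal_mul (hA _),
      ← ENNReal.ofReal_mul (hA _),
      ← ENNReal.ofReal_add (mul_nonneg (hA _) (hGn _)) (mul_nonneg (hA _) (hGn _))]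
    refine ENNReal.ofReal_le_ofReal ?_
    have hle : tailReal ω (1 - ‖z‖) ≤ C * ((1 - ‖z‖) / (1 - ‖a‖)) ^ lam * tailReal ω (1 - ‖a‖) +
        C * ((1 - ‖z‖) / (1 - ‖a‖)) ^ γ * tailReal ω (1 - ‖a‖) := by
      rcases le_total (1 - ‖a‖) (1 - ‖z‖) with h | h
      · refine (hd.upper _ hdam _ hdzm h).trans (le_add_of_nonneg_right (by positivity))
      · refine (hd.lower _ hdzm _ hdam h).trans (le_add_of_nonneg_left (by positivity))
    rw [hform, hform, ← add_mul, mul_div_assoc', mul_comm _ (tailReal ω (1 - ‖z‖)), mul_div_assoc]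
    gcongr
  calc _ ≤ ∫⁻ z, (ENNReal.ofReal (A lam) * ENNReal.ofReal (G lam z) +
        ENNReal.ofReal (A γ) * ENNReal.ofReal (G γ z)) ∂area := by
        refine lintegral_mono_ae ?_
        filter_upwards [ae_area_mem_disk] with z hz using hpt z hz
    _ = ENNReal.ofReal (A lam) * ∫⁻ z, ENNReal.ofReal (G lam z) ∂area +
        ENNReal.ofReal (A γ) * ∫⁻ z, ENNReal.ofReal (G γ z) ∂area := by
        rw [lintegral_add_left ((hmG lam).const_mul _), lintegral_const_mul' _ _ ENNReal.ofReal_ne_top,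
          lintegral_const_mul' _ _ ENNReal.ofReal_ne_top]
    _ ≤ ENNReal.ofReal (A lam) * ENNReal.ofReal (k lam * (1 - ‖a‖) ^ (lam - β + 1 - N)) +
        ENNReal.ofReal (A γ) * ENNReal.ofReal (k γ * (1 - ‖a‖) ^ (γ - β + 1 - N)) := by
        gcongr
        · exact lintegral_kernel_le (by linarith) (by linarith) hN ha
        · exact lintegral_kernel_le (by linarith) (by linarith) hN ha
    _ = _ := by
        have hform : ∀ τ, A τ * (k τ * (1 - ‖a‖) ^ (τ - β + 1 - N)) =
            C * k τ * tailReal ω (1 - ‖a‖) * (1 - ‖a‖) ^ (1 - N - β) := by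
          intro τ
          simp only [A]
          rw [show 1 - N - β = -τ + (τ - β + 1 - N) by ring, Real.rpow_add hda]
          ring
        rw [← ENNReal.ofReal_mul (hA _), ← ENNReal.ofReal_mul (hA _), hform, hform,
          ← ENNReal.ofReal_add (by positivity) (by positivity)]
        congr 1
        ring

/-! ### Geometry at the scale `1 - |a|` and lattices -/

lemma area_ball {a : ℂ} {r : ℝ} (hr : 0 ≤ r) (h : ball a r ⊆ disk) :
    area (ball a r) = ENNReal.ofReal (r ^ 2) := by
  rw [area, Measure.smul_apply, Measure.restrict_apply measurableSet_ball, inter_eq_left.mpr h,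
    Complex.volume_ball, smul_eq_mul, ← ENNReal.ofReal_coe_nnreal, NNReal.coe_real_pi,
    ← ENNReal.ofReal_pow hr, ← ENNReal.ofReal_mul (by positivity),
    ← ENNReal.ofReal_mul (by positivity)]
  congr 1
  field_simp

lemma area_ball_le (a : ℂ) {r : ℝ} (hr : 0 ≤ r) : area (ball a r) ≤ ENNReal.ofReal (r ^ 2) := by
  rw [area, Measure.smul_apply, smul_eq_mul]
  calc _ ≤ ENNReal.ofReal π⁻¹ * volume (ball a r) := by
        exact mul_le_mul_right (Measure.restrict_apply_le _ _) _
    _ = _ := by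
        rw [Complex.volume_ball, ← ENNReal.ofReal_coe_nnreal, NNReal.coe_real_pi,
          ← ENNReal.ofReal_pow hr, ← ENNReal.ofReal_mul (by positivity),
          ← ENNReal.ofReal_mul (by positivity)]
        congr 1
        field_simp

lemma IsPowerDoubling.le_of_le_mul {h : ℝ → ℝ} {C lam γ : ℝ} (hd : IsPowerDoubling h C lam γ)
    {R : ℝ} (hR : 1 ≤ R) {x y : ℝ} (hx : x ∈ Ioc (0 : ℝ) 1) (hy : y ∈ Ioc (0 : ℝ) 1)
    (hyx : y ≤ R * x) : h y ≤ C * R ^ lam * h x := by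
  have hC := hd.one_le
  have hl := hd.lam_pos
  have hhx := hd.pos x hx
  rcases le_total y x with h1 | h1
  · refine (hd.mono y hy x hx h1).trans (le_mul_of_one_le_left hhx.le ?_)
    exact one_le_mul_of_one_le_of_one_le hC (Real.one_le_rpow hR hl.le)
  · refine (hd.upper x hx y hy h1).trans ?_
    have hx0 := hx.1
    have hy0 := hy.1
    gcongr
    rwa [div_le_iff₀ hx0]

/-- The distance to the unit circle varies little on small balls. -/
lemma one_sub_norm_mem_of_mem_closedBall {a w : ℂ} {t : ℝ}
    (hw : w ∈ closedBall a (t * (1 - ‖a‖))) :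
    (1 - t) * (1 - ‖a‖) ≤ 1 - ‖w‖ ∧ 1 - ‖w‖ ≤ (1 + t) * (1 - ‖a‖) := by
  rw [mem_closedBall_iff_norm] at hw
  have h1 := norm_sub_norm_le w a
  have h2 := norm_sub_norm_le a w
  rw [norm_sub_rev] at h2
  constructor <;> linarith

lemma ball_subset_disk {a : ℂ} {t : ℝ} (ha : ‖a‖ < 1) (ht : t ≤ 1) :
    ball a (t * (1 - ‖a‖)) ⊆ disk := by
  intro w hw
  rw [mem_ball_iff_norm] at hw
  rw [mem_disk]
  have h1 := norm_sub_norm_le w a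
  nlinarith

lemma closedBall_subset_disk {a : ℂ} {t : ℝ} (ha : ‖a‖ < 1) (ht : t < 1) :
    closedBall a (t * (1 - ‖a‖)) ⊆ disk := by
  intro w hw
  have := (one_sub_norm_mem_of_mem_closedBall hw).1
  rw [mem_disk]
  nlinarith

/-- Expand `1 - āw = (1 - |a|²) - ā(w - a)`. -/
lemma norm_one_sub_conj_le_of_mem {a w : ℂ} {t : ℝ} (ha : ‖a‖ < 1)
    (hw : w ∈ closedBall a (t * (1 - ‖a‖))) :
    ‖1 - starRingEnd ℂ a * w‖ ≤ (2 + t) * (1 - ‖a‖) := by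
  rw [mem_closedBall_iff_norm] at hw
  have h1 : 1 - starRingEnd ℂ a * w = (1 - ‖a‖ ^ 2 : ℝ) - starRingEnd ℂ a * (w - a) := by
    have : starRingEnd ℂ a * a = (‖a‖ ^ 2 : ℝ) := by
      rw [mul_comm, Complex.mul_conj, Complex.normSq_eq_norm_sq]
    rw [mul_sub, this]; push_cast; ring
  have hnn := norm_nonneg a
  have h2 : ‖((1 - ‖a‖ ^ 2 : ℝ) : ℂ)‖ = 1 - ‖a‖ ^ 2 := by
    rw [Complex.norm_real, Real.norm_of_nonneg]; nlinarith
  rw [h1]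
  refine (norm_sub_le _ _).trans ?_
  rw [h2, norm_mul, Complex.norm_conj]
  have h3 : ‖a‖ * ‖w - a‖ ≤ 1 * (t * (1 - ‖a‖)) := by gcongr
  nlinarith

lemma norm_one_sub_conj_comm (z w : ℂ) :
    ‖1 - starRingEnd ℂ z * w‖ = ‖1 - starRingEnd ℂ w * z‖ := by
  rw [← Complex.norm_conj (1 - starRingEnd ℂ z * w)]
  simp [mul_comm]

/-- A family of points of the disk which is separated and dense at the scale of the distance to
the unit circle. -/
structure IsLattice (c : ℝ) (Z : Set ℂ) : Prop where
  subset : Z ⊆ disk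
  countable : Z.Countable
  disjoint : Z.PairwiseDisjoint fun a => closedBall a (c * (1 - ‖a‖))
  cover : ∀ z ∈ disk, ∃ a ∈ Z, closedBall z (c * (1 - ‖z‖)) ⊆ closedBall a (5 * c * (1 - ‖a‖))

/-- Vitali's covering lemma with enlargement factor `5`. It places the whole ball about any `z`, not
only `z` itself, inside one enlarged ball; later this fits a pseudohyperbolic disk into one cell. -/
lemma exists_isLattice {c : ℝ} (hc : 0 < c) : ∃ Z, IsLattice c Z := by
  obtain ⟨u, hu, hdisj, hcov⟩ := Vitali.exists_disjoint_subfamily_covering_enlargement_closedBall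
    disk (fun a : ℂ => a) (fun a => c * (1 - ‖a‖)) c
    (fun a _ => by nlinarith [norm_nonneg a]) 5 (by norm_num)
  refine ⟨u, hu, ?_, hdisj, fun z hz => ?_⟩
  · refine hdisj.countable_of_nonempty_interior fun a ha => ?_
    have := mem_disk.mp (hu ha)
    rw [interior_closedBall _ (by nlinarith)]
    exact nonempty_ball.mpr (by nlinarith)
  · obtain ⟨b, hb, h⟩ := hcov z hz
    exact ⟨b, hb, by rwa [mul_assoc]⟩

lemma two_rpow_neg_abs_mul_le {x y : ℝ} (τ : ℝ) (hx : 0 < x) (h1 : x / 2 ≤ y) (h2 : y ≤ 2 * x) :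
    2 ^ (-|τ|) * x ^ τ ≤ y ^ τ := by
  have hy : 0 < y := by linarith
  rcases le_total 0 τ with h | h
  · rw [abs_of_nonneg h, Real.rpow_neg two_pos.le, inv_mul_eq_div, ← Real.div_rpow hx.le two_pos.le]
    exact Real.rpow_le_rpow (by positivity) h1 h
  · rw [abs_of_nonpos h, neg_neg, ← Real.mul_rpow two_pos.le hx.le]
    exact Real.rpow_le_rpow_of_nonpos hy h2 h

lemma IsLattice.tsum_setLIntegral_le {c : ℝ} {Z : Set ℂ} (hZ : IsLattice c Z) (F : ℂ → ℝ≥0∞)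
    (ν : Measure ℂ) (I : Set Z) {A : Set ℂ} (hA : ∀ a ∈ I, ball (a : ℂ) (c * (1 - ‖(a : ℂ)‖)) ⊆ A) :
    ∑' a : I, ∫⁻ w in ball (a : ℂ) (c * (1 - ‖(a : ℂ)‖)), F w ∂ν ≤ ∫⁻ w in A, F w ∂ν := by
  have : Countable Z := hZ.countable.to_subtype
  rw [← lintegral_iUnion (fun a => measurableSet_ball)]
  · exact lintegral_mono_set (iUnion_subset fun a => hA _ a.2)
  · intro a b hab
    refine (hZ.disjoint a.1.2 b.1.2 fun h => hab ?_).mono ball_subset_closedBall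
      ball_subset_closedBall
    exact Subtype.ext (Subtype.ext h)

/-- Each term is comparable to an integral of the kernel over the ball of radius `c(1-|a|)`. These
balls are disjoint, so the sum is at most a Forelli–Rudin integral with `σ = N - β - 1` and pole
`z`. -/
lemma IsLattice.exists_tsum_kernel_le {c : ℝ} {Z : Set ℂ} (hZ : IsLattice c Z) (hc : 0 < c)
    (hc2 : c ≤ 1 / 2) {β N : ℝ} (hβ : 0 < β) (hβN : 1 + β < N) (hN : 2 ≤ N) :
    ∃ K : ℝ, 0 < K ∧ ∀ z ∈ disk,
      ∑' a : Z, ENNReal.ofReal ((1 - ‖(a : ℂ)‖) ^ (N - β) *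
        ‖1 - starRingEnd ℂ (a : ℂ) * z‖ ^ (-N)) ≤ ENNReal.ofReal (K * (1 - ‖z‖) ^ (-β)) := by
  set σ := N - β - 1 with hσ
  have hσ0 : 0 < σ := by linarith
  set k := 2 * (1 / σ + 1 / (N - 1 - σ))
  have hk : 0 < k := by
    have : 0 < N - 1 - σ := by linarith
    positivity
  -- The three factors are the losses from replacing `1 - |w|` by `1 - |a|`, from replacing `w` by
  -- `a` in the kernel, and from the area `c²(1-|a|)²` of the ball.
  set m : ℝ := 2 ^ (-|σ - 1|) * 2 ^ (-N) * c ^ 2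
  have hm : 0 < m := by positivity
  refine ⟨m⁻¹ * k, by positivity, fun z hz => ?_⟩
  have hz1 := mem_disk.mp hz
  set F : ℂ → ℝ≥0∞ := fun w =>
    ENNReal.ofReal ((1 - ‖w‖) ^ (σ - 1) * ‖1 - starRingEnd ℂ z * w‖ ^ (-N))
  have hterm : ∀ a : Z, ENNReal.ofReal ((1 - ‖(a : ℂ)‖) ^ (N - β) *
        ‖1 - starRingEnd ℂ (a : ℂ) * z‖ ^ (-N)) ≤ ENNReal.ofReal m⁻¹ *
      ∫⁻ w in ball (a : ℂ) (c * (1 - ‖(a : ℂ)‖)), F w ∂area := by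
    rintro ⟨a, ha⟩
    have ha1 := mem_disk.mp (hZ.subset ha)
    have hda : 0 < 1 - ‖a‖ := by linarith
    have hker : 0 < ‖1 - starRingEnd ℂ a * z‖ := by
      have := one_sub_norm_mul_norm_le a z
      nlinarith [norm_nonneg a, norm_nonneg z]
    have hlow : ∀ w ∈ ball a (c * (1 - ‖a‖)), ENNReal.ofReal (2 ^ (-|σ - 1|) * 2 ^ (-N) *
        ((1 - ‖a‖) ^ (σ - 1) * ‖1 - starRingEnd ℂ a * z‖ ^ (-N))) ≤ F w := by
      intro w hw
      obtain ⟨h1, h2⟩ := one_sub_norm_mem_of_mem_closedBall (ball_subset_closedBall hw)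
      have hw1 := mem_disk.mp (ball_subset_disk ha1 (by linarith) hw)
      have e1 : 2 ^ (-|σ - 1|) * (1 - ‖a‖) ^ (σ - 1) ≤ (1 - ‖w‖) ^ (σ - 1) :=
        two_rpow_neg_abs_mul_le _ hda (by nlinarith) (by nlinarith)
      have e2 : ‖1 - starRingEnd ℂ z * w‖ ≤ 2 * ‖1 - starRingEnd ℂ a * z‖ := by
        have h3 := one_sub_norm_mul_norm_le a z
        have h4 : ‖1 - starRingEnd ℂ z * w‖ ≤ ‖1 - starRingEnd ℂ z * a‖ + ‖z‖ * ‖w - a‖ := by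
          rw [← Complex.norm_conj z, ← norm_mul]
          refine le_trans (le_of_eq ?_) (norm_sub_le _ _)
          congr 1; ring
        rw [norm_one_sub_conj_comm z a] at h4
        rw [mem_ball_iff_norm] at hw
        have h5 : ‖z‖ * ‖w - a‖ ≤ 1 * (c * (1 - ‖a‖)) := by gcongr
        nlinarith [norm_nonneg a, norm_nonneg z]
      have hker' : 0 < ‖1 - starRingEnd ℂ z * w‖ := by
        have := one_sub_norm_mul_norm_le z w
        nlinarith [norm_nonneg w, norm_nonneg z]
      have e3 : 2 ^ (-N) * ‖1 - starRingEnd ℂ a * z‖ ^ (-N) ≤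
          ‖1 - starRingEnd ℂ z * w‖ ^ (-N) := by
        rw [← Real.mul_rpow two_pos.le hker.le]
        exact Real.rpow_le_rpow_of_nonpos hker' e2 (by linarith)
      refine ENNReal.ofReal_le_ofReal ?_
      calc _ = (2 ^ (-|σ - 1|) * (1 - ‖a‖) ^ (σ - 1)) *
            (2 ^ (-N) * ‖1 - starRingEnd ℂ a * z‖ ^ (-N)) := by ring
        _ ≤ _ := by gcongr
    have hint := setLIntegral_mono' (μ := area) measurableSet_ball hlow
    rw [setLIntegral_const, area_ball (by positivity) (ball_subset_disk ha1 (by linarith)),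
      ← ENNReal.ofReal_mul (by positivity)] at hint
    refine le_trans (le_of_eq ?_) (mul_le_mul_right hint _)
    rw [← ENNReal.ofReal_mul (by positivity)]
    congr 1
    have e4 : (1 - ‖a‖) ^ (N - β) = (1 - ‖a‖) ^ (σ - 1) * (1 - ‖a‖) ^ 2 := by
      rw [← Real.rpow_two, ← Real.rpow_add hda]
      congr 1; simp only [hσ]; ring
    rw [e4, mul_pow, inv_mul_eq_div, eq_div_iff hm.ne']
    ring
  have hall := hZ.tsum_setLIntegral_le F area univ (A := univ) (fun a _ => subset_univ _)
  rw [Measure.restrict_univ] at hall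
  calc _ ≤ ∑' a : Z, ENNReal.ofReal m⁻¹ *
        ∫⁻ w in ball (a : ℂ) (c * (1 - ‖(a : ℂ)‖)), F w ∂area := ENNReal.tsum_le_tsum hterm
    _ = ENNReal.ofReal m⁻¹ * ∑' a : (univ : Set Z),
        ∫⁻ w in ball (a : ℂ) (c * (1 - ‖(a : ℂ)‖)), F w ∂area := by
        rw [ENNReal.tsum_mul_left,
          tsum_univ fun a : Z => ∫⁻ w in ball (a : ℂ) (c * (1 - ‖(a : ℂ)‖)), F w ∂area]
    _ ≤ ENNReal.ofReal m⁻¹ * ENNReal.ofReal (k * (1 - ‖z‖) ^ (σ + 1 - N)) := by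
        gcongr
        exact hall.trans (lintegral_kernel_le hσ0 (by linarith) hN hz1)
    _ = _ := by
        rw [← ENNReal.ofReal_mul (by positivity), show σ + 1 - N = -β by simp only [hσ]; ring,
          ← mul_assoc]

/-- The half-size balls around the points of a lattice have bounded overlap. -/
lemma IsLattice.exists_overlap_le {c : ℝ} {Z : Set ℂ} (hZ : IsLattice c Z) (hc : 0 < c)
    (hc2 : c ≤ 1 / 2) : ∃ K : ℝ, 0 < K ∧ ∀ z ∈ disk,
      ∑' a : Z, (closedBall (a : ℂ) (1 / 2 * (1 - ‖(a : ℂ)‖))).indicator (fun _ => (1 : ℝ≥0∞)) z ≤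
        ENNReal.ofReal K := by
  obtain ⟨K, hK, h⟩ := hZ.exists_tsum_kernel_le hc hc2 (β := 1) (N := 4) one_pos
    (by norm_num) (by norm_num)
  -- If `z` lies in the ball of `a`, then `|1 - āz| ≤ (5/2)(1-|a|)` and `1-|a| ≤ 2(1-|z|)`. Since
  -- `2·(5/2)^4 < 80`, the indicator is at most `80(1-|z|)` times the kernel term with `N = 4`, `β =
  -- 1`.
  refine ⟨80 * K, by positivity, fun z hz => ?_⟩
  have hz1 := mem_disk.mp hz
  have hdz : 0 < 1 - ‖z‖ := by linarith
  calc _ ≤ ∑' a : Z, ENNReal.ofReal (80 * (1 - ‖z‖)) * ENNReal.ofReal ((1 - ‖(a : ℂ)‖) ^ ((4 : ℝ) - 1) *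
        ‖1 - starRingEnd ℂ (a : ℂ) * z‖ ^ (-4 : ℝ)) := by
        refine ENNReal.tsum_le_tsum fun ⟨a, ha⟩ => ?_
        by_cases hmem : z ∈ closedBall a (1 / 2 * (1 - ‖a‖))
        · have ha1 := mem_disk.mp (hZ.subset ha)
          have hda : 0 < 1 - ‖a‖ := by linarith
          have h1 := norm_one_sub_conj_le_of_mem ha1 hmem
          have h2 := (one_sub_norm_mem_of_mem_closedBall hmem).1
          have hker : 0 < ‖1 - starRingEnd ℂ a * z‖ := by
            have := one_sub_norm_mul_norm_le a z
            nlinarith [norm_nonneg a, norm_nonneg z]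
          rw [indicator_of_mem hmem, ← ENNReal.ofReal_mul (by positivity), ENNReal.one_le_ofReal,
            Real.rpow_neg hker.le]
          have e1 : (1 - ‖a‖) ^ ((4 : ℝ) - 1) = (1 - ‖a‖) ^ 3 := by
            rw [← Real.rpow_natCast]; norm_num
          have e2 : ‖1 - starRingEnd ℂ a * z‖ ^ (4 : ℝ) = ‖1 - starRingEnd ℂ a * z‖ ^ 4 := by
            rw [← Real.rpow_natCast]; norm_num
          rw [e1, e2, ← div_eq_mul_inv, ← mul_div_assoc, le_div_iff₀ (by positivity), one_mul]
          calc _ ≤ ((2 + 1 / 2) * (1 - ‖a‖)) ^ 4 := by gcongr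
            _ = (625 / 16 * (1 - ‖a‖)) * (1 - ‖a‖) ^ 3 := by ring
            _ ≤ _ := mul_le_mul_of_nonneg_right (by linarith) (by positivity)
        · rw [indicator_of_notMem hmem]; exact zero_le
    _ ≤ ENNReal.ofReal (80 * (1 - ‖z‖)) * ENNReal.ofReal (K * (1 - ‖z‖) ^ (-1 : ℝ)) := by
        rw [ENNReal.tsum_mul_left]
        gcongr
        exact h z hz
    _ = _ := by
        rw [← ENNReal.ofReal_mul (by positivity), Real.rpow_neg_one]
        congr 1
        field_simp

/-! ### Bump functions and the synthesis estimate -/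

/-- The size `ω̂(a) (1 - |a|)` of the `κ`-mass near the point `a`. -/
noncomputable def cellMass (ω : ℂ → ℝ) (a : ℂ) : ℝ := tailReal ω (1 - ‖a‖) * (1 - ‖a‖)

/-- The analytic bump function at the point `a`. -/
noncomputable def bump (a z : ℂ) : ℂ := ((1 - ‖a‖ : ℝ) : ℂ) / (1 - starRingEnd ℂ a * z)

lemma IsPowerDoubling.cellMass_pos {ω : ℂ → ℝ} {C lam γ : ℝ}
    (hd : IsPowerDoubling (tailReal ω) C lam γ) {a : ℂ} (ha : ‖a‖ < 1) : 0 < cellMass ω a :=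
  mul_pos (hd.pos _ ⟨by linarith, by linarith [norm_nonneg a]⟩) (by linarith)

lemma norm_one_sub_conj_pos {a z : ℂ} (ha : ‖a‖ < 1) (hz : ‖z‖ < 1) :
    0 < ‖1 - starRingEnd ℂ a * z‖ := by
  have := one_sub_norm_mul_norm_le a z
  nlinarith [norm_nonneg a, norm_nonneg z]

lemma differentiableOn_bump {a : ℂ} (ha : ‖a‖ < 1) : DifferentiableOn ℂ (bump a) disk := by
  refine DifferentiableOn.div (by fun_prop) (by fun_prop) fun z hz => ?_
  exact norm_pos_iff.mp (norm_one_sub_conj_pos ha (mem_disk.mp hz))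

lemma measurable_bump (a : ℂ) : Measurable (bump a) :=
  measurable_const.div (Continuous.measurable (by fun_prop))

lemma norm_bump {a : ℂ} (ha : ‖a‖ < 1) (z : ℂ) :
    ‖bump a z‖ = (1 - ‖a‖) * ‖1 - starRingEnd ℂ a * z‖⁻¹ := by
  rw [bump, norm_div, Complex.norm_real, Real.norm_of_nonneg (by linarith), div_eq_mul_inv]

lemma enorm_bump_rpow {a z : ℂ} (ha : ‖a‖ < 1) (hz : ‖z‖ < 1) (τ : ℝ) :
    ‖bump a z‖ₑ ^ τ =
      ENNReal.ofReal ((1 - ‖a‖) ^ τ * ‖1 - starRingEnd ℂ a * z‖ ^ (-τ)) := by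
  have h1 := norm_one_sub_conj_pos ha hz
  have hda : 0 < 1 - ‖a‖ := by linarith
  rw [← ofReal_norm, norm_bump ha, ENNReal.ofReal_rpow_of_pos (by positivity),
    Real.mul_rpow hda.le (by positivity), Real.inv_rpow h1.le, Real.rpow_neg h1.le]

/-- A high power of the bump has κ-integral of the order of the mass of the cell at `a`. The extra
factor `(1-|z|)^{-β}` is needed for the Hölder weight when `p > 1`. -/
lemma IsDWeight.lintegral_bump_le {ω : ℂ → ℝ} (hω : IsDWeight ω) {C lam γ : ℝ}
    (hd : IsPowerDoubling (tailReal ω) C lam γ) {β N : ℝ} (hβlam : β < lam)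
    (hβγ : β < γ) (hN : 2 ≤ N) (hNlam : lam - β < N - 1) (hNγ : γ - β < N - 1) :
    ∃ K : ℝ, 0 < K ∧ ∀ a : ℂ, ‖a‖ < 1 →
      ∫⁻ z, ‖bump a z‖ₑ ^ N * ENNReal.ofReal ((1 - ‖z‖) ^ (-β)) * kappa ω z ∂area ≤
        ENNReal.ofReal (K * cellMass ω a * (1 - ‖a‖) ^ (-β)) := by
  obtain ⟨K, hK, h⟩ := hω.lintegral_kernel_kappa_le hd hβlam hβγ hN hNlam hNγ
  refine ⟨K, hK, fun a ha => ?_⟩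
  have hda : 0 < 1 - ‖a‖ := by linarith
  calc _ = ∫⁻ z, ENNReal.ofReal ((1 - ‖a‖) ^ N) *
        (ENNReal.ofReal ((1 - ‖z‖) ^ (-β) * ‖1 - starRingEnd ℂ a * z‖ ^ (-N)) * kappa ω z) ∂area := by
        refine lintegral_congr_ae ?_
        filter_upwards [ae_area_mem_disk] with z hz
        have hdz : 0 < 1 - ‖z‖ := by linarith [mem_disk.mp hz]
        rw [enorm_bump_rpow ha (mem_disk.mp hz), ← mul_assoc,
          ← ENNReal.ofReal_mul (by positivity), ← ENNReal.ofReal_mul (by positivity)]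
        congr 2
        ring
    _ ≤ ENNReal.ofReal ((1 - ‖a‖) ^ N) *
        ENNReal.ofReal (K * tailReal ω (1 - ‖a‖) * (1 - ‖a‖) ^ (1 - N - β)) := by
        rw [lintegral_const_mul' _ _ ENNReal.ofReal_ne_top]
        gcongr
        exact h a ha
    _ = _ := by
        rw [← ENNReal.ofReal_mul (by positivity), cellMass]
        congr 1
        rw [show 1 - N - β = -N + (1 + -β) by ring, Real.rpow_add hda, Real.rpow_add hda,
          Real.rpow_one, Real.rpow_neg hda.le N]
        field_simp

lemma ennreal_rpow_sum_le_sum_rpow {ι : Type*} (s : Finset ι) (f : ι → ℝ≥0∞) {p : ℝ} (hp : 0 < p)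
    (hp1 : p ≤ 1) : (∑ i ∈ s, f i) ^ p ≤ ∑ i ∈ s, f i ^ p := by
  classical
  induction s using Finset.induction_on with
  | empty => simp [hp]
  | insert a s ha ih =>
    rw [Finset.sum_insert ha, Finset.sum_insert ha]
    exact (ENNReal.rpow_add_le_add_rpow _ _ hp.le hp1).trans (add_le_add_right ih _)

/-- Subadditivity of `t ↦ t^p` reduces the sum to single bumps, so no separation of the points
enters. `M` is chosen with `Mp ≥ lam + γ + 2`, enough for the kernel estimate. -/
lemma IsDWeight.exists_sum_bump_le_of_le_one {ω : ℂ → ℝ} (hω : IsDWeight ω) {p : ℝ} (hp : 0 < p)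
    (hp1 : p ≤ 1) {Z : Set ℂ} (hZ : Z ⊆ disk) :
    ∃ M : ℕ, ∃ K : ℝ, 0 < K ∧ ∀ (F : Finset Z) (A : Z → ℝ≥0∞), (∀ a, A a ≠ ∞) →
      ∫⁻ z, (∑ a ∈ F, A a * ‖bump a z‖ₑ ^ (M : ℝ)) ^ p * kappa ω z ∂area ≤
        ENNReal.ofReal K * ∑ a ∈ F, A a ^ p * ENNReal.ofReal (cellMass ω a) := by
  obtain ⟨C, lam, γ, hd⟩ := hω.isPowerDoubling
  have hlam := hd.lam_pos
  have hγ := hd.γ_pos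
  obtain ⟨M, hM⟩ := exists_nat_ge ((lam + γ + 2) / p)
  rw [div_le_iff₀ hp] at hM
  obtain ⟨K, hK, h⟩ := hω.lintegral_bump_le hd (β := 0) (N := M * p) hlam hγ (by linarith)
    (by linarith) (by linarith)
  simp only [neg_zero, Real.rpow_zero, ENNReal.ofReal_one, mul_one] at h
  refine ⟨M, K, hK, fun F A hA => ?_⟩
  calc _ ≤ ∫⁻ z, ∑ a ∈ F, A a ^ p * (‖bump a z‖ₑ ^ (M * p) * kappa ω z) ∂area := by
        refine lintegral_mono fun z => ?_
        refine (mul_le_mul_left (ennreal_rpow_sum_le_sum_rpow F _ hp hp1) _).trans (le_of_eq ?_)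
        rw [Finset.sum_mul]
        refine Finset.sum_congr rfl fun a _ => ?_
        rw [ENNReal.mul_rpow_of_nonneg _ _ hp.le, ← ENNReal.rpow_mul, mul_assoc]
    _ = ∑ a ∈ F, A a ^ p * ∫⁻ z, ‖bump a z‖ₑ ^ (M * p) * kappa ω z ∂area := by
        rw [lintegral_finsetSum]
        · refine Finset.sum_congr rfl fun a _ => ?_
          rw [lintegral_const_mul' _ _ (ENNReal.rpow_ne_top_of_nonneg hp.le (hA a))]
        · exact fun a _ => (((measurable_bump a).enorm.pow_const _).mul (measurable_kappa ω)).const_mul _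
    _ ≤ ∑ a ∈ F, A a ^ p * ENNReal.ofReal (K * cellMass ω a) := by
        gcongr with a
        exact h a (mem_disk.mp (hZ a.2))
    _ = _ := by
        rw [Finset.mul_sum]
        refine Finset.sum_congr rfl fun a _ => ?_
        rw [ENNReal.ofReal_mul hK.le]
        ring

/-- A Schur test with weights `(1-|a|)^η`. Hölder splits `|b_a|^M` into its powers `M/p` and `M/q`;
the lattice kernel sum bounds the dual factor by a power of `1-|z|`. The remaining `(1-|z|)^{-ηp}`
is absorbed when each bump is integrated. -/
lemma IsDWeight.exists_sum_bump_le_of_one_lt {ω : ℂ → ℝ} (hω : IsDWeight ω) {p : ℝ}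
    (hp1 : 1 < p) {c : ℝ} {Z : Set ℂ} (hZ : IsLattice c Z) (hc : 0 < c) (hc2 : c ≤ 1 / 2) :
    ∃ M : ℕ, ∃ K : ℝ, 0 < K ∧ ∀ (F : Finset Z) (A : Z → ℝ≥0∞), (∀ a, A a ≠ ∞) →
      ∫⁻ z, (∑ a ∈ F, A a * ‖bump a z‖ₑ ^ (M : ℝ)) ^ p * kappa ω z ∂area ≤
        ENNReal.ofReal K * ∑ a ∈ F, A a ^ p * ENNReal.ofReal (cellMass ω a) := by
  obtain ⟨C, lam, γ, hd⟩ := hω.isPowerDoubling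
  have hlam := hd.lam_pos
  have hγ := hd.γ_pos
  have hp : 0 < p := by linarith
  set q := p.conjExponent
  have hpq : p.HolderConjugate q := Real.HolderConjugate.conjExponent hp1
  have hq : 0 < q := hpq.symm.pos
  -- Chosen so that `ηp` is half of `min lam γ`, below both exponents as the weighted bump integral
  -- requires.
  set η := min lam γ / (2 * p)
  have hη : 0 < η := div_pos (lt_min hlam hγ) (by positivity)
  have hηp : η * p = min lam γ / 2 := by simp only [η]; field_simp
  have hηlam : η * p < lam := by rw [hηp]; linarith [min_le_left lam γ]
  have hηγ : η * p < γ := by rw [hηp]; linarith [min_le_right lam γ]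
  have hηp0 : 0 < η * p := by positivity
  have hηq0 : 0 < η * q := by positivity
  obtain ⟨M, hM⟩ := exists_nat_ge (lam + γ + η * q + 2)
  obtain ⟨K, hK, h⟩ := hω.lintegral_bump_le hd (β := η * p) (N := M) hηlam hηγ (by linarith)
    (by linarith) (by linarith)
  obtain ⟨K₁, hK₁, hS⟩ := hZ.exists_tsum_kernel_le hc hc2 (β := η * q) (N := M) hηq0
    (by linarith) (by linarith)
  refine ⟨M, K₁ ^ (p / q) * K, by positivity, fun F A hA => ?_⟩
  set D : Z → ℝ≥0∞ := fun a => ENNReal.ofReal (1 - ‖(a : ℂ)‖)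
  have hDpos : ∀ a : Z, 0 < 1 - ‖(a : ℂ)‖ := fun a => by linarith [mem_disk.mp (hZ.subset a.2)]
  have hD0 : ∀ a, D a ≠ 0 := fun a => by simpa [D] using hDpos a
  have hDt : ∀ a, D a ≠ ∞ := fun a => ENNReal.ofReal_ne_top
  have hM0 : (0 : ℝ) ≤ M := Nat.cast_nonneg M
  have hpt : ∀ z ∈ disk, (∑ a ∈ F, A a * ‖bump a z‖ₑ ^ (M : ℝ)) ^ p ≤
      (∑ a ∈ F, (A a * D a ^ η) ^ p * ‖bump a z‖ₑ ^ (M : ℝ)) *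
        (ENNReal.ofReal (K₁ ^ (p / q)) * ENNReal.ofReal ((1 - ‖z‖) ^ (-(η * p)))) := by
    intro z hz
    have hz1 := mem_disk.mp hz
    have hdz : 0 < 1 - ‖z‖ := by linarith
    have hsplit : ∀ a : Z, A a * ‖bump a z‖ₑ ^ (M : ℝ) =
        (A a * D a ^ η * ‖bump a z‖ₑ ^ (M / p : ℝ)) * (D a ^ (-η) * ‖bump a z‖ₑ ^ (M / q : ℝ)) := by
      intro a
      have e1 : D a ^ η * D a ^ (-η) = 1 := by
        rw [← ENNReal.rpow_add _ _ (hD0 a) (hDt a)]; simp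
      have e2 : ‖bump a z‖ₑ ^ (M / p : ℝ) * ‖bump a z‖ₑ ^ (M / q : ℝ) = ‖bump a z‖ₑ ^ (M : ℝ) := by
        rw [← ENNReal.rpow_add_of_nonneg _ _ (by positivity) (by positivity), div_eq_mul_inv,
          div_eq_mul_inv, ← mul_add, hpq.inv_add_inv_eq_one, mul_one]
      calc _ = A a * (D a ^ η * D a ^ (-η)) *
            (‖bump a z‖ₑ ^ (M / p : ℝ) * ‖bump a z‖ₑ ^ (M / q : ℝ)) := by rw [e1, e2, mul_one]
        _ = _ := by ring
    have hsecond : ∑ a ∈ F, (D a ^ (-η) * ‖bump a z‖ₑ ^ (M / q : ℝ)) ^ q ≤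
        ENNReal.ofReal (K₁ * (1 - ‖z‖) ^ (-(η * q))) := by
      refine le_trans (le_of_eq ?_) ((ENNReal.sum_le_tsum F).trans (hS z hz))
      refine Finset.sum_congr rfl fun a _ => ?_
      rw [ENNReal.mul_rpow_of_nonneg _ _ hq.le, ← ENNReal.rpow_mul, ← ENNReal.rpow_mul,
        div_mul_cancel₀ _ hq.ne', enorm_bump_rpow (mem_disk.mp (hZ.subset a.2)) hz1,
        ENNReal.ofReal_rpow_of_pos (hDpos a), ← ENNReal.ofReal_mul (by have := hDpos a; positivity),
        ← mul_assoc, ← Real.rpow_add (hDpos a)]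
      congr 3
      ring
    have hfirst : ∀ a : Z, (A a * D a ^ η * ‖bump a z‖ₑ ^ (M / p : ℝ)) ^ p =
        (A a * D a ^ η) ^ p * ‖bump a z‖ₑ ^ (M : ℝ) := by
      intro a
      rw [ENNReal.mul_rpow_of_nonneg _ _ hp.le, ← ENNReal.rpow_mul ‖bump a z‖ₑ,
        div_mul_cancel₀ _ hp.ne']
    have hH := ENNReal.inner_le_Lp_mul_Lq F (fun a => A a * D a ^ η * ‖bump a z‖ₑ ^ (M / p : ℝ))
      (fun a => D a ^ (-η) * ‖bump a z‖ₑ ^ (M / q : ℝ)) hpq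
    simp_rw [← hsplit, hfirst] at hH
    calc _ ≤ ((∑ a ∈ F, (A a * D a ^ η) ^ p * ‖bump a z‖ₑ ^ (M : ℝ)) ^ (1 / p) *
          (ENNReal.ofReal (K₁ * (1 - ‖z‖) ^ (-(η * q)))) ^ (1 / q)) ^ p := by
          gcongr
          refine hH.trans ?_
          gcongr
      _ = _ := by
          rw [ENNReal.mul_rpow_of_nonneg _ _ hp.le, ← ENNReal.rpow_mul, ← ENNReal.rpow_mul,
            one_div_mul_cancel hp.ne', ENNReal.rpow_one, one_div_mul_eq_div,
            ENNReal.ofReal_rpow_of_pos (by positivity), ← ENNReal.ofReal_mul (by positivity),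
            Real.mul_rpow hK₁.le (by positivity), ← Real.rpow_mul hdz.le]
          congr 4
          rw [hpq.div_conj_eq_sub_one]
          linear_combination -η * hpq.sub_one_mul_conj
  have hmeas : ∀ a : Z, Measurable fun z => (A a * D a ^ η) ^ p * (ENNReal.ofReal (K₁ ^ (p / q)) *
        (‖bump a z‖ₑ ^ (M : ℝ) * ENNReal.ofReal ((1 - ‖z‖) ^ (-(η * p))) * kappa ω z)) := by
    intro a
    have h1 : Measurable fun z : ℂ => ENNReal.ofReal ((1 - ‖z‖) ^ (-(η * p))) :=
      ((measurable_const.sub measurable_norm).pow_const _).ennreal_ofReal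
    exact (((((measurable_bump a).enorm.pow_const _).mul h1).mul (measurable_kappa ω)).const_mul
      _).const_mul _
  calc _ ≤ ∫⁻ z, ∑ a ∈ F, (A a * D a ^ η) ^ p * (ENNReal.ofReal (K₁ ^ (p / q)) *
        (‖bump a z‖ₑ ^ (M : ℝ) * ENNReal.ofReal ((1 - ‖z‖) ^ (-(η * p))) * kappa ω z)) ∂area := by
        refine lintegral_mono_ae ?_
        filter_upwards [ae_area_mem_disk] with z hz
        refine (mul_le_mul_left (hpt z hz) _).trans (le_of_eq ?_)
        rw [Finset.sum_mul, Finset.sum_mul]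
        refine Finset.sum_congr rfl fun a _ => ?_
        ring
    _ = ∑ a ∈ F, (A a * D a ^ η) ^ p * (ENNReal.ofReal (K₁ ^ (p / q)) *
        ∫⁻ z, ‖bump a z‖ₑ ^ (M : ℝ) * ENNReal.ofReal ((1 - ‖z‖) ^ (-(η * p))) *
          kappa ω z ∂area) := by
        rw [lintegral_finsetSum _ fun a _ => hmeas a]
        refine Finset.sum_congr rfl fun a _ => ?_
        rw [lintegral_const_mul', lintegral_const_mul' _ _ ENNReal.ofReal_ne_top]
        exact ENNReal.rpow_ne_top_of_nonneg hp.le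
          (ENNReal.mul_ne_top (hA a) (ENNReal.rpow_ne_top_of_nonneg hη.le (hDt a)))
    _ ≤ ∑ a ∈ F, (A a * D a ^ η) ^ p * (ENNReal.ofReal (K₁ ^ (p / q)) *
        ENNReal.ofReal (K * cellMass ω a * (1 - ‖(a : ℂ)‖) ^ (-(η * p)))) := by
        gcongr with a
        exact h a (mem_disk.mp (hZ.subset a.2))
    _ = _ := by
        rw [Finset.mul_sum]
        refine Finset.sum_congr rfl fun a _ => ?_
        have hm := (hd.cellMass_pos (mem_disk.mp (hZ.subset a.2))).le
        have hda := hDpos a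
        rw [ENNReal.mul_rpow_of_nonneg _ _ hp.le, ← ENNReal.rpow_mul, ENNReal.ofReal_rpow_of_pos hda,
          ENNReal.ofReal_mul (by positivity), ENNReal.ofReal_mul hK.le,
          ENNReal.ofReal_mul (by positivity)]
        have e : ENNReal.ofReal ((1 - ‖(a : ℂ)‖) ^ (η * p)) *
            ENNReal.ofReal ((1 - ‖(a : ℂ)‖) ^ (-(η * p))) = 1 := by
          rw [← ENNReal.ofReal_mul (by positivity), ← Real.rpow_add hda]; simp
        calc _ = A a ^ p * ENNReal.ofReal (K₁ ^ (p / q)) * ENNReal.ofReal K *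
              ENNReal.ofReal (cellMass ω a) * (ENNReal.ofReal ((1 - ‖(a : ℂ)‖) ^ (η * p)) *
            ENNReal.ofReal ((1 - ‖(a : ℂ)‖) ^ (-(η * p)))) := by ring
          _ = _ := by rw [e]; ring

/-- Linear combinations of bump functions at the points of a lattice. -/
lemma IsDWeight.exists_sum_bump_le {ω : ℂ → ℝ} (hω : IsDWeight ω) {p : ℝ} (hp : 0 < p) {c : ℝ}
    {Z : Set ℂ} (hZ : IsLattice c Z) (hc : 0 < c) (hc2 : c ≤ 1 / 2) :
    ∃ M : ℕ, ∃ K : ℝ, 0 < K ∧ ∀ (F : Finset Z) (A : Z → ℝ≥0∞), (∀ a, A a ≠ ∞) →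
      ∫⁻ z, (∑ a ∈ F, A a * ‖bump a z‖ₑ ^ (M : ℝ)) ^ p * kappa ω z ∂area ≤
        ENNReal.ofReal K * ∑ a ∈ F, A a ^ p * ENNReal.ofReal (cellMass ω a) := by
  rcases le_or_gt p 1 with h | h
  · exact hω.exists_sum_bump_le_of_le_one hp h hZ.subset
  · exact hω.exists_sum_bump_le_of_one_lt h hZ hc hc2

/-- Averaging over signs dominates every single term. -/
lemma card_mul_enorm_rpow_le_sum_signs {ι : Type*} [Fintype ι] [DecidableEq ι] (x : ι → ℂ) {q : ℝ}
    (hq : 0 < q) (j : ι) :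
    (Fintype.card (ι → Bool) : ℝ≥0∞) * ‖x j‖ₑ ^ q ≤
      2 * ∑ s : ι → Bool, ‖∑ i, (if s i then (1 : ℂ) else -1) * x i‖ₑ ^ q := by
  set φ : (ι → Bool) → ℂ := fun s => ∑ i, (if s i then (1 : ℂ) else -1) * x i
  -- Flipping the `j`-th sign changes the sum by `±2 x j`, so one of the two sums has modulus at
  -- least `|x j|`. As the flip is a bijection of sign patterns, summing over all patterns costs
  -- only a factor `2`.
  have hinv : Function.Involutive fun s : ι → Bool => Function.update s j (!s j) := by
    intro s
    ext i
    rcases eq_or_ne i j with rfl | h <;> simp [*]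
  have hpair : ∀ s : ι → Bool, ‖x j‖ₑ ^ q ≤
      ‖φ s‖ₑ ^ q + ‖φ (Function.update s j (!s j))‖ₑ ^ q := by
    intro s
    have hdiff : φ s - φ (Function.update s j (!s j)) = (if s j then (1 : ℂ) else -1) * (2 * x j) := by
      simp only [φ]
      rw [← Finset.sum_sub_distrib, Finset.sum_eq_single j]
      · cases s j <;> simp <;> ring
      · intro i _ hij
        simp [Function.update_of_ne hij]
      · simp
    have hn : 2 * ‖x j‖ ≤ ‖φ s‖ + ‖φ (Function.update s j (!s j))‖ := by
      refine le_trans (le_of_eq ?_) (norm_sub_le _ _)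
      rw [hdiff]
      cases s j <;> simp
    rcases le_total ‖φ s‖ ‖φ (Function.update s j (!s j))‖ with h | h
    · refine le_trans (ENNReal.rpow_le_rpow ?_ hq.le) le_add_self
      rw [enorm_le_iff_norm_le]; linarith
    · refine le_trans (ENNReal.rpow_le_rpow ?_ hq.le) le_self_add
      rw [enorm_le_iff_norm_le]; linarith
  calc _ = ∑ s : ι → Bool, ‖x j‖ₑ ^ q := by simp
    _ ≤ ∑ s : ι → Bool, (‖φ s‖ₑ ^ q + ‖φ (Function.update s j (!s j))‖ₑ ^ q) :=
        Finset.sum_le_sum fun s _ => hpair s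
    _ = _ := by
        rw [Finset.sum_add_distrib, two_mul]
        congr 1
        exact Equiv.sum_comp hinv.toPerm fun s => ‖φ s‖ₑ ^ q

/-! ### Arcs, Carleson squares and boundary balls -/

lemma circlePoint_eq_iff {s t : ℝ} : circlePoint s = circlePoint t ↔ ∃ n : ℤ, s = t + n := by
  rw [circlePoint, circlePoint, Complex.exp_eq_exp_iff_exists_int]
  refine exists_congr fun n => ?_
  have h2 : (2 * π * Complex.I : ℂ) ≠ 0 := Complex.two_pi_I_ne_zero
  constructor
  · intro h
    have h3 : (2 * π * Complex.I : ℂ) * s = (2 * π * Complex.I : ℂ) * ((t + n : ℝ) : ℂ) := by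
      push_cast; linear_combination h
    exact_mod_cast mul_left_cancel₀ h2 h3
  · intro h
    rw [h]; push_cast; ring

lemma norm_circlePoint (t : ℝ) : ‖circlePoint t‖ = 1 := by
  rw [circlePoint, show (2 * π * t * Complex.I : ℂ) = ((2 * π * t : ℝ) : ℂ) * Complex.I by
    push_cast; ring, Complex.norm_exp_ofReal_mul_I]

lemma exists_circlePoint_eq {ζ : ℂ} (hζ : ‖ζ‖ = 1) : circlePoint (ζ.arg / (2 * π)) = ζ := by
  have h := Complex.norm_mul_exp_arg_mul_I ζ
  rw [hζ, Complex.ofReal_one, one_mul] at h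
  rw [circlePoint]
  convert h using 2
  push_cast
  have : (π : ℂ) ≠ 0 := by exact_mod_cast pi_ne_zero
  field_simp

lemma norm_circlePoint_sub_le (s t : ℝ) : ‖circlePoint s - circlePoint t‖ ≤ 2 * π * |s - t| := by
  have h1 : circlePoint s - circlePoint t =
      circlePoint t * (Complex.exp (Complex.I * ((2 * π * (s - t) : ℝ) : ℂ)) - 1) := by
    rw [mul_sub, mul_one, circlePoint, circlePoint, ← Complex.exp_add]
    congr 2
    push_cast; ring
  rw [h1, norm_mul, norm_circlePoint, one_mul]
  refine (Real.norm_exp_I_mul_ofReal_sub_one_le).trans (le_of_eq ?_)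
  rw [Real.norm_eq_abs, abs_mul, abs_of_pos two_pi_pos]

/-- The union of the integer translates of the interval is invariant under `ℤ`, so its measure is
the same in the fundamental domains `(0, 1]` and `(a, a+1]`. -/
lemma arcLength_image_Icc {a b : ℝ} (hb : b ≤ a + 1) :
    arcLength (circlePoint '' Icc a b) = ENNReal.ofReal (b - a) := by
  set A : Set ℝ := ⋃ n : ℤ, Icc (a + n) (b + n)
  have hAm : MeasurableSet A := MeasurableSet.iUnion fun n => measurableSet_Icc
  have hmem : ∀ t, t ∈ A ↔ ∃ n : ℤ, a + n ≤ t ∧ t ≤ b + n := fun t => by simp [A]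
  have hAinv : ∀ g : AddSubgroup.zmultiples (1 : ℝ), (fun x => g +ᵥ x) ⁻¹' A = A := by
    rintro ⟨g, hg⟩
    obtain ⟨k, rfl⟩ := AddSubgroup.mem_zmultiples_iff.mp hg
    ext t
    simp only [mem_preimage, hmem, AddSubgroup.vadd_def, vadd_eq_add, zsmul_eq_mul, mul_one]
    constructor
    · rintro ⟨n, h1, h2⟩
      exact ⟨n - k, by push_cast; linarith, by push_cast; linarith⟩
    · rintro ⟨n, h1, h2⟩
      exact ⟨n + k, by push_cast; linarith, by push_cast; linarith⟩
  have h0 := (isAddFundamentalDomain_Ioc one_pos 0 (volume : Measure ℝ)).measure_set_eq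
    (isAddFundamentalDomain_Ioc one_pos a (volume : Measure ℝ)) hAm hAinv
  have h1 : {t : ℝ | t ∈ Ico (0 : ℝ) 1 ∧ circlePoint t ∈ circlePoint '' Icc a b} = A ∩ Ico 0 1 := by
    ext t
    simp only [mem_ofPred_eq, mem_inter_iff, hmem, mem_image]
    constructor
    · rintro ⟨ht, x, hx, hxt⟩
      obtain ⟨n, rfl⟩ := circlePoint_eq_iff.mp hxt.symm
      exact ⟨⟨n, by linarith [hx.1], by linarith [hx.2]⟩, ht⟩
    · rintro ⟨⟨n, h1, h2⟩, ht⟩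
      exact ⟨ht, t - n, ⟨by linarith, by linarith⟩, (circlePoint_eq_iff.mpr ⟨n, by ring⟩).symm⟩
  have h2 : volume (A ∩ Ico 0 1) = volume (A ∩ Ioc 0 (0 + 1)) := by
    rw [zero_add]
    exact measure_congr (Filter.EventuallyEq.rfl.inter Ico_ae_eq_Ioc)
  rw [arcLength, h1, h2, h0]
  refine le_antisymm ?_ ?_
  · calc volume (A ∩ Ioc a (a + 1)) ≤ volume (Icc a b ∪ {a + 1}) := by
          refine measure_mono ?_
          rintro x ⟨hx, hx2⟩
          obtain ⟨n, h3, h4⟩ := (hmem x).mp hx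
          rcases lt_trichotomy n 0 with hn | hn | hn
          · have : (n : ℝ) ≤ -1 := by exact_mod_cast Int.le_sub_one_of_lt hn
            linarith [hx2.1]
          · subst hn
            exact Or.inl ⟨by simpa using h3, by simpa using h4⟩
          · have : (1 : ℝ) ≤ n := by exact_mod_cast hn
            exact Or.inr (le_antisymm hx2.2 (by linarith))
      _ ≤ volume (Icc a b) + volume {a + 1} := measure_union_le _ _
      _ = ENNReal.ofReal (b - a) := by simp
  · calc ENNReal.ofReal (b - a) = volume (Ioc a b) := by simp
      _ ≤ _ := by
        refine measure_mono fun x hx => ⟨(hmem x).mpr ⟨0, ?_, ?_⟩, hx.1, hx.2.trans hb⟩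
        · simpa using hx.1.le
        · simpa using hx.2

lemma arcLength_mono {I I' : Set ℂ} (h : I ⊆ I') : arcLength I ≤ arcLength I' :=
  measure_mono fun _ ht => ⟨ht.1, h ht.2⟩

/-- A point of the square is within `|I|` of its radial projection, and the projection is within
`2π|I| ≤ 7|I|` of any chosen point of the arc; together this gives `8`. -/
lemma carlesonSquare_subset_closedBall {I : Set ℂ} (hI : IsArc I) (h0 : 0 < arcLength I)
    (h1 : arcLength I < 1) :
    ∃ ζ : ℂ, ‖ζ‖ = 1 ∧
      carlesonSquare I ⊆ closedBall ζ (8 * (arcLength I).toReal) ∩ disk := by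
  obtain ⟨J, hJ, rfl⟩ := hI
  set ℓ := (arcLength (circlePoint '' J)).toReal
  have hfin : arcLength (circlePoint '' J) ≠ ∞ := (h1.trans ENNReal.one_lt_top).ne
  have hdiam : ∀ x ∈ J, ∀ y ∈ J, x ≤ y → y - x ≤ ℓ := by
    intro x hx y hy hxy
    -- Truncation to one period makes the length formula applicable. Since the arc has length below
    -- `1`, the truncation turns out to be inactive.
    have hsub : Icc x (min y (x + 1)) ⊆ J :=
      (Icc_subset_Icc_right (min_le_left _ _)).trans (hJ.out hx hy)
    have h2 := arcLength_mono (image_mono (f := circlePoint) hsub)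
    rw [arcLength_image_Icc (min_le_right _ _)] at h2
    have h3 : min y (x + 1) - x ≤ ℓ := (ENNReal.ofReal_le_iff_le_toReal hfin).mp h2
    have h4 : ℓ < 1 := by
      have := (ENNReal.toReal_lt_toReal hfin ENNReal.one_ne_top).mpr h1
      simpa using this
    rcases min_cases y (x + 1) with h5 | h5 <;> linarith
  have hne : J.Nonempty := by
    rw [nonempty_iff_ne_empty]
    rintro rfl
    simp [arcLength] at h0
  obtain ⟨t₀, ht₀⟩ := hne
  refine ⟨circlePoint t₀, norm_circlePoint t₀, ?_⟩
  rintro z ⟨hz, ⟨t, ht, htz⟩, hzl⟩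
  refine ⟨?_, hz⟩
  have hz1 := mem_disk.mp hz
  have htt : |t - t₀| ≤ ℓ := by
    rcases le_total t t₀ with h | h
    · rw [abs_of_nonpos (by linarith)]; linarith [hdiam t ht t₀ ht₀ h]
    · rw [abs_of_nonneg (by linarith)]; exact hdiam t₀ ht₀ t ht h
  have hz0 : z ≠ 0 := by
    rintro rfl
    have := norm_circlePoint t
    rw [htz] at this
    simp at this
  have hnz : (‖z‖ : ℂ) ≠ 0 := by simpa using hz0
  have hzt : z - circlePoint t = ((‖z‖ - 1 : ℝ) : ℂ) * circlePoint t := by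
    rw [htz]; push_cast; field_simp
  have h5 : ‖z - circlePoint t‖ ≤ ℓ := by
    rw [hzt, norm_mul, norm_circlePoint, mul_one, Complex.norm_real, Real.norm_eq_abs,
      abs_of_nonpos (by linarith)]
    linarith
  have h6 := norm_circlePoint_sub_le t t₀
  rw [mem_closedBall_iff_norm]
  have h7 : ‖z - circlePoint t₀‖ ≤ ‖z - circlePoint t‖ + ‖circlePoint t - circlePoint t₀‖ := by
    refine le_trans (le_of_eq ?_) (norm_add_le _ _)
    congr 1; ring
  have h8 : 2 * π * |t - t₀| ≤ 7 * ℓ := by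
    have : 2 * π ≤ 7 := by linarith [pi_lt_d2]
    gcongr
  linarith

/-- The radial projection of a point of the ball is within `2ℓ` of `ζ`. Comparing chord and angle
puts its parameter within `ℓ` of that of `ζ`, well inside the arc of half-length `4ℓ`. The bound `ℓ
≤ 1/8` keeps the arc within one period. -/
lemma closedBall_subset_carlesonSquare {ζ : ℂ} (hζ : ‖ζ‖ = 1) {ℓ : ℝ} (hℓ : 0 < ℓ)
    (hℓ1 : ℓ ≤ 1 / 8) :
    ∃ I, IsArc I ∧ arcLength I = ENNReal.ofReal (8 * ℓ) ∧
      closedBall ζ ℓ ∩ disk ⊆ carlesonSquare I := by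
  set t₀ := ζ.arg / (2 * π)
  have ht₀ : circlePoint t₀ = ζ := exists_circlePoint_eq hζ
  have hlen : arcLength (circlePoint '' Icc (t₀ - 4 * ℓ) (t₀ + 4 * ℓ)) = ENNReal.ofReal (8 * ℓ) := by
    rw [arcLength_image_Icc (by linarith)]
    congr 1; ring
  refine ⟨_, ⟨_, ordConnected_Icc, rfl⟩, hlen, ?_⟩
  rintro z ⟨hzb, hz⟩
  rw [mem_closedBall_iff_norm] at hzb
  have hz1 := mem_disk.mp hz
  have hzl : 1 - ℓ ≤ ‖z‖ := by
    have := norm_sub_norm_le ζ z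
    rw [norm_sub_rev, hζ] at this
    linarith
  have hzpos : 0 < ‖z‖ := by linarith
  refine ⟨hz, ?_, ?_⟩
  · set w : ℂ := z / (‖z‖ : ℂ)
    have hw : ‖w‖ = 1 := by simp [w, hzpos.ne']
    have hwz : ‖w - z‖ ≤ ℓ := by
      have hnz : (‖z‖ : ℂ) ≠ 0 := by exact_mod_cast hzpos.ne'
      have : w - z = ((1 - ‖z‖ : ℝ) : ℂ) * w := by simp only [w]; push_cast; field_simp
      rw [this, norm_mul, hw, mul_one, Complex.norm_real, Real.norm_of_nonneg (by linarith)]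
      linarith
    have hwζ : ‖w - ζ‖ ≤ 2 * ℓ := by
      have : ‖w - ζ‖ ≤ ‖w - z‖ + ‖z - ζ‖ := by
        refine le_trans (le_of_eq ?_) (norm_add_le _ _)
        congr 1; ring
      linarith
    have hζ0 : ζ ≠ 0 := by rw [← norm_pos_iff, hζ]; exact one_pos
    have hw0 : w ≠ 0 := by rw [← norm_pos_iff, hw]; exact one_pos
    have hang := (Complex.norm_sub_mem_Icc_angle hw hζ).1
    rw [Complex.angle_eq_abs_arg hw0 hζ0] at hang
    set φ := (w / ζ).arg
    have hφ : |φ| ≤ π * ℓ := by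
      have : |φ| = π / 2 * (2 / π * |φ|) := by field_simp
      rw [this]
      calc _ ≤ π / 2 * (2 * ℓ) := mul_le_mul_of_nonneg_left (by linarith) (by positivity)
        _ = _ := by ring
    have hwe : circlePoint (t₀ + φ / (2 * π)) = w := by
      have h1 : circlePoint (φ / (2 * π)) = w / ζ := exists_circlePoint_eq (by rw [norm_div, hw, hζ, div_one])
      have h2 : circlePoint (t₀ + φ / (2 * π)) = circlePoint t₀ * circlePoint (φ / (2 * π)) := by
        simp only [circlePoint]
        rw [← Complex.exp_add]
        congr 1
        push_cast; ring
      rw [h2, ht₀, h1, mul_div_cancel₀ _ hζ0]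
    refine ⟨_, ?_, hwe⟩
    have h3 : |φ / (2 * π)| ≤ ℓ := by
      rw [abs_div, abs_of_pos two_pi_pos, div_le_iff₀ two_pi_pos]
      nlinarith [pi_pos]
    rw [abs_le] at h3
    exact ⟨by linarith, by linarith⟩
  · rw [hlen, ENNReal.toReal_ofReal (by positivity)]
    linarith

/-- Growth conditions on Carleson squares and on balls centred on the unit circle agree. -/
lemma forall_carlesonSquare_iff_forall_closedBall {X : Type*} {Φ : X → Set ℂ → ℝ≥0∞}
    (hΦ : ∀ x, Monotone (Φ x)) (B : X → ℝ≥0∞) (t : ℝ) :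
    (∀ ε : ℝ, 0 < ε → ∃ r₀ ∈ Ioo (0 : ℝ) 1, ∀ x, ∀ I : Set ℂ, IsArc I → 0 < arcLength I →
      arcLength I ≤ ENNReal.ofReal r₀ →
        Φ x (carlesonSquare I) / arcLength I ^ t ≤ ENNReal.ofReal ε * B x) ↔
    (∀ ε : ℝ, 0 < ε → ∃ r₀ : ℝ, 0 < r₀ ∧ ∀ x, ∀ ζ : ℂ, ‖ζ‖ = 1 → ∀ ℓ : ℝ, 0 < ℓ → ℓ ≤ r₀ →
      Φ x (closedBall ζ ℓ ∩ disk) ≤ ENNReal.ofReal (ε * ℓ ^ t) * B x) := by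
  have hdiv : ∀ {ℓ : ℝ}, 0 < ℓ → ∀ {ε : ℝ}, 0 < ε → ∀ u v : ℝ≥0∞,
      u / ENNReal.ofReal ℓ ^ t ≤ ENNReal.ofReal ε * v ↔ u ≤ ENNReal.ofReal (ε * ℓ ^ t) * v := by
    intro ℓ hℓ ε hε u v
    rw [ENNReal.ofReal_rpow_of_pos hℓ, ENNReal.div_le_iff
      (by simpa using Real.rpow_pos_of_pos hℓ t) ENNReal.ofReal_ne_top, ENNReal.ofReal_mul hε.le]
    rw [mul_right_comm]
  have h8 : (0 : ℝ) < 8 ^ t := by positivity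
  constructor
  · intro H ε hε
    obtain ⟨r₀, hr₀, h⟩ := H (ε / 8 ^ t) (by positivity)
    refine ⟨r₀ / 8, by linarith [hr₀.1], fun x ζ hζ ℓ hℓ hℓr => ?_⟩
    obtain ⟨I, hI, hlen, hsub⟩ := closedBall_subset_carlesonSquare hζ hℓ (by linarith [hr₀.2])
    have h1 := h x I hI (by rw [hlen]; simpa using hℓ)
      (by rw [hlen]; exact ENNReal.ofReal_le_ofReal (by linarith))
    rw [hlen, hdiv (by positivity) (by positivity)] at h1
    refine (hΦ x hsub).trans (h1.trans (le_of_eq ?_))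
    congr 2
    rw [Real.mul_rpow (by norm_num) hℓ.le]
    field_simp
  · intro H ε hε
    obtain ⟨r₀, hr₀, h⟩ := H (ε / 8 ^ t) (by positivity)
    -- The cap `1/2` forces `|I| < 1`, as needed to enclose the square in a ball.
    refine ⟨min (r₀ / 8) (1 / 2), ⟨by positivity, by
      exact (min_le_right _ _).trans_lt (by norm_num)⟩, fun x I hI h0 hle => ?_⟩
    have hlt : arcLength I < 1 := by
      refine hle.trans_lt ?_
      rw [← ENNReal.ofReal_one]
      exact (ENNReal.ofReal_lt_ofReal_iff one_pos).mpr
        ((min_le_right _ _).trans_lt (by norm_num))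
    have hfin : arcLength I ≠ ∞ := (hlt.trans ENNReal.one_lt_top).ne
    obtain ⟨ζ, hζ, hsub⟩ := carlesonSquare_subset_closedBall hI h0 hlt
    set ℓ := (arcLength I).toReal
    have hℓ : 0 < ℓ := ENNReal.toReal_pos h0.ne' hfin
    have hℓe : arcLength I = ENNReal.ofReal ℓ := (ENNReal.ofReal_toReal hfin).symm
    have hℓr : ℓ ≤ r₀ / 8 := by
      rw [hℓe] at hle
      exact ((ENNReal.ofReal_le_ofReal_iff (by positivity)).mp hle).trans (min_le_left _ _)
    have h1 := h x ζ hζ (8 * ℓ) (by positivity) (by linarith)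
    rw [hℓe, hdiv hℓ hε]
    refine (hΦ x hsub).trans (h1.trans (le_of_eq ?_))
    congr 2
    rw [Real.mul_rpow (by norm_num) hℓ.le]
    field_simp

/-- Vanishing Carleson measures in terms of balls centred on the unit circle. -/
def BallVanishing (s : ℝ) (ν : Measure ℂ) : Prop :=
  ∀ ε : ℝ, 0 < ε → ∃ r₀ : ℝ, 0 < r₀ ∧ ∀ ζ : ℂ, ‖ζ‖ = 1 → ∀ ℓ : ℝ, 0 < ℓ → ℓ ≤ r₀ →
    ν (closedBall ζ ℓ ∩ disk) ≤ ENNReal.ofReal (ε * ℓ ^ s)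

lemma isVanishingCarleson_iff (s : ℝ) (ν : Measure ℂ) :
    IsVanishingCarleson s ν ↔ BallVanishing s ν := by
  have h := forall_carlesonSquare_iff_forall_closedBall (X := Unit) (Φ := fun _ => ν)
    (fun _ _ _ h => measure_mono h) (fun _ => 1) s
  simpa [IsVanishingCarleson, BallVanishing] using h

/-- The condition `UniformlyVanishing` in terms of balls centred on the unit circle. -/
def UniformlyBallVanishing (p s ι : ℝ) (ω : ℂ → ℝ) (μ : Measure ℂ) : Prop :=
  ∀ ε : ℝ, 0 < ε → ∃ r₀ : ℝ, 0 < r₀ ∧ ∀ f : ℂ → ℂ, MemBergman p ω f → ∀ ζ : ℂ, ‖ζ‖ = 1 →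
    ∀ ℓ : ℝ, 0 < ℓ → ℓ ≤ r₀ → ∫⁻ z in closedBall ζ ℓ ∩ disk, ‖f z‖ₑ ^ (p * ι) ∂μ ≤
      ENNReal.ofReal (ε * ℓ ^ (s * (1 - ι))) * bergmanNorm p ω f ^ (p * ι)

lemma uniformlyVanishing_iff {p s ι : ℝ} {ω : ℂ → ℝ} {μ : Measure ℂ} :
    UniformlyVanishing p s ι ω μ ↔ UniformlyBallVanishing p s ι ω μ := by
  have h := forall_carlesonSquare_iff_forall_closedBall (X := {f : ℂ → ℂ // MemBergman p ω f})
    (Φ := fun f A => ∫⁻ z in A, ‖f.1 z‖ₑ ^ (p * ι) ∂μ) (fun _ _ _ h => lintegral_mono_set h)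
    (fun f => bergmanNorm p ω f.1 ^ (p * ι)) (s * (1 - ι))
  simp only [Subtype.forall] at h
  rw [UniformlyBallVanishing, ← h]
  constructor
  · rintro ⟨C, hC, H⟩ ε hε
    -- Because `ε` is arbitrary, the constant `C` can be absorbed into it.
    obtain ⟨r₀, hr₀, h⟩ := H (ε / C) (by positivity)
    refine ⟨r₀, hr₀, ?_⟩
    rwa [mul_div_cancel₀ _ hC.ne'] at h
  · intro H
    refine ⟨1, one_pos, fun ε hε => ?_⟩
    simpa only [one_mul] using H ε hε

/-! ### Pseudohyperbolic disks and their κ-mass -/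

lemma measurableSet_pseudoDisk (z : ℂ) (δ : ℝ) : MeasurableSet (pseudoDisk z δ) := by
  refine measurableSet_disk.inter (measurableSet_lt (Measurable.norm ?_) measurable_const)
  exact (Continuous.measurable (by fun_prop)).div (Continuous.measurable (by fun_prop))

lemma mem_pseudoDisk_iff {z w : ℂ} (hz : ‖z‖ < 1) {δ : ℝ} :
    w ∈ pseudoDisk z δ ↔ ‖w‖ < 1 ∧ ‖z - w‖ < δ * ‖1 - starRingEnd ℂ z * w‖ := by
  rw [pseudoDisk, mem_ofPred_eq, mem_disk]
  refine and_congr_right fun hw => ?_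
  rw [norm_div, div_lt_iff₀ (norm_one_sub_conj_pos hz hw)]

/-- Combine `|z-w| < δ|1 - z̄w|` with `|1 - z̄w| ≤ 2(1-|z|) + |z-w|` and solve for `|z-w|`. The
second bound follows by symmetry. -/
lemma norm_sub_le_of_mem_pseudoDisk {z w : ℂ} (hz : ‖z‖ < 1) {δ : ℝ} (hδ : δ ∈ Ioo (0 : ℝ) 1)
    (hw : w ∈ pseudoDisk z δ) :
    ‖z - w‖ ≤ 2 * δ / (1 - δ) * (1 - ‖z‖) ∧ ‖z - w‖ ≤ 2 * δ / (1 - δ) * (1 - ‖w‖) := by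
  have key : ∀ u v : ℂ, ‖u‖ < 1 → ‖u - v‖ < δ * ‖1 - starRingEnd ℂ u * v‖ →
      ‖u - v‖ ≤ 2 * δ / (1 - δ) * (1 - ‖u‖) := by
    intro u v hu h
    have hdu : 0 < 1 - ‖u‖ := by linarith
    have h1 := norm_one_sub_conj_le_of_mem (w := v) (t := ‖u - v‖ / (1 - ‖u‖)) hu (by
      rw [mem_closedBall_iff_norm, div_mul_cancel₀ _ hdu.ne', norm_sub_rev])
    rw [add_mul, div_mul_cancel₀ _ hdu.ne'] at h1
    have h2 : 0 < 1 - δ := by linarith [hδ.2]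
    rw [div_mul_eq_mul_div, le_div_iff₀ h2]
    nlinarith [hδ.1]
  obtain ⟨hw1, h⟩ := (mem_pseudoDisk_iff hz).mp hw
  refine ⟨key z w hz h, ?_⟩
  rw [norm_sub_rev]
  refine key w z hw1 ?_
  rwa [norm_sub_rev, norm_one_sub_conj_comm]

lemma closedBall_subset_pseudoDisk {z : ℂ} (hz : ‖z‖ < 1) {t δ : ℝ} (ht : t < δ) (hδ : δ < 1) :
    closedBall z (t * (1 - ‖z‖)) ⊆ pseudoDisk z δ := by
  intro w hw
  have hw1 := mem_disk.mp (closedBall_subset_disk hz (ht.trans hδ) hw)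
  rw [mem_closedBall_iff_norm, norm_sub_rev] at hw
  refine (mem_pseudoDisk_iff hz).mpr ⟨hw1, hw.trans_lt ?_⟩
  have h1 := one_sub_norm_mul_norm_le z w
  have h2 : 1 - ‖z‖ ≤ ‖1 - starRingEnd ℂ z * w‖ := by nlinarith [norm_nonneg z, norm_nonneg w]
  rcases le_or_gt 0 t with h0 | h0
  · calc t * (1 - ‖z‖) < δ * (1 - ‖z‖) := by nlinarith
      _ ≤ _ := mul_le_mul_of_nonneg_left h2 (h0.trans ht.le)
  · nlinarith [norm_nonneg (z - w)]

lemma IsDWeight.kappa_mul_sq {ω : ℂ → ℝ} (hω : IsDWeight ω) {a : ℂ} (ha : ‖a‖ < 1) :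
    kappa ω a * ENNReal.ofReal ((1 - ‖a‖) ^ 2) = ENNReal.ofReal (cellMass ω a) := by
  have hda : 0 < 1 - ‖a‖ := by linarith
  rw [hω.kappa_eq (mem_disk.mpr ha), ← ENNReal.ofReal_mul' (by positivity), cellMass]
  congr 1
  field_simp

lemma IsPowerDoubling.tailReal_le {ω : ℂ → ℝ} {C lam γ : ℝ}
    (hd : IsPowerDoubling (tailReal ω) C lam γ) {R : ℝ} (hR : 1 ≤ R) {a w : ℂ} (ha : ‖a‖ < 1)
    (hw : ‖w‖ < 1) (h : 1 - ‖w‖ ≤ R * (1 - ‖a‖)) :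
    tailReal ω (1 - ‖w‖) ≤ C * R ^ lam * tailReal ω (1 - ‖a‖) :=
  hd.le_of_le_mul hR ⟨by linarith, by linarith [norm_nonneg a]⟩
    ⟨by linarith, by linarith [norm_nonneg w]⟩ h

lemma IsPowerDoubling.const_pos {h : ℝ → ℝ} {C lam γ : ℝ} (hd : IsPowerDoubling h C lam γ)
    {R : ℝ} (hR : 1 ≤ R) : 0 < C * R ^ lam * R := by
  have := hd.one_le
  positivity

lemma IsDWeight.kappa_le_mul {ω : ℂ → ℝ} (hω : IsDWeight ω) {C lam γ : ℝ}
    (hd : IsPowerDoubling (tailReal ω) C lam γ) {R : ℝ} (hR : 1 ≤ R) {a w : ℂ} (ha : ‖a‖ < 1)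
    (hw : ‖w‖ < 1) (h1 : 1 - ‖w‖ ≤ R * (1 - ‖a‖)) (h2 : 1 - ‖a‖ ≤ R * (1 - ‖w‖)) :
    kappa ω w ≤ ENNReal.ofReal (C * R ^ lam * R) * kappa ω a := by
  have hda : 0 < 1 - ‖a‖ := by linarith
  have hdw : 0 < 1 - ‖w‖ := by linarith
  have hH := hd.const_pos hR
  have hC := hd.one_le
  have hpa := hd.pos (1 - ‖a‖) ⟨hda, by linarith [norm_nonneg a]⟩
  rw [hω.kappa_eq (mem_disk.mpr hw), hω.kappa_eq (mem_disk.mpr ha), ← ENNReal.ofReal_mul hH.le]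
  refine ENNReal.ofReal_le_ofReal ?_
  rw [div_le_iff₀ hdw]
  calc tailReal ω (1 - ‖w‖) ≤ C * R ^ lam * tailReal ω (1 - ‖a‖) := hd.tailReal_le hR ha hw h1
    _ = C * R ^ lam * (tailReal ω (1 - ‖a‖) / (1 - ‖a‖)) * (1 - ‖a‖) := by field_simp
    _ ≤ C * R ^ lam * (tailReal ω (1 - ‖a‖) / (1 - ‖a‖)) * (R * (1 - ‖w‖)) := by gcongr
    _ = _ := by ring

lemma IsPowerDoubling.cellMass_le_mul {ω : ℂ → ℝ} {C lam γ : ℝ}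
    (hd : IsPowerDoubling (tailReal ω) C lam γ) {R : ℝ} (hR : 1 ≤ R) {a w : ℂ} (ha : ‖a‖ < 1)
    (hw : ‖w‖ < 1) (h1 : 1 - ‖w‖ ≤ R * (1 - ‖a‖)) :
    cellMass ω w ≤ C * R ^ lam * R * cellMass ω a := by
  have hda : 0 < 1 - ‖a‖ := by linarith
  have hdw : 0 < 1 - ‖w‖ := by linarith
  have hC := hd.one_le
  have hpa := hd.pos (1 - ‖a‖) ⟨hda, by linarith [norm_nonneg a]⟩
  rw [cellMass, cellMass]
  calc _ ≤ (C * R ^ lam * tailReal ω (1 - ‖a‖)) * (R * (1 - ‖a‖)) := by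
        gcongr
        exact hd.tailReal_le hR ha hw h1
    _ = _ := by ring

/-- The pseudohyperbolic disk lies in a Euclidean ball of radius comparable to `1-|z|`, and κ is
comparable to `κ(z)` on it. With the converse bound below, `κ(D(z,δ))` may be replaced by `cellMass
ω z`. -/
lemma IsDWeight.exists_kappaMass_pseudoDisk_le {ω : ℂ → ℝ} (hω : IsDWeight ω) {C lam γ : ℝ}
    (hd : IsPowerDoubling (tailReal ω) C lam γ) {δ : ℝ} (hδ : δ ∈ Ioo (0 : ℝ) 1) :
    ∃ B : ℝ, 0 < B ∧ ∀ z : ℂ, ‖z‖ < 1 →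
      kappaMass ω (pseudoDisk z δ) ≤ ENNReal.ofReal (B * cellMass ω z) := by
  set R₀ := 2 * δ / (1 - δ)
  have hR₀ : 0 < R₀ := div_pos (by linarith [hδ.1]) (by linarith [hδ.2])
  have hR : 1 ≤ 1 + R₀ := by linarith
  have hH := hd.const_pos hR
  refine ⟨C * (1 + R₀) ^ lam * (1 + R₀) * (1 + R₀) ^ 2, by positivity, fun z hz => ?_⟩
  have hdz : 0 < 1 - ‖z‖ := by linarith
  have hm := hd.cellMass_pos hz
  calc kappaMass ω (pseudoDisk z δ)
      ≤ ∫⁻ _ in pseudoDisk z δ, ENNReal.ofReal (C * (1 + R₀) ^ lam * (1 + R₀)) * kappa ω z ∂area := by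
        refine setLIntegral_mono' (measurableSet_pseudoDisk z δ) fun w hw => ?_
        obtain ⟨h1, h2⟩ := norm_sub_le_of_mem_pseudoDisk hz hδ hw
        have h3 := norm_sub_norm_le z w
        have h4 := norm_sub_norm_le w z
        rw [norm_sub_rev] at h4
        refine hω.kappa_le_mul hd hR hz (mem_disk.mp hw.1) ?_ ?_ <;> linarith
    _ ≤ ENNReal.ofReal (C * (1 + R₀) ^ lam * (1 + R₀)) * kappa ω z *
          ENNReal.ofReal (((1 + R₀) * (1 - ‖z‖)) ^ 2) := by
        rw [setLIntegral_const]
        gcongr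
        refine le_trans (measure_mono fun w hw => ?_) (area_ball_le z (by positivity))
        rw [mem_ball_iff_norm, norm_sub_rev]
        have := (norm_sub_le_of_mem_pseudoDisk hz hδ hw).1
        linarith
    _ = _ := by
        rw [mul_pow, ENNReal.ofReal_mul (p := (1 + R₀) ^ 2) (by positivity), mul_assoc,
          mul_left_comm (kappa ω z), hω.kappa_mul_sq hz, ← ENNReal.ofReal_mul (by positivity),
          ← ENNReal.ofReal_mul (by positivity), ← mul_assoc]

lemma IsDWeight.exists_le_kappaMass_pseudoDisk {ω : ℂ → ℝ} (hω : IsDWeight ω) {C lam γ : ℝ}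
    (hd : IsPowerDoubling (tailReal ω) C lam γ) {δ : ℝ} (hδ : δ ∈ Ioo (0 : ℝ) 1) :
    ∃ B : ℝ, 0 < B ∧ ∀ z : ℂ, ‖z‖ < 1 →
      ENNReal.ofReal (cellMass ω z) ≤ ENNReal.ofReal B * kappaMass ω (pseudoDisk z δ) := by
  have hH := hd.const_pos one_le_two
  set H := C * 2 ^ lam * 2
  have hδ0 := hδ.1
  have hδ1 := hδ.2
  refine ⟨H * (2 / δ) ^ 2, by positivity, fun z hz => ?_⟩
  have hdz : 0 < 1 - ‖z‖ := by linarith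
  have hsub : ball z (δ / 2 * (1 - ‖z‖)) ⊆ pseudoDisk z δ :=
    ball_subset_closedBall.trans (closedBall_subset_pseudoDisk hz (by linarith) hδ1)
  have h1 : ∀ w ∈ ball z (δ / 2 * (1 - ‖z‖)), kappa ω z ≤ ENNReal.ofReal H * kappa ω w := by
    intro w hw
    obtain ⟨h2, h3⟩ := one_sub_norm_mem_of_mem_closedBall (ball_subset_closedBall hw)
    exact hω.kappa_le_mul hd one_le_two (mem_disk.mp (hsub hw).1) hz (by nlinarith) (by nlinarith)
  have h2 := setLIntegral_mono' (μ := area) measurableSet_ball h1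
  rw [setLIntegral_const, area_ball (by positivity) (ball_subset_disk hz (by linarith)),
    lintegral_const_mul' _ _ ENNReal.ofReal_ne_top] at h2
  calc ENNReal.ofReal (cellMass ω z)
      = ENNReal.ofReal ((2 / δ) ^ 2) *
          (kappa ω z * ENNReal.ofReal ((δ / 2 * (1 - ‖z‖)) ^ 2)) := by
        rw [← hω.kappa_mul_sq hz, mul_left_comm, ← ENNReal.ofReal_mul (by positivity)]
        congr 2
        field_simp
    _ ≤ ENNReal.ofReal ((2 / δ) ^ 2) * (ENNReal.ofReal H * kappaMass ω (pseudoDisk z δ)) := by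
        exact mul_le_mul_right (h2.trans (mul_le_mul_right (lintegral_mono_set hsub) _)) _
    _ = _ := by
        rw [← mul_assoc, ← ENNReal.ofReal_mul (by positivity), mul_comm H]

/-! ### Sums over cells and the discrete form of (i) -/

lemma IsLattice.tsum_setLIntegral_le_of_overlap {c : ℝ} {Z : Set ℂ} (hZ : IsLattice c Z) {K : ℝ}
    (hK : ∀ z ∈ disk, ∑' a : Z,
      (closedBall (a : ℂ) (1 / 2 * (1 - ‖(a : ℂ)‖))).indicator (fun _ => (1 : ℝ≥0∞)) z ≤
        ENNReal.ofReal K) {G : ℂ → ℝ≥0∞} (hG : Measurable G) (ν : Measure ℂ) {t : ℝ}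
    (ht : t ≤ 1 / 2) (I : Set Z) {E : Set ℂ} (hE : MeasurableSet E) (hEd : E ⊆ disk)
    (hIE : ∀ a ∈ I, closedBall (a : ℂ) (t * (1 - ‖(a : ℂ)‖)) ⊆ E) :
    ∑' a : I, ∫⁻ z in closedBall (a : ℂ) (t * (1 - ‖(a : ℂ)‖)), G z ∂ν ≤
      ENNReal.ofReal K * ∫⁻ z in E, G z ∂ν := by
  have : Countable Z := hZ.countable.to_subtype
  have hd : ∀ a : Z, 0 < 1 - ‖(a : ℂ)‖ := fun a => by linarith [mem_disk.mp (hZ.subset a.2)]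
  have hsub : ∀ a : Z, closedBall (a : ℂ) (t * (1 - ‖(a : ℂ)‖)) ⊆
      closedBall (a : ℂ) (1 / 2 * (1 - ‖(a : ℂ)‖)) := fun a =>
    closedBall_subset_closedBall (mul_le_mul_of_nonneg_right ht (hd a).le)
  calc _ = ∑' a : I, ∫⁻ z in E,
        (closedBall (a : ℂ) (t * (1 - ‖(a : ℂ)‖))).indicator G z ∂ν := by
        refine tsum_congr fun a => ?_
        rw [setLIntegral_indicator measurableSet_closedBall, inter_eq_left.mpr (hIE a a.2)]
    _ = ∫⁻ z in E, ∑' a : I,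
        (closedBall (a : ℂ) (t * (1 - ‖(a : ℂ)‖))).indicator G z ∂ν := by
        rw [lintegral_tsum]
        exact fun a => (hG.indicator measurableSet_closedBall).aemeasurable
    _ ≤ ∫⁻ z in E, ENNReal.ofReal K * G z ∂ν := by
        refine setLIntegral_mono' hE fun z hz => ?_
        calc _ ≤ ∑' a : I, (closedBall (a : ℂ) (1 / 2 * (1 - ‖(a : ℂ)‖))).indicator
              (fun _ => (1 : ℝ≥0∞)) z * G z := by
              refine ENNReal.tsum_le_tsum fun a => ?_
              by_cases h : z ∈ closedBall (a : ℂ) (t * (1 - ‖(a : ℂ)‖))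
              · rw [indicator_of_mem h, indicator_of_mem (hsub a h), one_mul]
              · rw [indicator_of_notMem h]; exact zero_le
          _ ≤ _ := by
              rw [ENNReal.tsum_mul_right]
              gcongr
              refine le_trans ?_ (hK z (hEd hz))
              exact ENNReal.tsum_comp_le_tsum_of_injective Subtype.val_injective
                fun a : Z => (closedBall (a : ℂ) (1 / 2 * (1 - ‖(a : ℂ)‖))).indicator
                  (fun _ => (1 : ℝ≥0∞)) z
    _ = _ := lintegral_const_mul' _ _ ENNReal.ofReal_ne_top

/-- Hölder's inequality with the conjugate exponents `1/ι` and `1/(1-ι)`. -/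
lemma tsum_rpow_mul_rpow_le {α : Type*} (x y : α → ℝ≥0∞) {ι : ℝ} (hι : ι ∈ Ioo (0 : ℝ) 1) :
    ∑' a, x a ^ ι * y a ^ (1 - ι) ≤ (∑' a, x a) ^ ι * (∑' a, y a) ^ (1 - ι) := by
  have h0 := hι.1
  have h1 : 0 < 1 - ι := by linarith [hι.2]
  have hconj : (1 / ι).HolderConjugate (1 / (1 - ι)) := by
    have : 1 / (1 - ι) = Real.conjExponent (1 / ι) := by
      rw [Real.conjExponent]; field_simp
    rw [this]
    exact Real.HolderConjugate.conjExponent ((one_lt_div h0).mpr hι.2)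
  rw [ENNReal.tsum_eq_iSup_sum]
  refine iSup_le fun F => ?_
  have h := ENNReal.inner_le_Lp_mul_Lq F (fun a => x a ^ ι) (fun a => y a ^ (1 - ι)) hconj
  simp only [← ENNReal.rpow_mul, one_div_one_div, mul_one_div_cancel h0.ne',
    mul_one_div_cancel h1.ne', ENNReal.rpow_one] at h
  refine h.trans ?_
  gcongr
  · exact ENNReal.sum_le_tsum F
  · exact ENNReal.sum_le_tsum F

/-- The contribution of the ball around `a` to the discretised Carleson condition. -/
noncomputable def cellTerm (ω : ℂ → ℝ) (μ : Measure ℂ) (ι c : ℝ) (a : ℂ) : ℝ≥0∞ :=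
  (μ (closedBall a (5 * c * (1 - ‖a‖))) / ENNReal.ofReal (cellMass ω a)) ^ (1 / (1 - ι)) *
    ENNReal.ofReal (cellMass ω a)

/-- The discretised form of the vanishing Carleson conditions. -/
def CellVanishing (ω : ℂ → ℝ) (μ : Measure ℂ) (ι s c : ℝ) (Z : Set ℂ) : Prop :=
  ∀ ε : ℝ, 0 < ε → ∃ r₀ : ℝ, 0 < r₀ ∧ ∀ ζ : ℂ, ‖ζ‖ = 1 → ∀ ℓ : ℝ, 0 < ℓ → ℓ ≤ r₀ →
    ∑' a : {a : Z | ‖(a : ℂ) - ζ‖ ≤ ℓ}, cellTerm ω μ ι c a ≤ ENNReal.ofReal (ε * ℓ ^ s)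

lemma one_sub_norm_le_norm_sub {a ζ : ℂ} (hζ : ‖ζ‖ = 1) : 1 - ‖a‖ ≤ ‖a - ζ‖ := by
  have := norm_sub_norm_le ζ a
  rwa [hζ, norm_sub_rev] at this

/-- For lattice scale `c = δ/20` the enlarged ball has radius `(δ/4)(1-|a|)` and lies in `D(z,δ)`
for every `z` in the small ball about `a`. The integrand thus dominates the cell term on the small
ball, whose area is comparable to `(1-|a|)²`. -/
lemma IsDWeight.exists_cellTerm_le {ω : ℂ → ℝ} (hω : IsDWeight ω) (μ : Measure ℂ) {ι δ : ℝ}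
    (hι : ι ∈ Ioo (0 : ℝ) 1) (hδ : δ ∈ Ioo (0 : ℝ) 1) :
    ∃ K : ℝ, 0 < K ∧ ∀ a : ℂ, ‖a‖ < 1 → cellTerm ω μ ι (δ / 20) a ≤ ENNReal.ofReal K *
      ∫⁻ z in ball a (δ / 20 * (1 - ‖a‖)),
        (μ (pseudoDisk z δ) / kappaMass ω (pseudoDisk z δ)) ^ (1 / (1 - ι)) * kappa ω z ∂area := by
  obtain ⟨C, lam, γ, hd⟩ := hω.isPowerDoubling
  obtain ⟨B, hB, hκ⟩ := hω.exists_kappaMass_pseudoDisk_le hd hδ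
  have hδ0 := hδ.1
  have hδ1 := hδ.2
  have hq : 0 < 1 / (1 - ι) := one_div_pos.mpr (by linarith [hι.2])
  set q := 1 / (1 - ι)
  have hH := hd.const_pos one_le_two
  set H := C * 2 ^ lam * 2
  refine ⟨(B * H) ^ q * H * (20 / δ) ^ 2, by positivity, fun a ha => ?_⟩
  have hda : 0 < 1 - ‖a‖ := by linarith
  have hm := hd.cellMass_pos ha
  set m := ENNReal.ofReal (cellMass ω a)
  have hm0 : m ≠ 0 := by simpa [m] using hm
  set R := closedBall a (5 * (δ / 20) * (1 - ‖a‖))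
  have hBH : ENNReal.ofReal (B * H) ≠ 0 := by simp only [ne_eq, ENNReal.ofReal_eq_zero, not_le]; positivity
  have hpt : ∀ z ∈ ball a (δ / 20 * (1 - ‖a‖)),
      (μ R / m) ^ q * kappa ω a ≤ ENNReal.ofReal ((B * H) ^ q * H) *
        ((μ (pseudoDisk z δ) / kappaMass ω (pseudoDisk z δ)) ^ q * kappa ω z) := by
    intro z hz
    have hz1 := mem_disk.mp (ball_subset_disk ha (by linarith) hz)
    obtain ⟨h1, h2⟩ := one_sub_norm_mem_of_mem_closedBall (ball_subset_closedBall hz)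
    have hsub : R ⊆ pseudoDisk z δ := by
      refine subset_trans ?_ (closedBall_subset_pseudoDisk hz1 (t := 2 / 3 * δ) (by linarith) hδ1)
      refine closedBall_subset_closedBall' ?_
      rw [mem_ball, dist_comm] at hz
      nlinarith
    have h3 : kappaMass ω (pseudoDisk z δ) ≤ ENNReal.ofReal (B * H) * m := by
      refine (hκ z hz1).trans ?_
      rw [← ENNReal.ofReal_mul (by positivity), mul_assoc]
      refine ENNReal.ofReal_le_ofReal (mul_le_mul_of_nonneg_left ?_ hB.le)
      exact hd.cellMass_le_mul one_le_two ha hz1 (by nlinarith)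
    have h4 : kappa ω a ≤ ENNReal.ofReal H * kappa ω z :=
      hω.kappa_le_mul hd one_le_two hz1 ha (by nlinarith) (by nlinarith)
    have h5 : μ R / m ≤ ENNReal.ofReal (B * H) *
        (μ (pseudoDisk z δ) / kappaMass ω (pseudoDisk z δ)) := by
      calc μ R / m = ENNReal.ofReal (B * H) * (μ R / (ENNReal.ofReal (B * H) * m)) := by
            rw [← mul_div_assoc, ENNReal.mul_div_mul_left _ _ hBH ENNReal.ofReal_ne_top]
        _ ≤ _ := by gcongr
    calc (μ R / m) ^ q * kappa ω a
        ≤ (ENNReal.ofReal (B * H) * (μ (pseudoDisk z δ) / kappaMass ω (pseudoDisk z δ))) ^ q *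
            (ENNReal.ofReal H * kappa ω z) := by gcongr
      _ = _ := by
          rw [ENNReal.mul_rpow_of_nonneg _ _ hq.le, ENNReal.ofReal_rpow_of_pos (by positivity),
            ENNReal.ofReal_mul (p := (B * H) ^ q) (q := H) (by positivity)]
          ring
  have hint := setLIntegral_mono' (μ := area) measurableSet_ball hpt
  rw [setLIntegral_const, area_ball (by positivity) (ball_subset_disk ha (by linarith)),
    lintegral_const_mul' _ _ ENNReal.ofReal_ne_top] at hint
  calc cellTerm ω μ ι (δ / 20) a = ENNReal.ofReal ((20 / δ) ^ 2) *
        ((μ R / m) ^ q * kappa ω a * ENNReal.ofReal ((δ / 20 * (1 - ‖a‖)) ^ 2)) := by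
        rw [cellTerm, ← hω.kappa_mul_sq ha, mul_pow, ENNReal.ofReal_mul (by positivity)]
        have : ENNReal.ofReal ((20 / δ) ^ 2) * ENNReal.ofReal ((δ / 20) ^ 2) = 1 := by
          rw [← ENNReal.ofReal_mul (by positivity), ← mul_pow]
          simp [hδ0.ne']
        rw [hω.kappa_mul_sq ha]
        calc (μ R / m) ^ q * m = (ENNReal.ofReal ((20 / δ) ^ 2) * ENNReal.ofReal ((δ / 20) ^ 2)) *
              ((μ R / m) ^ q * (kappa ω a * ENNReal.ofReal ((1 - ‖a‖) ^ 2))) := by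
              rw [this, one_mul, hω.kappa_mul_sq ha]
          _ = _ := by ring
    _ ≤ ENNReal.ofReal ((20 / δ) ^ 2) * (ENNReal.ofReal ((B * H) ^ q * H) * _) := by
        gcongr
    _ = _ := by
        rw [← mul_assoc, ← ENNReal.ofReal_mul (by positivity)]
        congr 2
        ring

lemma IsDWeight.cellVanishing_of_ballVanishing {ω : ℂ → ℝ} (hω : IsDWeight ω) {μ : Measure ℂ}
    {ι δ s : ℝ} (hι : ι ∈ Ioo (0 : ℝ) 1) (hδ : δ ∈ Ioo (0 : ℝ) 1) {Z : Set ℂ}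
    (hZ : IsLattice (δ / 20) Z) (h : BallVanishing s (averagedMeasure ω μ ι δ)) :
    CellVanishing ω μ ι s (δ / 20) Z := by
  obtain ⟨K, hK, hcell⟩ := hω.exists_cellTerm_le μ hι hδ
  intro ε hε
  obtain ⟨r₀, hr₀, hr⟩ := h (ε / (K * 2 ^ s)) (by positivity)
  refine ⟨r₀ / 2, by positivity, fun ζ hζ ℓ hℓ hℓr => ?_⟩
  have h1 := hr ζ hζ (2 * ℓ) (by positivity) (by linarith)
  rw [averagedMeasure, withDensity_apply _ (measurableSet_closedBall.inter measurableSet_disk)] at h1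
  calc _ ≤ ∑' a : {a : Z | ‖(a : ℂ) - ζ‖ ≤ ℓ}, ENNReal.ofReal K *
        ∫⁻ z in ball (a : ℂ) (δ / 20 * (1 - ‖(a : ℂ)‖)),
          (μ (pseudoDisk z δ) / kappaMass ω (pseudoDisk z δ)) ^ (1 / (1 - ι)) * kappa ω z ∂area :=
        ENNReal.tsum_le_tsum fun a => hcell a (mem_disk.mp (hZ.subset a.1.2))
    _ ≤ ENNReal.ofReal K * ∫⁻ z in closedBall ζ (2 * ℓ) ∩ disk,
          (μ (pseudoDisk z δ) / kappaMass ω (pseudoDisk z δ)) ^ (1 / (1 - ι)) * kappa ω z ∂area := by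
        rw [ENNReal.tsum_mul_left]
        gcongr
        refine hZ.tsum_setLIntegral_le _ area _ fun a ha => ?_
        have ha1 := mem_disk.mp (hZ.subset a.2)
        have h2 := one_sub_norm_le_norm_sub (a := (a : ℂ)) hζ
        have ha' : ‖(a : ℂ) - ζ‖ ≤ ℓ := ha
        refine subset_inter ?_ (ball_subset_disk ha1 (by linarith [hδ.2]))
        refine ball_subset_closedBall.trans (closedBall_subset_closedBall' ?_)
        rw [dist_eq_norm]
        nlinarith [hδ.1, hδ.2]
    _ ≤ ENNReal.ofReal K * ENNReal.ofReal (ε / (K * 2 ^ s) * (2 * ℓ) ^ s) := by gcongr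
    _ = _ := by
        rw [← ENNReal.ofReal_mul hK.le, Real.mul_rpow two_pos.le hℓ.le]
        congr 1
        field_simp

/-- With `5c ≤ 1/4`, the centre `a` of a cell containing `z` satisfies `|z-a| ≤ (1-|z|)/3 ≤ ℓ/3`, so
doubling the radius captures it. -/
lemma IsLattice.exists_mem_cell {c : ℝ} {Z : Set ℂ} (hZ : IsLattice c Z) (hc : 0 < c)
    (hc1 : c ≤ 1 / 20) {ζ z : ℂ} (hζ : ‖ζ‖ = 1) {ℓ : ℝ} (hz : z ∈ closedBall ζ ℓ ∩ disk) :
    ∃ a : Z, ‖(a : ℂ) - ζ‖ ≤ 2 * ℓ ∧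
      closedBall z (c * (1 - ‖z‖)) ⊆ closedBall (a : ℂ) (5 * c * (1 - ‖(a : ℂ)‖)) := by
  obtain ⟨a, ha, h⟩ := hZ.cover z hz.2
  have hz1 := mem_disk.mp hz.2
  have ha1 := mem_disk.mp (hZ.subset ha)
  refine ⟨⟨a, ha⟩, ?_, h⟩
  have hmem : z ∈ closedBall a (5 * c * (1 - ‖a‖)) :=
    h (mem_closedBall_self (mul_nonneg hc.le (by linarith)))
  have h1 := (one_sub_norm_mem_of_mem_closedBall hmem).1
  have h2 := one_sub_norm_le_norm_sub (a := z) hζ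
  have h3 : ‖z - ζ‖ ≤ ℓ := mem_closedBall_iff_norm.mp hz.1
  rw [mem_closedBall_iff_norm] at hmem
  have h4 : ‖a - ζ‖ ≤ ‖z - a‖ + ‖z - ζ‖ := by
    rw [norm_sub_rev z a]
    refine le_trans (le_of_eq ?_) (norm_add_le _ _)
    congr 1; ring
  show ‖a - ζ‖ ≤ 2 * ℓ
  nlinarith

/-- The parameter `c/4` makes `D(z, c/4)` lie in the Euclidean ball of radius `c(1-|z|)`, hence in
one enlarged cell. There the integrand is at most a constant times the value attached to that cell,
and the area of the cell is at most `(1-|a|)²`. -/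
lemma IsDWeight.ballVanishing_of_cellVanishing {ω : ℂ → ℝ} (hω : IsDWeight ω) {μ : Measure ℂ}
    {ι s c : ℝ} (hι : ι ∈ Ioo (0 : ℝ) 1) (hc : 0 < c) (hc1 : c ≤ 1 / 20) {Z : Set ℂ}
    (hZ : IsLattice c Z) (h : CellVanishing ω μ ι s c Z) :
    BallVanishing s (averagedMeasure ω μ ι (c / 4)) := by
  have : Countable Z := hZ.countable.to_subtype
  obtain ⟨C, lam, γ, hd⟩ := hω.isPowerDoubling
  have hδ : c / 4 ∈ Ioo (0 : ℝ) 1 := ⟨by linarith, by linarith⟩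
  obtain ⟨B, hB, hκ⟩ := hω.exists_le_kappaMass_pseudoDisk hd hδ
  have hq : 0 < 1 / (1 - ι) := one_div_pos.mpr (by linarith [hι.2])
  set q := 1 / (1 - ι)
  have hH := hd.const_pos one_le_two
  set H := C * 2 ^ lam * 2
  set K := (B * H) ^ q * H
  have hK : 0 < K := by positivity
  have hBH : 0 < B * H := by positivity
  have hcell : ∀ z ∈ disk, ∀ a : Z,
      closedBall z (c * (1 - ‖z‖)) ⊆ closedBall (a : ℂ) (5 * c * (1 - ‖(a : ℂ)‖)) →
      (μ (pseudoDisk z (c / 4)) / kappaMass ω (pseudoDisk z (c / 4))) ^ q * kappa ω z ≤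
        ENNReal.ofReal K * ((μ (closedBall (a : ℂ) (5 * c * (1 - ‖(a : ℂ)‖))) /
          ENNReal.ofReal (cellMass ω a)) ^ q * kappa ω a) := by
    intro z hz a ha
    have hz1 := mem_disk.mp hz
    have ha1 := mem_disk.mp (hZ.subset a.2)
    have hsub : pseudoDisk z (c / 4) ⊆ closedBall (a : ℂ) (5 * c * (1 - ‖(a : ℂ)‖)) := by
      refine subset_trans (fun w hw => ?_) ha
      rw [mem_closedBall_iff_norm, norm_sub_rev]
      refine (norm_sub_le_of_mem_pseudoDisk hz1 hδ hw).1.trans ?_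
      refine mul_le_mul_of_nonneg_right ?_ (by linarith)
      rw [div_le_iff₀ (by linarith)]
      nlinarith
    obtain ⟨h1, h2⟩ := one_sub_norm_mem_of_mem_closedBall
      (ha (mem_closedBall_self (mul_nonneg hc.le (by linarith))))
    have hm : ENNReal.ofReal (cellMass ω a) ≤
        ENNReal.ofReal (B * H) * kappaMass ω (pseudoDisk z (c / 4)) := by
      calc ENNReal.ofReal (cellMass ω a) ≤ ENNReal.ofReal (H * cellMass ω z) :=
            ENNReal.ofReal_le_ofReal (hd.cellMass_le_mul one_le_two hz1 ha1 (by nlinarith))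
        _ ≤ ENNReal.ofReal H * (ENNReal.ofReal B * kappaMass ω (pseudoDisk z (c / 4))) := by
            rw [ENNReal.ofReal_mul hH.le]
            gcongr
            exact hκ z hz1
        _ = _ := by rw [← mul_assoc, ← ENNReal.ofReal_mul hH.le, mul_comm H]
    have hBH0 : ENNReal.ofReal (B * H) ≠ 0 := by simpa using hBH
    have h3 : μ (pseudoDisk z (c / 4)) / kappaMass ω (pseudoDisk z (c / 4)) ≤
        ENNReal.ofReal (B * H) * (μ (closedBall (a : ℂ) (5 * c * (1 - ‖(a : ℂ)‖))) /
          ENNReal.ofReal (cellMass ω a)) := by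
      rw [← ENNReal.mul_div_mul_left _ _ hBH0 ENNReal.ofReal_ne_top, mul_div_assoc]
      gcongr
    have h4 : kappa ω z ≤ ENNReal.ofReal H * kappa ω a :=
      hω.kappa_le_mul hd one_le_two ha1 hz1 (by nlinarith) (by nlinarith)
    calc _ ≤ (ENNReal.ofReal (B * H) * (μ (closedBall (a : ℂ) (5 * c * (1 - ‖(a : ℂ)‖))) /
          ENNReal.ofReal (cellMass ω a))) ^ q * (ENNReal.ofReal H * kappa ω a) := by gcongr
      _ = _ := by
          rw [ENNReal.mul_rpow_of_nonneg _ _ hq.le, ENNReal.ofReal_rpow_of_pos hBH,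
            ENNReal.ofReal_mul (p := (B * H) ^ q) (q := H) (by positivity)]
          ring
  intro ε hε
  obtain ⟨r₀, hr₀, hr⟩ := h (ε / (K * 2 ^ s)) (by positivity)
  refine ⟨r₀ / 2, by positivity, fun ζ hζ ℓ hℓ hℓr => ?_⟩
  have hsum := hr ζ hζ (2 * ℓ) (by positivity) (by linarith)
  have hEm : MeasurableSet (closedBall ζ ℓ ∩ disk) :=
    measurableSet_closedBall.inter measurableSet_disk
  rw [averagedMeasure, withDensity_apply _ hEm]
  set g : Z → ℝ≥0∞ := fun a => (μ (closedBall (a : ℂ) (5 * c * (1 - ‖(a : ℂ)‖))) /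
          ENNReal.ofReal (cellMass ω a)) ^ q * kappa ω a
  calc _ ≤ ∫⁻ z in closedBall ζ ℓ ∩ disk, ∑' a : {a : Z | ‖(a : ℂ) - ζ‖ ≤ 2 * ℓ},
        (closedBall (a : ℂ) (5 * c * (1 - ‖(a : ℂ)‖))).indicator
          (fun _ => ENNReal.ofReal K * g a) z ∂area := by
        refine setLIntegral_mono' hEm fun z hz => ?_
        obtain ⟨a, ha, hsub⟩ := hZ.exists_mem_cell hc hc1 hζ hz
        refine le_trans ?_ (ENNReal.le_tsum (⟨a, ha⟩ : {a : Z | ‖(a : ℂ) - ζ‖ ≤ 2 * ℓ}))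
        have hz1 := mem_disk.mp hz.2
        rw [indicator_of_mem (hsub (mem_closedBall_self (mul_nonneg hc.le (by linarith))))]
        exact hcell z hz.2 a hsub
    _ ≤ ∫⁻ z, ∑' a : {a : Z | ‖(a : ℂ) - ζ‖ ≤ 2 * ℓ},
        (closedBall (a : ℂ) (5 * c * (1 - ‖(a : ℂ)‖))).indicator
          (fun _ => ENNReal.ofReal K * g a) z ∂area := setLIntegral_le_lintegral _ _
    _ = ∑' a : {a : Z | ‖(a : ℂ) - ζ‖ ≤ 2 * ℓ}, ENNReal.ofReal K * g a *
          area (closedBall (a : ℂ) (5 * c * (1 - ‖(a : ℂ)‖))) := by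
        rw [lintegral_tsum fun a =>
          (measurable_const.indicator measurableSet_closedBall).aemeasurable]
        refine tsum_congr fun a => ?_
        rw [lintegral_indicator measurableSet_closedBall, setLIntegral_const]
    _ ≤ ∑' a : {a : Z | ‖(a : ℂ) - ζ‖ ≤ 2 * ℓ}, ENNReal.ofReal K * cellTerm ω μ ι c a := by
        refine ENNReal.tsum_le_tsum fun a => ?_
        have ha1 := mem_disk.mp (hZ.subset a.1.2)
        have hda : 0 < 1 - ‖(a : ℂ)‖ := by linarith
        rw [mul_assoc]
        gcongr
        rw [cellTerm, ← hω.kappa_mul_sq ha1, ← mul_assoc, hω.kappa_mul_sq ha1]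
        gcongr
        refine le_trans (measure_mono ?_) (area_ball_le (a : ℂ) hda.le)
        exact closedBall_subset_ball (by nlinarith)
    _ ≤ ENNReal.ofReal K * ENNReal.ofReal (ε / (K * 2 ^ s) * (2 * ℓ) ^ s) := by
        rw [ENNReal.tsum_mul_left]
        gcongr
    _ = _ := by
        rw [← ENNReal.ofReal_mul hK.le, Real.mul_rpow two_pos.le hℓ.le]
        congr 1
        field_simp

/-! ### From the discrete condition to (ii) -/

lemma measure_eq_cellTerm_rpow_mul {ω : ℂ → ℝ} {μ : Measure ℂ} {ι c : ℝ} (hι : ι ∈ Ioo (0 : ℝ) 1)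
    {a : ℂ} (hm : 0 < cellMass ω a) :
    μ (closedBall a (5 * c * (1 - ‖a‖))) =
      cellTerm ω μ ι c a ^ (1 - ι) * ENNReal.ofReal (cellMass ω a) ^ ι := by
  have h1 : 0 < 1 - ι := by linarith [hι.2]
  have hm0 : ENNReal.ofReal (cellMass ω a) ≠ 0 := by simpa using hm
  rw [cellTerm, ENNReal.mul_rpow_of_nonneg _ _ h1.le, ← ENNReal.rpow_mul,
    one_div_mul_cancel h1.ne', ENNReal.rpow_one, mul_assoc (_ / _),
    ← ENNReal.rpow_add _ _ hm0 ENNReal.ofReal_ne_top, sub_add_cancel, ENNReal.rpow_one,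
    ENNReal.div_mul_cancel hm0 ENNReal.ofReal_ne_top]

/-- The submean property on the ball of radius `(1-|a|)/4` about `w`, together with the near
constancy of κ. The factor `16` is `(1/4)^{-2}`. -/
lemma IsDWeight.exists_enorm_rpow_mul_cellMass_le {ω : ℂ → ℝ} (hω : IsDWeight ω) {p : ℝ}
    (hp : 0 < p) : ∃ K : ℝ, 0 < K ∧ ∀ f : ℂ → ℂ, DifferentiableOn ℂ f disk → ∀ a : ℂ, ‖a‖ < 1 →
      ∀ w ∈ closedBall a (1 / 4 * (1 - ‖a‖)),
        ‖f w‖ₑ ^ p * ENNReal.ofReal (cellMass ω a) ≤ ENNReal.ofReal K *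
          ∫⁻ z in closedBall a (1 / 2 * (1 - ‖a‖)),
            ‖disk.indicator f z‖ₑ ^ p * kappa ω z ∂area := by
  obtain ⟨C, lam, γ, hd⟩ := hω.isPowerDoubling
  have hH := hd.const_pos one_le_two
  refine ⟨16 * (C * 2 ^ lam * 2), by positivity, fun f hf a ha w hw => ?_⟩
  set H := C * 2 ^ lam * 2
  have hda : 0 < 1 - ‖a‖ := by linarith
  have hsub : ball w (1 / 4 * (1 - ‖a‖)) ⊆ closedBall a (1 / 2 * (1 - ‖a‖)) := by
    refine ball_subset_closedBall.trans (closedBall_subset_closedBall' ?_)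
    rw [mem_closedBall] at hw
    linarith
  have hdisk := closedBall_subset_disk ha (t := 1 / 2) (by norm_num)
  have h1 := enorm_rpow_le_lintegral_ball hf hp (by positivity) (hsub.trans hdisk)
  have h2 : ENNReal.ofReal ((1 - ‖a‖) ^ 2) =
      ENNReal.ofReal 16 * ENNReal.ofReal ((1 / 4 * (1 - ‖a‖)) ^ 2) := by
    rw [← ENNReal.ofReal_mul (by norm_num)]
    congr 1; ring
  calc ‖f w‖ₑ ^ p * ENNReal.ofReal (cellMass ω a)
      = ENNReal.ofReal 16 *
          ((ENNReal.ofReal ((1 / 4 * (1 - ‖a‖)) ^ 2) * ‖f w‖ₑ ^ p) * kappa ω a) := by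
        rw [← hω.kappa_mul_sq ha, h2]; ring
    _ ≤ ENNReal.ofReal 16 *
          ((∫⁻ z in ball w (1 / 4 * (1 - ‖a‖)), ‖f z‖ₑ ^ p ∂area) * kappa ω a) := by gcongr
    _ ≤ ENNReal.ofReal 16 *
          ∫⁻ z in ball w (1 / 4 * (1 - ‖a‖)), ‖f z‖ₑ ^ p * kappa ω a ∂area := by
        gcongr
        exact lintegral_mul_const_le _ _
    _ ≤ ENNReal.ofReal 16 * ∫⁻ z in ball w (1 / 4 * (1 - ‖a‖)),
          ENNReal.ofReal H * (‖disk.indicator f z‖ₑ ^ p * kappa ω z) ∂area := by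
        gcongr ENNReal.ofReal 16 * ?_
        refine setLIntegral_mono' measurableSet_ball fun z hz => ?_
        have hz1 := hdisk (hsub hz)
        obtain ⟨h3, h4⟩ := one_sub_norm_mem_of_mem_closedBall (hsub hz)
        rw [indicator_of_mem hz1, mul_left_comm]
        gcongr
        exact hω.kappa_le_mul hd one_le_two (mem_disk.mp hz1) ha (by linarith) (by linarith)
    _ = ENNReal.ofReal (16 * H) * ∫⁻ z in ball w (1 / 4 * (1 - ‖a‖)),
          ‖disk.indicator f z‖ₑ ^ p * kappa ω z ∂area := by
        rw [lintegral_const_mul' _ _ ENNReal.ofReal_ne_top, ← mul_assoc,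
          ← ENNReal.ofReal_mul (by norm_num)]
    _ ≤ _ := by gcongr

lemma kappaIntegral_eq_setLIntegral (p : ℝ) (ω : ℂ → ℝ) (f : ℂ → ℂ) :
    kappaIntegral p ω f = ∫⁻ z in disk, ‖disk.indicator f z‖ₑ ^ p * kappa ω z ∂area := by
  rw [kappaIntegral, area_restrict_disk]
  refine lintegral_congr_ae ?_
  filter_upwards [ae_area_mem_disk] with z hz
  rw [indicator_of_mem hz]

/-- The cell masses cancel between the pointwise bound on `f` and `μ(R_a) = T_a^{1-ι} m_a^ι`. Hölder
leaves the norm of `f` to the power `pι`, and the discrete sum to the power `1-ι`. -/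
lemma IsDWeight.uniformlyBallVanishing_of_cellVanishing {ω : ℂ → ℝ} (hω : IsDWeight ω)
    {μ : Measure ℂ} {p ι s c : ℝ} (hp : 0 < p) (hι : ι ∈ Ioo (0 : ℝ) 1) (hc : 0 < c)
    (hc1 : c ≤ 1 / 20) {Z : Set ℂ} (hZ : IsLattice c Z) (h : CellVanishing ω μ ι s c Z) :
    UniformlyBallVanishing p s ι ω μ := by
  have : Countable Z := hZ.countable.to_subtype
  obtain ⟨C, lam, γ, hd⟩ := hω.isPowerDoubling
  obtain ⟨K₁, hK₁, hmean⟩ := hω.exists_enorm_rpow_mul_cellMass_le hp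
  obtain ⟨K₂, hK₂, hover⟩ := hZ.exists_overlap_le hc (by linarith)
  obtain ⟨K₃, hK₃, hequiv⟩ := hω.exists_kappaIntegral_equiv hp
  have hι0 := hι.1
  have hι1 : 0 < 1 - ι := by linarith [hι.2]
  set A := (K₁ * K₂ * K₃) ^ ι
  have hA : 0 < A := by positivity
  intro ε hε
  -- The discrete condition is applied with `D^{1/(1-ι)}`, which becomes `D` after the power `1-ι`;
  -- `A` and the power of `2` cancel the constant and the doubled radius.
  set D := ε / (A * 2 ^ (s * (1 - ι)))
  have hD : 0 < D := by positivity
  obtain ⟨r₀, hr₀, hr⟩ := h (D ^ (1 / (1 - ι))) (by positivity)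
  refine ⟨r₀ / 2, by positivity, fun f hf ζ hζ ℓ hℓ hℓr => ?_⟩
  have hT := hr ζ hζ (2 * ℓ) (by positivity) (by linarith)
  set I : Set Z := {a : Z | ‖(a : ℂ) - ζ‖ ≤ 2 * ℓ}
  set P : Z → ℝ≥0∞ := fun a => ∫⁻ z in closedBall (a : ℂ) (1 / 2 * (1 - ‖(a : ℂ)‖)),
    ‖disk.indicator f z‖ₑ ^ p * kappa ω z ∂area
  have hcell : ∀ a : Z, ∫⁻ z in closedBall (a : ℂ) (5 * c * (1 - ‖(a : ℂ)‖)), ‖f z‖ₑ ^ (p * ι) ∂μ ≤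
      (ENNReal.ofReal K₁ * P a) ^ ι * cellTerm ω μ ι c a ^ (1 - ι) := by
    intro a
    have ha := mem_disk.mp (hZ.subset a.2)
    have hm := hd.cellMass_pos ha
    set m := ENNReal.ofReal (cellMass ω a)
    have hm0 : m ≠ 0 := by simpa [m] using hm
    have hmt : m ≠ ∞ := ENNReal.ofReal_ne_top
    calc _ ≤ ∫⁻ z in closedBall (a : ℂ) (5 * c * (1 - ‖(a : ℂ)‖)),
          (ENNReal.ofReal K₁ * P a / m) ^ ι ∂μ := by
          refine setLIntegral_mono' measurableSet_closedBall fun w hw => ?_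
          rw [ENNReal.rpow_mul]
          gcongr
          rw [ENNReal.le_div_iff_mul_le (Or.inl hm0) (Or.inl hmt)]
          refine hmean f hf.1 a ha w (closedBall_subset_closedBall ?_ hw)
          nlinarith
      _ = (ENNReal.ofReal K₁ * P a) ^ ι / m ^ ι * (cellTerm ω μ ι c a ^ (1 - ι) * m ^ ι) := by
          rw [setLIntegral_const, measure_eq_cellTerm_rpow_mul hι hm,
            ENNReal.div_rpow_of_nonneg _ _ hι0.le]
      _ = _ := by
          rw [mul_comm (_ ^ (1 - ι)), ← mul_assoc, ENNReal.div_mul_cancel]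
          · exact (ENNReal.rpow_pos (pos_iff_ne_zero.mpr hm0) hmt).ne'
          · exact ENNReal.rpow_ne_top_of_nonneg hι0.le hmt
  have hP : ∑' a : I, ENNReal.ofReal K₁ * P a ≤
      ENNReal.ofReal (K₁ * K₂ * K₃) * bergmanNorm p ω f ^ p := by
    rw [ENNReal.tsum_mul_left, ENNReal.ofReal_mul (by positivity), ENNReal.ofReal_mul hK₁.le,
      mul_assoc, mul_assoc]
    gcongr
    refine (hZ.tsum_setLIntegral_le_of_overlap hover
      (G := fun z => ‖disk.indicator f z‖ₑ ^ p * kappa ω z)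
      ((measurable_indicator_disk_enorm_rpow hf.1 p).mul (measurable_kappa ω)) area le_rfl I
      measurableSet_disk subset_rfl fun a _ =>
        closedBall_subset_disk (mem_disk.mp (hZ.subset a.2)) (by norm_num)).trans ?_
    rw [← kappaIntegral_eq_setLIntegral]
    gcongr
    exact (hequiv f hf.1).1
  calc _ ≤ ∫⁻ z in ⋃ a : I, closedBall (a : ℂ) (5 * c * (1 - ‖(a : ℂ)‖)), ‖f z‖ₑ ^ (p * ι) ∂μ := by
        refine lintegral_mono_set fun z hz => ?_
        obtain ⟨a, ha, hsub⟩ := hZ.exists_mem_cell hc hc1 hζ hz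
        have hz1 := mem_disk.mp hz.2
        exact mem_iUnion.mpr ⟨⟨a, ha⟩,
          hsub (mem_closedBall_self (mul_nonneg hc.le (by linarith)))⟩
    _ ≤ ∑' a : I, ∫⁻ z in closedBall (a : ℂ) (5 * c * (1 - ‖(a : ℂ)‖)), ‖f z‖ₑ ^ (p * ι) ∂μ :=
        lintegral_iUnion_le _ _
    _ ≤ ∑' a : I, (ENNReal.ofReal K₁ * P a) ^ ι * cellTerm ω μ ι c a ^ (1 - ι) :=
        ENNReal.tsum_le_tsum fun a => hcell a
    _ ≤ (∑' a : I, ENNReal.ofReal K₁ * P a) ^ ι * (∑' a : I, cellTerm ω μ ι c a) ^ (1 - ι) :=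
        tsum_rpow_mul_rpow_le _ _ hι
    _ ≤ (ENNReal.ofReal (K₁ * K₂ * K₃) * bergmanNorm p ω f ^ p) ^ ι *
          ENNReal.ofReal (D ^ (1 / (1 - ι)) * (2 * ℓ) ^ s) ^ (1 - ι) := by gcongr
    _ = ENNReal.ofReal (A * (D * (2 * ℓ) ^ (s * (1 - ι)))) * bergmanNorm p ω f ^ (p * ι) := by
        rw [ENNReal.mul_rpow_of_nonneg _ _ hι0.le, ← ENNReal.rpow_mul,
          ENNReal.ofReal_rpow_of_pos (by positivity), ENNReal.ofReal_rpow_of_pos (by positivity),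
          Real.mul_rpow (x := D ^ (1 / (1 - ι))) (by positivity) (by positivity), ← Real.rpow_mul hD.le,
          one_div_mul_cancel hι1.ne', Real.rpow_one, ← Real.rpow_mul (by positivity),
          ENNReal.ofReal_mul hA.le]
        ring
    _ = _ := by
        congr 2
        rw [Real.mul_rpow two_pos.le hℓ.le]
        simp only [D]
        field_simp

/-! ### Random sums of bumps: from (ii) to the discrete condition -/

lemma IsDWeight.exists_bergmanNorm_sum_bump_le {ω : ℂ → ℝ} (hω : IsDWeight ω) {p : ℝ} (hp : 0 < p)
    {c : ℝ} {Z : Set ℂ} (hZ : IsLattice c Z) (hc : 0 < c) (hc2 : c ≤ 1 / 2) :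
    ∃ M : ℕ, ∃ K : ℝ, 0 < K ∧ ∀ (F : Finset Z) (x : F → ℂ),
      MemBergman p ω (fun z => ∑ a : F, x a * bump (a : Z) z ^ M) ∧
        bergmanNorm p ω (fun z => ∑ a : F, x a * bump (a : Z) z ^ M) ^ p ≤
          ENNReal.ofReal K * ∑ a : F, ‖x a‖ₑ ^ p * ENNReal.ofReal (cellMass ω (a : Z)) := by
  classical
  obtain ⟨M, K, hK, h⟩ := hω.exists_sum_bump_le hp hZ hc hc2
  obtain ⟨K', hK', hequiv⟩ := hω.exists_kappaIntegral_equiv hp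
  refine ⟨M, K' * K, by positivity, fun F x => ?_⟩
  set f : ℂ → ℂ := fun z => ∑ a : F, x a * bump (a : Z) z ^ M
  have hf : DifferentiableOn ℂ f disk := by
    refine DifferentiableOn.fun_sum fun a _ => ?_
    exact ((differentiableOn_bump (mem_disk.mp (hZ.subset a.1.2))).pow M).const_mul _
  set A : Z → ℝ≥0∞ := fun a => if ha : a ∈ F then ‖x ⟨a, ha⟩‖ₑ else 0
  have hA : ∀ a : F, A a = ‖x a‖ₑ := fun a => by simp [A]
  have hAt : ∀ a, A a ≠ ∞ := by
    intro a
    by_cases ha : a ∈ F <;> simp [A, ha]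
  have h1 := h F A hAt
  rw [← Finset.sum_coe_sort F] at h1
  simp only [hA] at h1
  have hpt : ∀ z, ‖f z‖ₑ ≤ ∑ a ∈ F, A a * ‖bump a z‖ₑ ^ (M : ℝ) := by
    intro z
    rw [← Finset.sum_coe_sort F]
    refine (enorm_sum_le _ _).trans (Finset.sum_le_sum fun a _ => ?_)
    rw [hA, enorm_mul, enorm_pow, ENNReal.rpow_natCast]
  have h2 : bergmanNorm p ω f ^ p ≤ ENNReal.ofReal (K' * K) *
      ∑ a : F, ‖x a‖ₑ ^ p * ENNReal.ofReal (cellMass ω (a : Z)) := by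
    rw [ENNReal.ofReal_mul hK'.le, mul_assoc]
    refine (hequiv f hf).2.trans ?_
    gcongr
    refine le_trans (lintegral_mono fun z => ?_) h1
    gcongr
    exact hpt z
  refine ⟨⟨hf, (ENNReal.rpow_lt_top_iff_of_pos hp).mp (h2.trans_lt ?_)⟩, h2⟩
  refine ENNReal.mul_lt_top ENNReal.ofReal_lt_top (ENNReal.sum_lt_top.mpr fun a _ => ?_)
  exact ENNReal.mul_lt_top (ENNReal.rpow_lt_top_of_nonneg hp.le (by simp)) ENNReal.ofReal_lt_top

lemma third_le_enorm_bump {a z : ℂ} (ha : ‖a‖ < 1) (hz : z ∈ closedBall a (1 / 4 * (1 - ‖a‖))) :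
    ENNReal.ofReal (1 / 3) ≤ ‖bump a z‖ₑ := by
  have hz1 := mem_disk.mp (closedBall_subset_disk ha (by norm_num) hz)
  have h1 := norm_one_sub_conj_pos ha hz1
  have h2 := norm_one_sub_conj_le_of_mem ha hz
  rw [← ofReal_norm, norm_bump ha, ← div_eq_mul_inv]
  refine ENNReal.ofReal_le_ofReal ?_
  rw [le_div_iff₀ h1]
  linarith

lemma IsDWeight.memBergman_one {ω : ℂ → ℝ} (hω : IsDWeight ω) {p : ℝ} (hp : 0 < p) :
    MemBergman p ω fun _ => 1 := by
  refine ⟨differentiableOn_const _, ENNReal.rpow_lt_top_of_nonneg (by positivity) ?_⟩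
  have h1 := hω.integrable.lintegral_lt_top
  rw [area_restrict_disk] at h1
  simpa using h1.ne

/-- The finite form of the estimate obtained by testing on random sums of bumps. -/
lemma IsDWeight.sum_cellTerm_le {ω : ℂ → ℝ} (hω : IsDWeight ω)
    {μ : Measure ℂ} {p ι c : ℝ} (hp : 0 < p) (hι : ι ∈ Ioo (0 : ℝ) 1) (hc : 0 < c)
    (hc1 : c ≤ 1 / 20) {Z : Set ℂ} (hZ : IsLattice c Z) :
    ∃ K : ℝ, 0 < K ∧ ∀ (E : Set ℂ), MeasurableSet E → E ⊆ disk → ∀ D : ℝ≥0∞, D ≠ ∞ →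
      (∀ f, MemBergman p ω f → ∫⁻ z in E, ‖f z‖ₑ ^ (p * ι) ∂μ ≤ D * bergmanNorm p ω f ^ (p * ι)) →
      ∀ F : Finset Z, (∀ a ∈ F, closedBall (a : ℂ) (5 * c * (1 - ‖(a : ℂ)‖)) ⊆ E) →
        (∑ a ∈ F, cellTerm ω μ ι c a) ^ (1 - ι) ≤ ENNReal.ofReal K * D := by
  classical
  obtain ⟨C, lam, γ, hd⟩ := hω.isPowerDoubling
  obtain ⟨M, K₁, hK₁, htest⟩ := hω.exists_bergmanNorm_sum_bump_le hp hZ hc (by linarith)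
  obtain ⟨K₂, hK₂, hover⟩ := hZ.exists_overlap_le hc (by linarith)
  have hι0 := hι.1
  have hι1 : 0 < 1 - ι := by linarith [hι.2]
  have hq : 0 < p * ι := by positivity
  set b : ℝ := ((1 / 3) ^ M) ^ (p * ι)
  have hb : 0 < b := by positivity
  refine ⟨2 * K₂ * K₁ ^ ι / b, by positivity, fun E hE hEd D hDt hED F hF => ?_⟩
  set T : Z → ℝ≥0∞ := fun a => cellTerm ω μ ι c a
  set S := ∑ a ∈ F, T a
  set m : Z → ℝ≥0∞ := fun a => ENNReal.ofReal (cellMass ω a)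
  set R : Z → Set ℂ := fun a => closedBall (a : ℂ) (5 * c * (1 - ‖(a : ℂ)‖))
  have hZ1 : ∀ a : Z, ‖(a : ℂ)‖ < 1 := fun a => mem_disk.mp (hZ.subset a.2)
  have hm0 : ∀ a, m a ≠ 0 := fun a => by simpa [m] using hd.cellMass_pos (hZ1 a)
  have hmt : ∀ a, m a ≠ ∞ := fun a => ENNReal.ofReal_ne_top
  -- Testing on the constant `1` makes `μ E` finite. Hence the sum `S` is finite, which permits the
  -- final division by `S ^ ι`.
  have hEt : μ E ≠ ∞ := by
    have h1 := hED _ (hω.memBergman_one hp)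
    have h2 : ∫⁻ z in E, ‖(1 : ℂ)‖ₑ ^ (p * ι) ∂μ = μ E := by simp
    rw [h2] at h1
    refine ne_top_of_le_ne_top (ENNReal.mul_ne_top hDt ?_) h1
    exact ENNReal.rpow_ne_top_of_nonneg hq.le (hω.memBergman_one hp).2.ne
  have hTt : ∀ a ∈ F, T a ≠ ∞ := by
    intro a ha
    refine ENNReal.mul_ne_top (ENNReal.rpow_ne_top_of_nonneg (by positivity) ?_) (hmt a)
    exact ENNReal.div_ne_top (ne_top_of_le_ne_top hEt (measure_mono (hF a ha))) (hm0 a)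
  have hSt : S ≠ ∞ := ENNReal.sum_ne_top.mpr hTt
  -- Normalised so that `|x a|^p m a = T a`, which bounds the norm of every signed sum by `K₁ S`.
  set x : F → ℂ := fun a => (((T a / m a) ^ (1 / p)).toReal : ℂ)
  have hx : ∀ a : F, ‖x a‖ₑ = (T a / m a) ^ (1 / p) := by
    intro a
    rw [← ofReal_norm, Complex.norm_real, Real.norm_of_nonneg ENNReal.toReal_nonneg,
      ENNReal.ofReal_toReal]
    exact ENNReal.rpow_ne_top_of_nonneg (by positivity) (ENNReal.div_ne_top (hTt a a.2) (hm0 a))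
  set N : ℝ≥0∞ := (Fintype.card (F → Bool) : ℝ≥0∞)
  have hN0 : N ≠ 0 := by simp [N]
  have hNt : N ≠ ∞ := ENNReal.natCast_ne_top _
  set f : (F → Bool) → ℂ → ℂ := fun σ z =>
    ∑ a : F, ((if σ a then (1 : ℂ) else -1) * x a) * bump (a : Z) z ^ M
  have hfS : ∀ σ, MemBergman p ω (f σ) ∧ bergmanNorm p ω (f σ) ^ p ≤ ENNReal.ofReal K₁ * S := by
    intro σ
    refine ⟨(htest F _).1, (htest F _).2.trans (le_of_eq ?_)⟩
    congr 1
    simp only [S]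
    rw [← Finset.sum_coe_sort F]
    refine Finset.sum_congr rfl fun a _ => ?_
    have h1 : ‖(if σ a then (1 : ℂ) else -1) * x a‖ₑ = ‖x a‖ₑ := by
      split_ifs <;> simp
    rw [h1, hx, ← ENNReal.rpow_mul, one_div_mul_cancel hp.ne', ENNReal.rpow_one]
    exact ENNReal.div_mul_cancel (hm0 a) (hmt a)
  set G : ℂ → ℝ≥0∞ := fun z => ∑ σ, ‖f σ z‖ₑ ^ (p * ι)
  have hfm : ∀ σ, Measurable (f σ) := fun σ =>
    Finset.measurable_fun_sum _ fun a _ => ((measurable_bump _).pow_const M).const_mul _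
  have hG : Measurable G := Finset.measurable_fun_sum _ fun σ _ => (hfm σ).enorm.pow_const _
  have hcell : ∀ a ∈ F, N * ENNReal.ofReal b * T a ≤ 2 * ∫⁻ z in R a, G z ∂μ := by
    intro a ha
    -- The exponent `1/(1-ι)` in the cell term is exactly what makes this identity hold, so
    -- integrating the lower bound for `G` over the cell returns `T a`.
    have hT : T a = (T a / m a) ^ ι * μ (R a) := by
      rw [measure_eq_cellTerm_rpow_mul hι (hd.cellMass_pos (hZ1 a)),
        ENNReal.div_rpow_of_nonneg _ _ hι0.le, mul_comm (_ ^ (1 - ι)), ← mul_assoc,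
        ENNReal.div_mul_cancel, ← ENNReal.rpow_add_of_nonneg _ _ hι0.le hι1.le,
        add_sub_cancel, ENNReal.rpow_one]
      · exact (ENNReal.rpow_pos (pos_iff_ne_zero.mpr (hm0 a)) (hmt a)).ne'
      · exact ENNReal.rpow_ne_top_of_nonneg hι0.le (hmt a)
    have hpt : ∀ z ∈ R a, N * ENNReal.ofReal b * (T a / m a) ^ ι ≤ 2 * G z := by
      intro z hz
      have h1 := card_mul_enorm_rpow_le_sum_signs
        (fun i : F => x i * bump (i : Z) z ^ M) hq ⟨a, ha⟩
      have h2 : ∑ σ : F → Bool, ‖∑ i : F, (if σ i then (1 : ℂ) else -1) *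
          (x i * bump (i : Z) z ^ M)‖ₑ ^ (p * ι) = G z := by
        simp only [G, f, mul_assoc]
      rw [h2] at h1
      refine le_trans ?_ h1
      have h3 : ENNReal.ofReal (1 / 3) ≤ ‖bump (a : ℂ) z‖ₑ := by
        refine third_le_enorm_bump (hZ1 a) (closedBall_subset_closedBall ?_ hz)
        nlinarith [hZ1 a]
      have h4 : ‖x ⟨a, ha⟩‖ₑ ^ (p * ι) = (T a / m a) ^ ι := by
        rw [hx, ← ENNReal.rpow_mul]
        congr 1
        field_simp
      rw [mul_assoc, enorm_mul, enorm_pow, ENNReal.mul_rpow_of_nonneg _ _ hq.le, h4,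
        mul_comm (ENNReal.ofReal b), ← ENNReal.ofReal_rpow_of_pos (by positivity),
        ENNReal.ofReal_pow (by norm_num)]
      gcongr
    calc N * ENNReal.ofReal b * T a = ∫⁻ _ in R a, N * ENNReal.ofReal b * (T a / m a) ^ ι ∂μ := by
          rw [setLIntegral_const, mul_assoc _ (_ ^ ι), ← hT]
      _ ≤ ∫⁻ z in R a, 2 * G z ∂μ := setLIntegral_mono' measurableSet_closedBall hpt
      _ = _ := lintegral_const_mul' _ _ (by simp)
  have hmain : N * (ENNReal.ofReal b * S) ≤
      N * (2 * ENNReal.ofReal K₂ * D * ENNReal.ofReal (K₁ ^ ι) * S ^ ι) := by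
    calc N * (ENNReal.ofReal b * S) = ∑ a ∈ F, N * ENNReal.ofReal b * T a := by
          rw [← mul_assoc, Finset.mul_sum]
      _ ≤ ∑ a ∈ F, 2 * ∫⁻ z in R a, G z ∂μ := Finset.sum_le_sum hcell
      _ = 2 * ∑' a : (F : Set Z), ∫⁻ z in R a, G z ∂μ := by
          rw [← Finset.mul_sum, Finset.tsum_subtype' F fun a => ∫⁻ z in R a, G z ∂μ]
      _ ≤ 2 * (ENNReal.ofReal K₂ * ∫⁻ z in E, G z ∂μ) := by
          gcongr
          exact hZ.tsum_setLIntegral_le_of_overlap hover hG μ (by linarith) _ hE hEd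
            fun a ha => hF a ha
      _ = 2 * (ENNReal.ofReal K₂ * ∑ σ, ∫⁻ z in E, ‖f σ z‖ₑ ^ (p * ι) ∂μ) := by
          rw [lintegral_finsetSum _ fun σ _ => (hfm σ).enorm.pow_const _]
      _ ≤ 2 * (ENNReal.ofReal K₂ * ∑ _σ : F → Bool, D * (ENNReal.ofReal K₁ * S) ^ ι) := by
          gcongr with σ
          refine (hED _ (hfS σ).1).trans ?_
          rw [ENNReal.rpow_mul]
          gcongr
          exact (hfS σ).2
      _ = _ := by
          rw [Finset.sum_const, Finset.card_univ, nsmul_eq_mul,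
            ENNReal.mul_rpow_of_nonneg _ _ hι0.le, ENNReal.ofReal_rpow_of_pos hK₁]
          ring
  -- The number of sign patterns cancels, leaving `b S ≤ C D S^ι`.
  have hmain' := (ENNReal.mul_le_mul_iff_right hN0 hNt).mp hmain
  rcases eq_or_ne S 0 with hS0 | hS0
  · rw [hS0, ENNReal.zero_rpow_of_pos hι1]
    exact zero_le
  have hSι0 : S ^ ι ≠ 0 := (ENNReal.rpow_pos (pos_iff_ne_zero.mpr hS0) hSt).ne'
  have hSιt : S ^ ι ≠ ∞ := ENNReal.rpow_ne_top_of_nonneg hι0.le hSt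
  have hb0 : ENNReal.ofReal b ≠ 0 := by simpa using hb
  rw [← ENNReal.mul_le_mul_iff_right hb0 ENNReal.ofReal_ne_top,
    ← ENNReal.mul_le_mul_iff_left hSι0 hSιt, mul_assoc,
    ← ENNReal.rpow_add_of_nonneg _ _ hι1.le hι0.le, sub_add_cancel, ENNReal.rpow_one]
  refine hmain'.trans (le_of_eq ?_)
  rw [← mul_assoc (ENNReal.ofReal b), ← ENNReal.ofReal_mul hb.le, mul_div_cancel₀ _ hb.ne',
    ENNReal.ofReal_mul (by positivity), ENNReal.ofReal_mul two_pos.le, ENNReal.ofReal_ofNat]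
  ring

/-- If `|a-ζ| ≤ ℓ`, the cell of `a` has radius at most `ℓ/4`, so it lies in the boundary ball of
radius `2ℓ`. The finite estimate on that ball is uniform in the finite set of points. -/
lemma IsDWeight.cellVanishing_of_uniformlyBallVanishing {ω : ℂ → ℝ} (hω : IsDWeight ω)
    {μ : Measure ℂ} {p ι s c : ℝ} (hp : 0 < p) (hι : ι ∈ Ioo (0 : ℝ) 1) (hc : 0 < c)
    (hc1 : c ≤ 1 / 20) {Z : Set ℂ} (hZ : IsLattice c Z) (h : UniformlyBallVanishing p s ι ω μ) :
    CellVanishing ω μ ι s c Z := by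
  obtain ⟨K, hK, hcell⟩ := hω.sum_cellTerm_le (μ := μ) hp hι hc hc1 hZ
  have hι1 : 0 < 1 - ι := by linarith [hι.2]
  intro ε hε
  obtain ⟨r₀, hr₀, hr⟩ := h (ε ^ (1 - ι) / (K * 2 ^ (s * (1 - ι)))) (by positivity)
  refine ⟨r₀ / 2, by positivity, fun ζ hζ ℓ hℓ hℓr => ?_⟩
  rw [ENNReal.tsum_eq_iSup_sum]
  refine iSup_le fun F => ?_
  have h1 := hcell (closedBall ζ (2 * ℓ) ∩ disk) (measurableSet_closedBall.inter measurableSet_disk)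
    inter_subset_right _ ENNReal.ofReal_ne_top
    (fun f hf => hr f hf ζ hζ (2 * ℓ) (by positivity) (by linarith))
    (F.map (Function.Embedding.subtype _)) (by
      intro a ha
      obtain ⟨⟨a, ha'⟩, -, rfl⟩ := Finset.mem_map.mp ha
      have ha1 := mem_disk.mp (hZ.subset a.2)
      have h2 := one_sub_norm_le_norm_sub (a := (a : ℂ)) hζ
      have ha' : ‖(a : ℂ) - ζ‖ ≤ ℓ := ha'
      refine subset_inter (closedBall_subset_closedBall' ?_)
        (closedBall_subset_disk ha1 (by linarith))
      rw [dist_eq_norm]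
      show 5 * c * (1 - ‖(a : ℂ)‖) + ‖(a : ℂ) - ζ‖ ≤ _
      nlinarith)
  rw [Finset.sum_map] at h1
  rw [← ENNReal.rpow_le_rpow_iff hι1, ENNReal.ofReal_rpow_of_pos (by positivity)]
  refine h1.trans (le_of_eq ?_)
  rw [← ENNReal.ofReal_mul hK.le, Real.mul_rpow two_pos.le hℓ.le,
    Real.mul_rpow hε.le (by positivity), ← Real.rpow_mul hℓ.le]
  congr 1
  field_simp

end WeightedBergman

theorem proposition2 (ω : ℂ → ℝ) (hω : WeightedBergman.IsDWeight ω)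
    (μ : MeasureTheory.Measure ℂ) (hμ : μ (WeightedBergman.disk)ᶜ = 0)
    (p s ι : ℝ) (hp : 0 < p) (hs : 1 ≤ s) (hι : ι ∈ Set.Ioo (0 : ℝ) 1) :
    (∃ δ ∈ Set.Ioo (0 : ℝ) 1,
      WeightedBergman.IsVanishingCarleson s (WeightedBergman.averagedMeasure ω μ ι δ)) ↔
    WeightedBergman.UniformlyVanishing p s ι ω μ := by
  rw [WeightedBergman.uniformlyVanishing_iff]
  constructor
  · rintro ⟨δ, hδ, h⟩
    rw [WeightedBergman.isVanishingCarleson_iff] at h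
    have hc : 0 < δ / 20 := by linarith [hδ.1]
    obtain ⟨Z, hZ⟩ := WeightedBergman.exists_isLattice hc
    exact hω.uniformlyBallVanishing_of_cellVanishing hp hι hc (by linarith [hδ.2]) hZ
      (hω.cellVanishing_of_ballVanishing hι hδ hZ h)
  · intro h
    obtain ⟨Z, hZ⟩ := WeightedBergman.exists_isLattice (c := 1 / 20) (by norm_num)
    -- The lattice scale `1/20` is the largest admitted by the cell estimates, and pseudohyperbolic
    -- disks of a quarter of that scale fit into single cells.
    refine ⟨1 / 20 / 4, by norm_num, (WeightedBergman.isVanishingCarleson_iff s _).mpr ?_⟩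
    exact hω.ballVanishing_of_cellVanishing hι (by norm_num) le_rfl hZ
      (hω.cellVanishing_of_uniformlyBallVanishing hp hι (by norm_num) le_rfl hZ h)
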